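/- A tree is a (finite or infinite, locally finite) planar rooted tree whose root has degree $1$; trees are considered up to isomorphism of planar rooted trees. For a tree $T$ let $|T|$ be its number of edges, $h(T)$ its height, $D_r(T)$ the set of vertices at graph distance $r$ from the root, $B_r(T)$ the subtree spanned by the vertices at distance at most $r$ from the root, and $|B_r(T)|$ the number of edges of $B_r(T)$. The set $\mathcal T$ of all trees carries the metric $\mathrm{dist}(T,T')=\inf\{1/r : r\ge 1,\ B_r(T)=B_r(T')\}$ and its Borel $\sigma$-algebra. A tree is one-sided if the path that starts at the root and follows the leftmost offspring as long as there is one has length $h(T)$; $\Omega_N$ is the (finite) set of one-sided trees with $N$ edges. For $\mu\in\mathbb R$ and $N\ge1$ let $W_N^{(\mu)}=\sum_{T\in\Omega_N}e^{-\mu h(T)}$, and let $\tau_N^{(\mu)}$ be the probability measure on $\mathcal T$ that is concentrated on $\Omega_N$ with $\tau_N^{(\mu)}(\{T\})=e^{-\mu h(T)}/W_N^{(\mu)}$ for $T\in\Omega_N$. Put $\mu_0=-\ln 2$. Let $g_c(\mu)$ be the radius of convergence of $\sum_{N\ge1} W_N^{(\mu)}g^N$, let $X(g)=\sum_{T}g^{|T|}$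 (sum over all finite trees), and let $m=m(\mu)=\sum_{n\ge0}n\,p(n)$ be the mean of the offspring distribution $p(n)=X(g_c(\mu))^n\,(1-X(g_c(\mu)))$. (i) Let $\mu<\mu_0$. The measures $\tau_N^{(\mu)}$ converge weakly, as $N\to\infty$, to a probability measure $\tau^{(\mu)}$ on $\mathcal T$. Moreover $m=\frac{X(g_c(\mu))}{1-X(g_c(\mu))}\in(0,1)$. For every $r$ the functions $|D_r|$ and $|B_r|$ are $\tau^{(\mu)}$-integrable, and their expectations with respect to $\tau^{(\mu)}$ satisfy, for $r\ge 1$, $$\mathbb E_\mu(|D_r|)=\frac1{1-m}+O(m^{r-1}),\qquad \mathbb E_\mu(|B_r|)=\frac r{1-m}+O(1),$$ with implied constants independent of $r$ (they may depend on $\mu$). (ii) The measures $\tau_N^{(\mu_0)}$ converge weakly, as $N\to\infty$, to a probability measure $\tau^{(\mu_0)}$ on $\mathcal T$. For every $r$ the functions $|D_r|$ and $|B_r|$ are $\tau^{(\mu_0)}$-integrable, and their expectations with respect to $\tau^{(\mu_0)}$ satisfy, for $r\ge1$, $$\mathbb E_{\mu_0}(|D_r|)=r,\qquad \mathbb E_{\mu_0}(|B_r|)=\tfrac12r^2+O(r),$$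 with an implied constant independent of $r$. -/

import Mathlib

open MeasureTheory Filter Topology
open scoped BoundedContinuousFunction ENNReal

noncomputable section

/-- A (possibly infinite, locally finite) planar rooted tree whose root has degree `1`, in its
canonical Ulam-Harris coding: a vertex is the word of the positions (counted from the left, starting
with `0`) of the vertices on the path leading to it from the root, among the offspring of their
parents. The root is the empty word, and the offspring of `w` are `w ++ [0], ..., w ++ [k - 1]`. -/
@[ext]
structure PlanarTree where
  verts : Set (List ℕ)
  root_mem : [] ∈ verts
  parent_mem : ∀ (w : List ℕ) (n : ℕ), w ++ [n] ∈ verts → w ∈ verts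
  left_mem : ∀ (w : List ℕ) (n : ℕ), w ++ [n + 1] ∈ verts → w ++ [n] ∈ verts
  finite_offspring : ∀ w : List ℕ, {n : ℕ | w ++ [n] ∈ verts}.Finite
  root_degree_one : ∀ n : ℕ, [n] ∈ verts ↔ n = 0

namespace PlanarTree

/-- `D_r(T)`: the vertices at graph distance `r` from the root. -/
def level (T : PlanarTree) (r : ℕ) : Set (List ℕ) := {w ∈ T.verts | w.length = r}

/-- The vertices of the ball `B_r(T)` of radius `r` around the root. Since `verts` is closed under
taking parents, equality of balls as planar trees is equality of these sets. -/
def ball (T : PlanarTree) (r : ℕ) : Set (List ℕ) := {w ∈ T.verts | w.length ≤ r}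

theorem level_finite (T : PlanarTree) (r : ℕ) : (T.level r).Finite := by
  induction r with
  | zero =>
    refine (Set.finite_singleton ([] : List ℕ)).subset ?_
    rintro w ⟨-, hw⟩
    exact List.length_eq_zero_iff.mp hw
  | succ r ih =>
    have h : (⋃ w ∈ T.level r, (fun n => w ++ [n]) '' {n : ℕ | w ++ [n] ∈ T.verts}).Finite :=
      ih.biUnion fun w _ => (T.finite_offspring w).image _
    refine h.subset ?_
    rintro w ⟨hw, hl⟩
    rcases List.eq_nil_or_concat w with rfl | ⟨v, n, rfl⟩
    · simp at hl
    · rw [List.concat_eq_append] at hw hl ⊢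
      simp only [Set.mem_iUnion]
      refine ⟨v, ⟨T.parent_mem v n hw, by simpa using hl⟩, n, hw, rfl⟩

/-- The edges of the tree; an edge is represented by its endpoint further away from the root. -/
def edges (T : PlanarTree) : Set (List ℕ) := {w ∈ T.verts | w ≠ []}

/-- The size `|T|`: the number of edges. -/
def size (T : PlanarTree) : ℕ∞ := T.edges.encard

/-- The height `h(T)`: the maximal distance of a vertex from the root (`⊤` for infinite trees). -/
def height (T : PlanarTree) : ℕ∞ := ⨆ w ∈ T.verts, (w.length : ℕ∞)

/-- The length of the path that starts at the root and follows the leftmost offspring as long as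
there is one, that is, the path with vertices `[], [0], [0, 0], ...`. -/
def leftmostPathLength (T : PlanarTree) : ℕ∞ :=
  ⨆ (k : ℕ) (_ : List.replicate k 0 ∈ T.verts), (k : ℕ∞)

/-- One-sided trees: the leftmost path has length `h(T)`. -/
def IsOneSided (T : PlanarTree) : Prop := T.leftmostPathLength = T.height

/-- `|D_r(T)|`. -/
def levelCard (T : PlanarTree) (r : ℕ) : ℕ := (T.level r).ncard

/-- `|B_r(T)|`: the size (number of edges) of the ball of radius `r` around the root. -/
def ballSize (T : PlanarTree) (r : ℕ) : ℕ := (T.ball r ∩ T.edges).ncard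

/-- The numbers `1 / r`, `r ≥ 1`, such that the balls of radius `r` in `T` and `T'` agree. -/
def distSet (T T' : PlanarTree) : Set ℝ := {x | ∃ r : ℕ, 1 ≤ r ∧ T.ball r = T'.ball r ∧ x = 1 / r}

theorem ball_one (T : PlanarTree) : T.ball 1 = {[], [0]} := by
  ext w
  rcases w with _ | ⟨n, _ | ⟨k, w⟩⟩
  · simp [ball, T.root_mem]
  · simp [ball, T.root_degree_one]
  · simp [ball]

theorem one_mem_distSet (T T' : PlanarTree) : (1 : ℝ) ∈ distSet T T' :=
  ⟨1, le_rfl, by rw [ball_one, ball_one], by simp⟩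

theorem nonneg_of_mem_distSet {T T' : PlanarTree} {x : ℝ} (hx : x ∈ distSet T T') : 0 ≤ x := by
  obtain ⟨r, -, -, rfl⟩ := hx
  positivity

theorem bddBelow_distSet (T T' : PlanarTree) : BddBelow (distSet T T') :=
  ⟨0, fun _ => nonneg_of_mem_distSet⟩

theorem distSet_comm (T T' : PlanarTree) : distSet T T' = distSet T' T := by
  ext x
  simp only [distSet, Set.mem_ofPred_eq, eq_comm]

theorem ball_eq_of_le {T T' : PlanarTree} {r s : ℕ} (hrs : r ≤ s) (h : T.ball s = T'.ball s) :
    T.ball r = T'.ball r := by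
  ext w
  have hw := Set.ext_iff.mp h w
  simp only [ball, Set.mem_ofPred_eq] at hw ⊢
  constructor
  · exact fun h1 => ⟨(hw.mp ⟨h1.1, h1.2.trans hrs⟩).1, h1.2⟩
  · exact fun h1 => ⟨(hw.mpr ⟨h1.1, h1.2.trans hrs⟩).1, h1.2⟩

theorem max_mem_distSet {T₁ T₂ T₃ : PlanarTree} {x y : ℝ} (hx : x ∈ distSet T₁ T₂)
    (hy : y ∈ distSet T₂ T₃) : max x y ∈ distSet T₁ T₃ := by
  obtain ⟨r, hr, hb, rfl⟩ := hx
  obtain ⟨s, hs, hc, rfl⟩ := hy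
  have hr0 : (0 : ℝ) < r := by exact_mod_cast hr
  have hs0 : (0 : ℝ) < s := by exact_mod_cast hs
  rcases le_total r s with h | h
  · refine ⟨r, hr, hb.trans (ball_eq_of_le h hc), max_eq_left ?_⟩
    exact one_div_le_one_div_of_le hr0 (by exact_mod_cast h)
  · refine ⟨s, hs, (ball_eq_of_le h hb).trans hc, max_eq_right ?_⟩
    exact one_div_le_one_div_of_le hs0 (by exact_mod_cast h)

/-- The metric `dist(T, T') = inf {1 / r | r ≥ 1, B_r(T) = B_r(T')}`. -/
instance : MetricSpace PlanarTree where
  dist T T' := sInf (distSet T T')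
  dist_self T := by
    refine le_antisymm (le_of_forall_pos_lt_add fun ε hε => ?_)
      (le_csInf ⟨1, one_mem_distSet T T⟩ fun x hx => nonneg_of_mem_distSet hx)
    obtain ⟨n, hn⟩ := exists_nat_one_div_lt hε
    refine (csInf_le (bddBelow_distSet T T) ⟨n + 1, by omega, rfl, rfl⟩).trans_lt ?_
    push_cast
    linarith
  dist_comm T T' := congrArg sInf (distSet_comm T T')
  dist_triangle T₁ T₂ T₃ := by
    have key : ∀ x ∈ distSet T₁ T₂, ∀ y ∈ distSet T₂ T₃, sInf (distSet T₁ T₃) ≤ x + y := by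
      intro x hx y hy
      refine (csInf_le (bddBelow_distSet _ _) (max_mem_distSet hx hy)).trans ?_
      exact max_le (le_add_of_nonneg_right (nonneg_of_mem_distSet hy))
        (le_add_of_nonneg_left (nonneg_of_mem_distSet hx))
    have key2 : ∀ x ∈ distSet T₁ T₂,
        sInf (distSet T₁ T₃) - x ≤ sInf (distSet T₂ T₃) := fun x hx =>
      le_csInf ⟨1, one_mem_distSet _ _⟩ fun y hy => by linarith [key x hx y hy]
    have key3 : sInf (distSet T₁ T₃) - sInf (distSet T₂ T₃) ≤ sInf (distSet T₁ T₂) :=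
      le_csInf ⟨1, one_mem_distSet _ _⟩ fun x hx => by linarith [key2 x hx]
    linarith
  eq_of_dist_eq_zero {T T'} h := by
    have hn : ∀ n : ℕ, T.ball n = T'.ball n := by
      intro n
      have hpos : (0 : ℝ) < 1 / ((n : ℝ) + 1) := by positivity
      obtain ⟨x, ⟨r, hr, hb, rfl⟩, hx⟩ :=
        exists_lt_of_csInf_lt ⟨1, one_mem_distSet T T'⟩ (h.trans_lt hpos)
      have hr0 : (0 : ℝ) < r := by exact_mod_cast hr
      have h1 : (n : ℝ) + 1 < r := (one_div_lt_one_div hr0 (by positivity)).mp hx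
      have h2 : n ≤ r := by
        have : (n : ℝ) ≤ r := by linarith
        exact_mod_cast this
      exact ball_eq_of_le h2 hb
    ext w
    have hw := Set.ext_iff.mp (hn w.length) w
    simpa [ball] using hw

instance : MeasurableSpace PlanarTree := borel PlanarTree

instance : BorelSpace PlanarTree := ⟨rfl⟩

/-- `Ω_N`: the one-sided trees of size `N`. -/
def oneSided (N : ℕ) : Set PlanarTree := {T | T.IsOneSided ∧ T.size = N}

/-- The weight `e^{-μ h(T)}` of a finite tree. -/
def weight (μ : ℝ) (T : PlanarTree) : ℝ := Real.exp (-μ * (T.height.toNat : ℝ))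

/-- The partition function `W_N^{(μ)}`, the (finite) sum of the weights over `Ω_N`. -/
def partitionFunction (μ : ℝ) (N : ℕ) : ℝ := ∑' T : oneSided N, weight μ T

/-- The finite size measure `τ_N^{(μ)}` on the space of all trees: it is concentrated on `Ω_N` and
gives mass `e^{-μ h(T)} / W_N^{(μ)}` to `T ∈ Ω_N`. -/
def finiteSizeMeasure (μ : ℝ) (N : ℕ) : Measure PlanarTree :=
  Measure.sum fun T : oneSided N =>
    ENNReal.ofReal (weight μ T / partitionFunction μ N) • Measure.dirac (T : PlanarTree)

/-- `τ` is the local limit `τ^{(μ)}`: a Borel probability measure which is the weak limit of the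
measures `τ_N^{(μ)}` as `N → ∞`. -/
def IsLocalLimit (μ : ℝ) (τ : Measure PlanarTree) : Prop :=
  IsProbabilityMeasure τ ∧ ∀ F : PlanarTree →ᵇ ℝ,
    Tendsto (fun N : ℕ => ∫ T, F T ∂(finiteSizeMeasure μ N)) atTop (𝓝 (∫ T, F T ∂τ))

/-- `g_c(μ)`: the radius of convergence of the power series `∑_N W_N^{(μ)} g^N`. -/
def criticalPoint (μ : ℝ) : ℝ :=
  (FormalMultilinearSeries.ofScalars ℝ (partitionFunction μ)).radius.toReal

/-- `X(g)`: the generating function `∑_T g^{|T|}` of all finite planar trees. -/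
def generatingFunction (g : ℝ) : ℝ := ∑' T : {T : PlanarTree // T.verts.Finite}, g ^ T.1.size.toNat

/-- The offspring probabilities `p(n) = X(g_c(μ))^n (1 - X(g_c(μ)))`. -/
def offspringProb (μ : ℝ) (n : ℕ) : ℝ :=
  generatingFunction (criticalPoint μ) ^ n * (1 - generatingFunction (criticalPoint μ))

/-- The mean `m = ∑_n n p(n)` of the offspring distribution. -/
def offspringMean (μ : ℝ) : ℝ := ∑' n : ℕ, (n : ℝ) * offspringProb μ n

end PlanarTree

end

/-! Put y = e^{-μ}; both cases have y ≥ 2. Let X_n be the generating series of trees of height at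
most n and X that of all finite trees. Cutting at the first vertex gives X_{n+1} = g/(1 - X_n) and
X(1 - X) = g; cutting along the leftmost path, the one-sided trees of height n have series X_1 ⋯
X_n. So Σ W_N g^N = Σ V_n with V_n = y^{n+1} X_1 ⋯ X_{n+1}. For g = ξ(1 - ξ), ξ ≤ 1/2, one has X_n →
X = ξ, and Σ V_n becomes singular at ξ = 1/y: g_c = y⁻¹(1 - y⁻¹), X(g_c) = 1/y and m = 1/(y - 1).

The asymptotics of W_N use no complex analysis. Put b_N = W_N g_c^N. The recursions give (y - 1)(b_N
- b_{N+1}) as a normalised coefficient of y Σ V_n (X_{n+2} - X_n), so b_N decreases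
(`normCount_sub`). Monotonicity makes elementary Tauberian arguments work: b_N is bounded below if y
> 2 (`normCount_ge_of_two_lt`) and of order 1/N if y = 2 (`normCount_two_le`, `normCount_two_ge`).
Tree counts, normalised by g_c, are at most N^{-3/2} and hence negligible against b_N. It follows
that b_{N-j}/b_N → 1, and that each additional branch contributes a factor X(g_c) = 1/y in the limit
(`tendsto_weightedSum_pow`).

A tree of Ω_N with a prescribed ball of radius r + 1 is that ball with independent trees attached at
level r + 1, the leftmost of them one-sided (`represents_oneSided_ball`). Therefore the probability
of the ball tends to g_c^{|B_r|} y^r y^{-(|D_{r+1}| - 1)}. This is its probability for an infinite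
leftmost path whose vertices other than the root have an independent geometric number of further
offspring, all other vertices having geometric offspring too (`spineLaw_cylinder`). As the limit is
known to be a probability measure, convergence on balls implies weak convergence
(`tendsto_of_cylinder`) and no separate tightness proof is needed.

In the limit tree E|D_{r+1}| = m E|D_r| + 1 for r ≥ 1, so E|D_r| = 1 + m + ⋯ + m^{r-1}. Both
expansions follow, with m = 1 when y = 2. -/

noncomputable section

/-! ### Formal power series of trees and of one-sided trees -/

namespace PlanarTree

open PowerSeries in
/-- All coefficients of the power series are nonnegative. -/
def CoeffNonneg (P : PowerSeries ℝ) : Prop := ∀ n, 0 ≤ coeff n P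

namespace CoeffNonneg

open PowerSeries

variable {P Q : PowerSeries ℝ}

theorem zero : CoeffNonneg 0 := fun n => by simp

theorem one : CoeffNonneg 1 := fun n => by
  rw [coeff_one]; split_ifs <;> norm_num

theorem X : CoeffNonneg PowerSeries.X := fun n => by
  rw [coeff_X]; split_ifs <;> norm_num

theorem C {a : ℝ} (ha : 0 ≤ a) : CoeffNonneg (PowerSeries.C a) := fun n => by
  rw [coeff_C]; split_ifs <;> simp [ha]

theorem add (hP : CoeffNonneg P) (hQ : CoeffNonneg Q) : CoeffNonneg (P + Q) := fun n => by
  rw [map_add]; exact add_nonneg (hP n) (hQ n)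

theorem mul (hP : CoeffNonneg P) (hQ : CoeffNonneg Q) : CoeffNonneg (P * Q) := fun n => by
  rw [coeff_mul]; exact Finset.sum_nonneg fun _ _ => mul_nonneg (hP _) (hQ _)

theorem pow (hP : CoeffNonneg P) (k : ℕ) : CoeffNonneg (P ^ k) := by
  induction k with
  | zero => simpa using one
  | succ k ih => rw [pow_succ]; exact ih.mul hP

theorem prod {ι : Type*} (s : Finset ι) {f : ι → PowerSeries ℝ} (h : ∀ i ∈ s, CoeffNonneg (f i)) :
    CoeffNonneg (∏ i ∈ s, f i) := by
  classical
  induction s using Finset.induction_on with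
  | empty => simpa using one
  | insert a s ha ih =>
    rw [Finset.prod_insert ha]
    exact (h a (by simp)).mul (ih fun i hi => h i (by simp [hi]))

end CoeffNonneg

/-- A power series without constant term satisfies the geometric series identity. -/
theorem one_sub_mul_inv {P : PowerSeries ℝ} (h0 : PowerSeries.constantCoeff P = 0) :
    (1 - P) * (1 - P)⁻¹ = 1 :=
  PowerSeries.mul_inv_cancel _ (by simp [h0])

theorem coeff_inv_one_sub {P : PowerSeries ℝ} (h0 : PowerSeries.constantCoeff P = 0) (n : ℕ) :
    PowerSeries.coeff n (1 - P)⁻¹ = (if n = 0 then 1 else 0) +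
      ∑ p ∈ Finset.HasAntidiagonal.antidiagonal n, PowerSeries.coeff p.1 P * PowerSeries.coeff p.2 (1 - P)⁻¹ := by
  have h : (1 - P)⁻¹ = 1 + P * (1 - P)⁻¹ := by
    linear_combination one_sub_mul_inv h0
  conv_lhs => rw [h]
  rw [map_add, PowerSeries.coeff_one, PowerSeries.coeff_mul]

theorem CoeffNonneg.inv_one_sub {P : PowerSeries ℝ} (hP : CoeffNonneg P)
    (h0 : PowerSeries.constantCoeff P = 0) : CoeffNonneg (1 - P)⁻¹ := by
  intro n
  induction n using Nat.strong_induction_on with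
  | _ n ih =>
    rw [coeff_inv_one_sub h0]
    refine add_nonneg (by split_ifs <;> norm_num) (Finset.sum_nonneg fun p hp => ?_)
    rw [Finset.HasAntidiagonal.mem_antidiagonal] at hp
    rcases Nat.eq_zero_or_pos p.1 with h | h
    · rw [h, PowerSeries.coeff_zero_eq_constantCoeff_apply, h0, zero_mul]
    · exact mul_nonneg (hP _) (ih _ (by omega))

/-- The generating series, by the number of edges, of the trees of height at most `n`. -/
def heightSeries : ℕ → PowerSeries ℝ
  | 0 => 0
  | n + 1 => PowerSeries.X * (1 - heightSeries n)⁻¹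

/-- The generating series, by the number of edges, of all finite trees. -/
def treeSeries : PowerSeries ℝ :=
  PowerSeries.X * PowerSeries.map (Nat.castRingHom ℝ) PowerSeries.catalanSeries

theorem heightSeries_zero : heightSeries 0 = 0 := rfl

theorem heightSeries_succ (n : ℕ) :
    heightSeries (n + 1) = PowerSeries.X * (1 - heightSeries n)⁻¹ := rfl

theorem constantCoeff_heightSeries (n : ℕ) :
    PowerSeries.constantCoeff (heightSeries n) = 0 := by
  cases n <;> simp [heightSeries]

theorem constantCoeff_treeSeries : PowerSeries.constantCoeff treeSeries = 0 := by
  simp [treeSeries]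

theorem heightSeries_succ_mul (n : ℕ) :
    heightSeries (n + 1) * (1 - heightSeries n) = PowerSeries.X := by
  rw [heightSeries_succ]
  linear_combination PowerSeries.X * one_sub_mul_inv (constantCoeff_heightSeries n)

theorem heightSeries_one : heightSeries 1 = PowerSeries.X := by
  have := heightSeries_succ_mul 0
  simpa [heightSeries_zero] using this

theorem treeSeries_mul : treeSeries * (1 - treeSeries) = PowerSeries.X := by
  have h := congrArg (PowerSeries.map (Nat.castRingHom ℝ)) PowerSeries.catalanSeries_sq_mul_X_add_one
  simp only [map_add, map_mul, map_pow, PowerSeries.map_X, map_one] at h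
  rw [treeSeries]
  linear_combination -PowerSeries.X * h

theorem treeSeries_eq : treeSeries = PowerSeries.X * (1 - treeSeries)⁻¹ := by
  linear_combination (1 - treeSeries)⁻¹ * treeSeries_mul
    - treeSeries * one_sub_mul_inv constantCoeff_treeSeries

theorem coeffNonneg_heightSeries (n : ℕ) : CoeffNonneg (heightSeries n) := by
  induction n with
  | zero => exact CoeffNonneg.zero
  | succ n ih => exact CoeffNonneg.X.mul (ih.inv_one_sub (constantCoeff_heightSeries n))

theorem coeff_treeSeries_succ (n : ℕ) :
    PowerSeries.coeff (n + 1) treeSeries = (catalan n : ℝ) := by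
  rw [treeSeries, PowerSeries.coeff_succ_X_mul]
  simp

theorem coeffNonneg_treeSeries : CoeffNonneg treeSeries := by
  intro n
  cases n with
  | zero => simp [constantCoeff_treeSeries]
  | succ n => rw [coeff_treeSeries_succ]; positivity

/-- The difference g/(1 - a) - g/(1 - b) = g(a - b)/((1 - a)(1 - b)) propagates nonnegativity along
the recursion. -/
theorem coeffNonneg_heightSeries_succ_sub (n : ℕ) :
    CoeffNonneg (heightSeries (n + 1) - heightSeries n) := by
  induction n with
  | zero => rw [heightSeries_zero, sub_zero]; exact coeffNonneg_heightSeries 1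
  | succ n ih =>
    have h : heightSeries (n + 2) - heightSeries (n + 1) = PowerSeries.X *
        ((1 - heightSeries (n + 1))⁻¹ * (1 - heightSeries n)⁻¹ *
          (heightSeries (n + 1) - heightSeries n)) := by
      have h1 := heightSeries_succ n
      rw [heightSeries_succ (n + 1)]
      linear_combination -h1 + PowerSeries.X * (1 - heightSeries n)⁻¹ *
          one_sub_mul_inv (constantCoeff_heightSeries (n + 1)) - PowerSeries.X *
          (1 - heightSeries (n + 1))⁻¹ * one_sub_mul_inv (constantCoeff_heightSeries n)
    rw [h]
    exact CoeffNonneg.X.mul ((((coeffNonneg_heightSeries _).inv_one_sub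
      (constantCoeff_heightSeries _)).mul ((coeffNonneg_heightSeries _).inv_one_sub
      (constantCoeff_heightSeries _))).mul ih)

theorem treeSeries_sub_heightSeries_succ (n : ℕ) :
    treeSeries - heightSeries (n + 1) = PowerSeries.X *
      ((1 - treeSeries)⁻¹ * (1 - heightSeries n)⁻¹ * (treeSeries - heightSeries n)) := by
  rw [heightSeries_succ]
  conv_lhs => rw [treeSeries_eq]
  linear_combination PowerSeries.X * (1 - heightSeries n)⁻¹ *
      one_sub_mul_inv constantCoeff_treeSeries - PowerSeries.X *
      (1 - treeSeries)⁻¹ * one_sub_mul_inv (constantCoeff_heightSeries n)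

theorem coeffNonneg_treeSeries_sub (n : ℕ) : CoeffNonneg (treeSeries - heightSeries n) := by
  induction n with
  | zero => rw [heightSeries_zero, sub_zero]; exact coeffNonneg_treeSeries
  | succ n ih =>
    rw [treeSeries_sub_heightSeries_succ]
    exact CoeffNonneg.X.mul (((coeffNonneg_treeSeries.inv_one_sub
      constantCoeff_treeSeries).mul ((coeffNonneg_heightSeries _).inv_one_sub
      (constantCoeff_heightSeries _))).mul ih)

/-- A tree with at most n edges has height at most n. Algebraically, each step of the recursion for
X - X_n gains a factor g. -/
theorem X_pow_dvd_treeSeries_sub (n : ℕ) :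
    (PowerSeries.X : PowerSeries ℝ) ^ (n + 1) ∣ treeSeries - heightSeries n := by
  induction n with
  | zero => rw [heightSeries_zero, sub_zero, pow_one]; exact Dvd.intro _ rfl
  | succ n ih =>
    rw [treeSeries_sub_heightSeries_succ, pow_succ']
    exact mul_dvd_mul_left _ (ih.mul_left _)

theorem coeff_heightSeries_eq {N n : ℕ} (h : N ≤ n) :
    PowerSeries.coeff N (heightSeries n) = PowerSeries.coeff N treeSeries := by
  have := PowerSeries.X_pow_dvd_iff.mp (X_pow_dvd_treeSeries_sub n) N (by omega)
  rw [map_sub] at this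
  linarith

theorem coeff_heightSeries_le (N n : ℕ) :
    PowerSeries.coeff N (heightSeries n) ≤ PowerSeries.coeff N treeSeries := by
  have := coeffNonneg_treeSeries_sub n N
  rw [map_sub] at this
  linarith

/-- `P - Q` is nonnegative on powers. -/
theorem CoeffNonneg.pow_sub_pow {P Q : PowerSeries ℝ} (hQ : CoeffNonneg Q)
    (h : CoeffNonneg (P - Q)) (k : ℕ) : CoeffNonneg (P ^ k - Q ^ k) := by
  have hP : CoeffNonneg P := by simpa using h.add hQ
  induction k with
  | zero => simpa using CoeffNonneg.zero
  | succ k ih =>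
    have : P ^ (k + 1) - Q ^ (k + 1) = (P ^ k - Q ^ k) * P + Q ^ k * (P - Q) := by ring
    rw [this]
    exact (ih.mul hP).add ((hQ.pow k).mul h)

/-- X - X² = g has nonnegative coefficients, so X dominates its powers. A bounded number of tree
factors can thus be absorbed into a single one. -/
theorem coeffNonneg_treeSeries_sub_pow (k : ℕ) :
    CoeffNonneg (treeSeries - treeSeries ^ (k + 1)) := by
  induction k with
  | zero => simpa using CoeffNonneg.zero
  | succ k ih =>
    have : treeSeries - treeSeries ^ (k + 2) =
        (treeSeries - treeSeries ^ (k + 1)) * treeSeries + PowerSeries.X := by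
      linear_combination treeSeries_mul
    rw [this]
    exact (ih.mul coeffNonneg_treeSeries).add CoeffNonneg.X

theorem coeffNonneg_heightSeries_sub {m n : ℕ} (h : m ≤ n) :
    CoeffNonneg (heightSeries n - heightSeries m) := by
  induction n, h using Nat.le_induction with
  | base => simpa using CoeffNonneg.zero
  | succ n _ ih => simpa using (coeffNonneg_heightSeries_succ_sub n).add ih

/-- The generating series of the one-sided trees of height `n`. -/
def oneSidedSeries (n : ℕ) : PowerSeries ℝ := ∏ j ∈ Finset.range n, heightSeries (j + 1)

/-- The generating series of the one-sided trees of height `n + 1`, weighted by `y ^ (n + 1)`. -/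
def weightedSeries (y : ℝ) (n : ℕ) : PowerSeries ℝ :=
  PowerSeries.C (y ^ (n + 1)) * oneSidedSeries (n + 1)

theorem oneSidedSeries_succ (n : ℕ) :
    oneSidedSeries (n + 1) = oneSidedSeries n * heightSeries (n + 1) := Finset.prod_range_succ _ _

theorem coeffNonneg_oneSidedSeries (n : ℕ) : CoeffNonneg (oneSidedSeries n) :=
  CoeffNonneg.prod _ fun _ _ => coeffNonneg_heightSeries _

theorem coeffNonneg_weightedSeries {y : ℝ} (hy : 0 ≤ y) (n : ℕ) :
    CoeffNonneg (weightedSeries y n) :=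
  (CoeffNonneg.C (by positivity)).mul (coeffNonneg_oneSidedSeries _)

theorem X_pow_dvd_oneSidedSeries (n : ℕ) :
    (PowerSeries.X : PowerSeries ℝ) ^ n ∣ oneSidedSeries n := by
  induction n with
  | zero => simp
  | succ n ih =>
    rw [oneSidedSeries_succ, pow_succ]
    exact mul_dvd_mul ih ⟨_, heightSeries_succ n⟩

theorem coeff_weightedSeries_mul_eq_zero (y : ℝ) (P : PowerSeries ℝ) {N n : ℕ} (h : N ≤ n) :
    PowerSeries.coeff N (weightedSeries y n * P) = 0 := by
  have h1 : (PowerSeries.X : PowerSeries ℝ) ^ (n + 1) ∣ weightedSeries y n * P :=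
    ((X_pow_dvd_oneSidedSeries (n + 1)).mul_left _).mul_right _
  exact PowerSeries.X_pow_dvd_iff.mp h1 N (by omega)

theorem weightedSeries_succ (y : ℝ) (n : ℕ) :
    weightedSeries y (n + 1) = PowerSeries.C y * (weightedSeries y n * heightSeries (n + 2)) := by
  rw [weightedSeries, weightedSeries, oneSidedSeries_succ (n + 1), pow_succ, map_mul]
  ring

theorem weightedSeries_zero (y : ℝ) :
    weightedSeries y 0 = PowerSeries.C y * PowerSeries.X := by
  rw [weightedSeries, oneSidedSeries, zero_add, Finset.prod_range_one, zero_add, heightSeries_one,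
    pow_one]

theorem weightedSeries_succ_mul (y : ℝ) (n : ℕ) :
    weightedSeries y (n + 1) * heightSeries (n + 1) =
      weightedSeries y (n + 1) - PowerSeries.C y * PowerSeries.X * weightedSeries y n := by
  rw [weightedSeries_succ]
  linear_combination (-PowerSeries.C y * weightedSeries y n) * heightSeries_succ_mul (n + 1)

/-- The coefficients of `∑ₙ Vₙ cₙ`, where `Vₙ` is the weighted series of the one-sided trees of
height `n + 1`. -/
def weightedSum (y : ℝ) (c : ℕ → PowerSeries ℝ) (N : ℕ) : ℝ :=
  ∑ n ∈ Finset.range N, PowerSeries.coeff N (weightedSeries y n * c n)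

theorem weightedSum_eq (y : ℝ) (c : ℕ → PowerSeries ℝ) {N M : ℕ} (h : N ≤ M) :
    weightedSum y c N = ∑ n ∈ Finset.range M, PowerSeries.coeff N (weightedSeries y n * c n) := by
  rw [weightedSum]
  refine Finset.sum_subset (Finset.range_mono h) fun n _ hn => ?_
  exact coeff_weightedSeries_mul_eq_zero _ _ (by simpa using hn)

/-- The coefficient of `g ^ N` in the grand canonical partition function. -/
def weightedCount (y : ℝ) (N : ℕ) : ℝ := weightedSum y (fun _ => 1) N

/-- V_{n+1} = y V_n X_{n+2} evaluates the sum with X_{n+2}, and V_{n+1} X_{n+1} = V_{n+1} - y g V_n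
the sum with X_n. What remains is linear in Σ V_n, up to boundary terms. -/
theorem partial_sum_identity (y : ℝ) (M : ℕ) :
    PowerSeries.C y * ∑ n ∈ Finset.range (M + 1),
        weightedSeries y n * (heightSeries (n + 2) - heightSeries n) =
      (1 - PowerSeries.C y) * ∑ n ∈ Finset.range (M + 1), weightedSeries y n +
      (weightedSeries y (M + 1) - weightedSeries y 0) + PowerSeries.C y * weightedSeries y 0 +
      PowerSeries.C y ^ 2 * PowerSeries.X * ∑ n ∈ Finset.range M, weightedSeries y n := by
  induction M with
  | zero =>
    simp only [zero_add, Finset.sum_range_one, Finset.sum_range_zero, heightSeries_zero]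
    have := weightedSeries_succ y 0
    rw [zero_add] at this
    rw [this]
    ring
  | succ M ih =>
    rw [Finset.sum_range_succ _ (M + 1), mul_add, ih, Finset.sum_range_succ _ (M + 1),
      Finset.sum_range_succ _ M]
    have h1 := weightedSeries_succ y (M + 1)
    have h2 := weightedSeries_succ_mul y M
    linear_combination -h1 - PowerSeries.C y * h2

theorem weightedSum_sub_eq (y : ℝ) {N : ℕ} (hN : 1 ≤ N) :
    y * weightedSum y (fun n => heightSeries (n + 2) - heightSeries n) (N + 1) =
      (1 - y) * weightedCount y (N + 1) + y ^ 2 * weightedCount y N := by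
  have h := congrArg (PowerSeries.coeff (N + 1)) (partial_sum_identity y (N + 1))
  -- V_0 = y g lives in degree 1 only; this is where N ≥ 1 enters.
  have h0 : PowerSeries.coeff (N + 1) (weightedSeries y 0) = 0 := by
    rw [weightedSeries_zero, PowerSeries.coeff_C_mul, PowerSeries.coeff_X, if_neg (by omega),
      mul_zero]
  have h1 : PowerSeries.coeff (N + 1) (weightedSeries y (N + 1 + 1)) = 0 := by
    simpa using coeff_weightedSeries_mul_eq_zero y 1 (show N + 1 ≤ N + 1 + 1 by omega)
  have e1 : (1 - PowerSeries.C y : PowerSeries ℝ) = PowerSeries.C (1 - y) := by simp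
  rw [e1, ← map_pow, mul_assoc, map_add, map_add, map_add, PowerSeries.coeff_C_mul,
    PowerSeries.coeff_C_mul, PowerSeries.coeff_C_mul, PowerSeries.coeff_C_mul, map_sub, h0, h1,
    PowerSeries.coeff_succ_X_mul, map_sum, map_sum, map_sum] at h
  rw [weightedSum_eq y _ (show N + 1 ≤ N + 1 + 1 by omega), h, weightedCount, weightedCount,
    weightedSum_eq y _ (show N + 1 ≤ N + 1 + 1 by omega),
    weightedSum_eq y _ (show N ≤ N + 1 by omega)]
  simp

end PlanarTree

end

/-! ### Values of the series inside the disc of convergence -/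

noncomputable section

namespace PlanarTree

/-- The power series `P` converges at `g` with sum `v`. -/
def SumsTo (P : PowerSeries ℝ) (g v : ℝ) : Prop :=
  HasSum (fun n => PowerSeries.coeff n P * g ^ n) v

theorem hasSum_congr_left {f g : ℕ → ℝ} {v : ℝ} (h : HasSum f v) (hfg : ∀ n, g n = f n) :
    HasSum g v := by
  rwa [funext hfg]

theorem SumsTo.mul {P Q : PowerSeries ℝ} {g v w : ℝ} (hg : 0 ≤ g) (hP : CoeffNonneg P)
    (hQ : CoeffNonneg Q) (h : SumsTo P g v) (h' : SumsTo Q g w) : SumsTo (P * Q) g (v * w) := by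
  obtain ⟨p, hp⟩ : ∃ p : ℕ → ℝ, p = fun n => PowerSeries.coeff n P * g ^ n := ⟨_, rfl⟩
  obtain ⟨q, hq⟩ : ∃ q : ℕ → ℝ, q = fun n => PowerSeries.coeff n Q * g ^ n := ⟨_, rfl⟩
  have hp0 : 0 ≤ p := fun n => by rw [hp]; exact mul_nonneg (hP n) (pow_nonneg hg n)
  have hq0 : 0 ≤ q := fun n => by rw [hq]; exact mul_nonneg (hQ n) (pow_nonneg hg n)
  have h1 : HasSum p v := by rw [hp]; exact h
  have h2 : HasSum q w := by rw [hq]; exact h'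
  have hs : Summable fun x : ℕ × ℕ => p x.1 * q x.2 :=
    h1.summable.mul_of_nonneg h2.summable hp0 hq0
  have h3 := (summable_sum_mul_antidiagonal_of_summable_mul hs).hasSum
  rw [← h1.summable.tsum_mul_tsum_eq_tsum_sum_antidiagonal h2.summable hs, h1.tsum_eq,
    h2.tsum_eq] at h3
  refine hasSum_congr_left h3 fun n => ?_
  rw [PowerSeries.coeff_mul, Finset.sum_mul]
  refine Finset.sum_congr rfl fun x hx => ?_
  rw [← Finset.HasAntidiagonal.mem_antidiagonal.mp hx, pow_add, hp, hq]
  ring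

theorem SumsTo.pow {P : PowerSeries ℝ} {g v : ℝ} (hg : 0 ≤ g) (hP : CoeffNonneg P)
    (h : SumsTo P g v) (k : ℕ) : SumsTo (P ^ k) g (v ^ k) := by
  induction k with
  | zero =>
    have := hasSum_single (f := fun n => PowerSeries.coeff n (1 : PowerSeries ℝ) * g ^ n) 0
      (fun n hn => by simp [PowerSeries.coeff_one, hn])
    simpa [SumsTo] using this
  | succ k ih => rw [pow_succ, pow_succ]; exact ih.mul hg (hP.pow k) hP h

theorem SumsTo.sub {P Q : PowerSeries ℝ} {g v w : ℝ} (h : SumsTo P g v) (h' : SumsTo Q g w) :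
    SumsTo (P - Q) g (v - w) := by
  refine hasSum_congr_left (HasSum.sub h h') fun n => ?_
  rw [map_sub, sub_mul]

theorem SumsTo.const_mul {P : PowerSeries ℝ} {g v : ℝ} (a : ℝ) (h : SumsTo P g v) :
    SumsTo (PowerSeries.C a * P) g (a * v) := by
  refine hasSum_congr_left (HasSum.mul_left a h) fun n => ?_
  rw [PowerSeries.coeff_C_mul, mul_assoc]

theorem sumsTo_X (g : ℝ) : SumsTo PowerSeries.X g g := by
  have := hasSum_single (f := fun n => PowerSeries.coeff n (PowerSeries.X : PowerSeries ℝ) * g ^ n)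
    1 (fun n hn => by simp [PowerSeries.coeff_X, hn])
  simpa [SumsTo] using this

/-- The recursion I = 1 + P I shows that a partial sum s of I satisfies s ≤ 1 + v s, which gives
convergence; the value then comes from (1 - P) I = 1. -/
theorem SumsTo.inv_one_sub {P : PowerSeries ℝ} {g v : ℝ} (hg : 0 ≤ g) (hP : CoeffNonneg P)
    (h0 : PowerSeries.constantCoeff P = 0) (h : SumsTo P g v) (hv : v < 1) :
    SumsTo (1 - P)⁻¹ g (1 - v)⁻¹ := by
  have hI := hP.inv_one_sub h0
  set I := (1 - P)⁻¹ with hIdef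
  have hv1 : 0 < 1 - v := by linarith
  have hbound : ∀ M, ∑ n ∈ Finset.range M, PowerSeries.coeff n I * g ^ n ≤ (1 - v)⁻¹ := by
    intro M
    have h1 : ∑ n ∈ Finset.range M, PowerSeries.coeff n I * g ^ n ≤
        1 + v * ∑ n ∈ Finset.range M, PowerSeries.coeff n I * g ^ n := by
      have e1 : ∀ n, PowerSeries.coeff n I * g ^ n = (if n = 0 then 1 else 0) +
          ∑ p ∈ Finset.HasAntidiagonal.antidiagonal n,
            (PowerSeries.coeff p.1 P * g ^ p.1) * (PowerSeries.coeff p.2 I * g ^ p.2) := by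
        intro n
        rw [hIdef, coeff_inv_one_sub h0, ← hIdef, add_mul, Finset.sum_mul]
        congr 1
        · split_ifs with hn <;> simp [hn]
        · refine Finset.sum_congr rfl fun p hp => ?_
          rw [← Finset.HasAntidiagonal.mem_antidiagonal.mp hp, pow_add]
          ring
      conv_lhs => rw [Finset.sum_congr rfl fun n _ => e1 n, Finset.sum_add_distrib]
      refine add_le_add ?_ ?_
      · rw [Finset.sum_ite_eq']
        split_ifs <;> norm_num
      -- The antidiagonals below M are disjoint and lie in the square `range M ×ˢ range M`.
      · rw [← Finset.sum_biUnion fun a _ b _ hab => Finset.disjoint_left.mpr fun p hp hp' =>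
          hab ((Finset.HasAntidiagonal.mem_antidiagonal.mp hp).symm.trans
            (Finset.HasAntidiagonal.mem_antidiagonal.mp hp'))]
        calc _ ≤ ∑ x ∈ Finset.range M ×ˢ Finset.range M,
              (PowerSeries.coeff x.1 P * g ^ x.1) * (PowerSeries.coeff x.2 I * g ^ x.2) := by
              refine Finset.sum_le_sum_of_subset_of_nonneg ?_ fun x _ _ => mul_nonneg
                (mul_nonneg (hP _) (pow_nonneg hg _)) (mul_nonneg (hI _) (pow_nonneg hg _))
              intro x hx
              simp only [Finset.mem_biUnion, Finset.mem_range,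
                Finset.HasAntidiagonal.mem_antidiagonal, Finset.mem_product] at hx ⊢
              obtain ⟨n, hn, hx⟩ := hx
              omega
          _ = (∑ n ∈ Finset.range M, PowerSeries.coeff n P * g ^ n) *
                ∑ n ∈ Finset.range M, PowerSeries.coeff n I * g ^ n := by
              rw [Finset.sum_mul_sum, Finset.sum_product]
          _ ≤ v * ∑ n ∈ Finset.range M, PowerSeries.coeff n I * g ^ n := by
              refine mul_le_mul_of_nonneg_right ?_ (Finset.sum_nonneg fun n _ =>
                mul_nonneg (hI n) (by positivity))
              exact sum_le_hasSum _ (fun n _ => mul_nonneg (hP n) (by positivity)) h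
    rw [← one_div, le_div_iff₀ hv1]
    linarith
  have hsum : Summable fun n => PowerSeries.coeff n I * g ^ n :=
    summable_of_sum_range_le (fun n => mul_nonneg (hI n) (by positivity)) hbound
  obtain ⟨w, hw⟩ := hsum
  have h2 : SumsTo (P * I) g (v * w) := h.mul hg hP hI hw
  have h3 : SumsTo (I - P * I) g (w - v * w) := SumsTo.sub hw h2
  have h4 : I - P * I = 1 := by linear_combination one_sub_mul_inv h0
  rw [h4] at h3
  have h5 : SumsTo 1 g 1 := by simpa using (sumsTo_X g).pow hg CoeffNonneg.X 0
  have h6 : w - v * w = 1 := h3.unique h5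
  have : w = (1 - v)⁻¹ := by
    rw [← one_div, eq_div_iff hv1.ne']
    linarith
  rw [← this]
  exact hw

/-- The value of the generating series of trees of height at most `n`. -/
def heightValue (g : ℝ) : ℕ → ℝ
  | 0 => 0
  | n + 1 => g * (1 - heightValue g n)⁻¹

/-- ξ is a fixed point of the increasing map v ↦ ξ(1 - ξ)/(1 - v), iterated from 0. -/
theorem heightValue_le {ξ : ℝ} (h0 : 0 < ξ) (h1 : ξ < 1) (n : ℕ) :
    heightValue (ξ * (1 - ξ)) n ≤ ξ := by
  induction n with
  | zero => exact h0.le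
  | succ n ih =>
    rw [heightValue, ← div_eq_mul_inv, div_le_iff₀ (by linarith)]
    nlinarith

/-- The factor n/(n + 1) is exact at ξ = 1/2; for smaller ξ it survives the recursion as a lower
bound. -/
theorem le_heightValue {ξ : ℝ} (h0 : 0 < ξ) (h1 : ξ ≤ 1 / 2) (n : ℕ) :
    ξ * (n / (n + 1)) ≤ heightValue (ξ * (1 - ξ)) n := by
  induction n with
  | zero => simp [heightValue]
  | succ n ih =>
    have h2 := heightValue_le h0 (by linarith) n
    have hn : (0 : ℝ) < n + 1 := by positivity
    have hn2 : (0 : ℝ) < n + 2 := by positivity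
    have h3 : 0 < 1 - ξ * (n / (n + 1) : ℝ) := by
      have : (n / (n + 1) : ℝ) ≤ 1 := by rw [div_le_one hn]; linarith
      nlinarith
    calc ξ * (((n + 1 : ℕ) : ℝ) / ((n + 1 : ℕ) + 1)) ≤
          ξ * (1 - ξ) / (1 - ξ * (n / (n + 1) : ℝ)) := by
            rw [le_div_iff₀ h3]
            push_cast
            have e : (n + 1 + 1 : ℝ) = n + 2 := by ring
            rw [e, mul_assoc]
            refine mul_le_mul_of_nonneg_left ?_ h0.le
            have : ((n : ℝ) + 1) / (n + 2) * (1 - ξ * (n / (n + 1))) =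
                (n + 1 - ξ * n) / (n + 2) := by field_simp
            rw [this, div_le_iff₀ hn2]
            nlinarith
      _ ≤ _ := by
            rw [heightValue, ← div_eq_mul_inv]
            exact div_le_div_of_nonneg_left (by nlinarith) (by linarith) (by linarith)

theorem heightValue_nonneg {ξ : ℝ} (h0 : 0 < ξ) (h1 : ξ ≤ 1 / 2) (n : ℕ) :
    0 ≤ heightValue (ξ * (1 - ξ)) n :=
  le_trans (by positivity) (le_heightValue h0 h1 n)

theorem tendsto_heightValue {ξ : ℝ} (h0 : 0 < ξ) (h1 : ξ ≤ 1 / 2) :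
    Tendsto (heightValue (ξ * (1 - ξ))) atTop (𝓝 ξ) := by
  have h := (tendsto_natCast_div_add_atTop (𝕜 := ℝ) (1 : ℝ)).const_mul ξ
  rw [mul_one] at h
  exact tendsto_of_tendsto_of_tendsto_of_le_of_le h tendsto_const_nhds
    (fun n => le_heightValue h0 h1 n) (fun n => heightValue_le h0 (by linarith) n)

theorem sumsTo_heightSeries {ξ : ℝ} (h0 : 0 < ξ) (h1 : ξ ≤ 1 / 2) (n : ℕ) :
    SumsTo (heightSeries n) (ξ * (1 - ξ)) (heightValue (ξ * (1 - ξ)) n) := by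
  have hg : 0 ≤ ξ * (1 - ξ) := by nlinarith
  induction n with
  | zero => simp [SumsTo, heightSeries_zero, heightValue, hasSum_zero]
  | succ n ih =>
    rw [heightSeries_succ, heightValue]
    have := heightValue_le h0 (by linarith) n
    exact (sumsTo_X _).mul hg CoeffNonneg.X ((coeffNonneg_heightSeries n).inv_one_sub
      (constantCoeff_heightSeries n)) (ih.inv_one_sub hg (coeffNonneg_heightSeries n)
      (constantCoeff_heightSeries n) (by linarith))

/-- Below degree M the series X and X_M agree, so partial sums are at most ξ; conversely X ≥ X_n
coefficientwise and the values of X_n tend to ξ. -/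
theorem sumsTo_treeSeries {ξ : ℝ} (h0 : 0 < ξ) (h1 : ξ ≤ 1 / 2) :
    SumsTo treeSeries (ξ * (1 - ξ)) ξ := by
  have hg : 0 ≤ ξ * (1 - ξ) := by nlinarith
  have hnn : ∀ n, 0 ≤ PowerSeries.coeff n treeSeries * (ξ * (1 - ξ)) ^ n := fun n =>
    mul_nonneg (coeffNonneg_treeSeries n) (by positivity)
  have hb : ∀ M, ∑ n ∈ Finset.range M, PowerSeries.coeff n treeSeries * (ξ * (1 - ξ)) ^ n ≤ ξ := by
    intro M
    calc _ = ∑ n ∈ Finset.range M, PowerSeries.coeff n (heightSeries M) * (ξ * (1 - ξ)) ^ n := by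
          refine Finset.sum_congr rfl fun n hn => ?_
          rw [coeff_heightSeries_eq (Finset.mem_range.mp hn).le]
      _ ≤ heightValue (ξ * (1 - ξ)) M := sum_le_hasSum _ (fun n _ =>
          mul_nonneg (coeffNonneg_heightSeries M n) (by positivity)) (sumsTo_heightSeries h0 h1 M)
      _ ≤ ξ := heightValue_le h0 (by linarith) M
  have hs := summable_of_sum_range_le hnn hb
  have h2 : ∑' n, PowerSeries.coeff n treeSeries * (ξ * (1 - ξ)) ^ n = ξ := by
    refine le_antisymm (Real.tsum_le_of_sum_range_le hnn hb)
      (le_of_tendsto (tendsto_heightValue h0 h1) (Eventually.of_forall fun n => ?_))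
    exact hasSum_le (fun k => mul_le_mul_of_nonneg_right (coeff_heightSeries_le k n)
      (by positivity)) (sumsTo_heightSeries h0 h1 n) hs.hasSum
  have h3 := hs.hasSum
  rwa [h2] at h3

/-- The value of the weighted series of the one-sided trees of height `n + 1`. -/
def weightedValue (y g : ℝ) (n : ℕ) : ℝ :=
  y ^ (n + 1) * ∏ j ∈ Finset.range (n + 1), heightValue g (j + 1)

theorem sumsTo_weightedSeries {ξ : ℝ} (h0 : 0 < ξ) (h1 : ξ ≤ 1 / 2) (y : ℝ) (n : ℕ) :
    SumsTo (weightedSeries y n) (ξ * (1 - ξ)) (weightedValue y (ξ * (1 - ξ)) n) := by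
  have hg : 0 ≤ ξ * (1 - ξ) := by nlinarith
  have key : ∀ m, SumsTo (oneSidedSeries m) (ξ * (1 - ξ))
      (∏ j ∈ Finset.range m, heightValue (ξ * (1 - ξ)) (j + 1)) := by
    intro m
    induction m with
    | zero => simpa [oneSidedSeries] using (sumsTo_X (ξ * (1 - ξ))).pow hg CoeffNonneg.X 0
    | succ m ih =>
      rw [oneSidedSeries_succ, Finset.prod_range_succ]
      exact ih.mul hg (coeffNonneg_oneSidedSeries m) (coeffNonneg_heightSeries _)
        (sumsTo_heightSeries h0 h1 _)
  exact (key (n + 1)).const_mul _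

theorem weightedValue_nonneg {ξ y : ℝ} (hy : 0 ≤ y) (h0 : 0 < ξ) (h1 : ξ ≤ 1 / 2) (n : ℕ) :
    0 ≤ weightedValue y (ξ * (1 - ξ)) n :=
  mul_nonneg (by positivity) (Finset.prod_nonneg fun _ _ => heightValue_nonneg h0 h1 _)

theorem weightedCount_nonneg {y : ℝ} (hy : 0 ≤ y) (N : ℕ) : 0 ≤ weightedCount y N := by
  rw [weightedCount, weightedSum]
  refine Finset.sum_nonneg fun n _ => ?_
  rw [mul_one]
  exact coeffNonneg_weightedSeries hy n N

/-- Half of the interchange of the sums over N and n, the other half being `sum_weightedValue_le`.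
Partial sums are compared so that convergence may be known on either side only. -/
theorem sum_weightedCount_le {ξ y : ℝ} (hy : 0 ≤ y) (h0 : 0 < ξ) (h1 : ξ ≤ 1 / 2) (M : ℕ) :
    ∑ N ∈ Finset.range M, weightedCount y N * (ξ * (1 - ξ)) ^ N ≤
      ∑ n ∈ Finset.range M, weightedValue y (ξ * (1 - ξ)) n := by
  have hg : 0 ≤ ξ * (1 - ξ) := by nlinarith
  have e : ∀ N ∈ Finset.range M, weightedCount y N * (ξ * (1 - ξ)) ^ N =
      ∑ n ∈ Finset.range M, PowerSeries.coeff N (weightedSeries y n) * (ξ * (1 - ξ)) ^ N := by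
    intro N hN
    rw [weightedCount, weightedSum_eq y _ (Finset.mem_range.mp hN).le, Finset.sum_mul]
    simp
  rw [Finset.sum_congr rfl e, Finset.sum_comm]
  refine Finset.sum_le_sum fun n _ => sum_le_hasSum _ (fun N _ => ?_)
    (sumsTo_weightedSeries h0 h1 y n)
  exact mul_nonneg (coeffNonneg_weightedSeries hy n N) (by positivity)

theorem sum_weightedValue_le {ξ y : ℝ} (hy : 0 ≤ y) (h0 : 0 < ξ) (h1 : ξ ≤ 1 / 2) {v : ℝ}
    (h : HasSum (fun N => weightedCount y N * (ξ * (1 - ξ)) ^ N) v) (M : ℕ) :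
    ∑ n ∈ Finset.range M, weightedValue y (ξ * (1 - ξ)) n ≤ v := by
  have hg : 0 ≤ ξ * (1 - ξ) := by nlinarith
  refine hasSum_le (fun N => ?_) (hasSum_sum fun n _ => sumsTo_weightedSeries h0 h1 y n) h
  rw [← Finset.sum_mul]
  refine mul_le_mul_of_nonneg_right ?_ (by positivity)
  rw [weightedCount, weightedSum_eq y _ (Nat.le_add_right N M)]
  simp only [mul_one]
  exact Finset.sum_le_sum_of_subset_of_nonneg (Finset.range_mono (by omega))
    fun n _ _ => coeffNonneg_weightedSeries hy n N

end PlanarTree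

end

/-! ### Normalised counts: monotonicity and the case y > 2 -/

noncomputable section

namespace PlanarTree

/-- The radius of convergence of the partition function with weight `y` per unit of height. -/
def critical (y : ℝ) : ℝ := y⁻¹ * (1 - y⁻¹)

/-- The partition function, normalised by the exponential growth rate. -/
def normCount (y : ℝ) (N : ℕ) : ℝ := weightedCount y N * critical y ^ N

/-- The number of trees with `N` edges, normalised by the critical point. -/
def normTree (y : ℝ) (N : ℕ) : ℝ := PowerSeries.coeff N treeSeries * critical y ^ N

theorem critical_pos {y : ℝ} (hy : 2 ≤ y) : 0 < critical y := by
  have h : y⁻¹ < 1 := inv_lt_one_of_one_lt₀ (by linarith)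
  have h' : 0 < y⁻¹ := by positivity
  exact mul_pos h' (by linarith)

theorem critical_le {y : ℝ} : critical y ≤ 1 / 4 := by
  unfold critical
  nlinarith [sq_nonneg (y⁻¹ - 1 / 2)]

theorem sq_mul_critical {y : ℝ} (hy : 2 ≤ y) : y ^ 2 * critical y = y - 1 := by
  unfold critical
  field_simp

theorem inv_le_half {y : ℝ} (hy : 2 ≤ y) : y⁻¹ ≤ 1 / 2 := by
  rw [one_div]; exact inv_anti₀ two_pos hy

theorem normCount_nonneg {y : ℝ} (hy : 2 ≤ y) (N : ℕ) : 0 ≤ normCount y N :=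
  mul_nonneg (weightedCount_nonneg (by linarith) N) (pow_nonneg (critical_pos hy).le _)

theorem normTree_nonneg {y : ℝ} (hy : 2 ≤ y) (N : ℕ) : 0 ≤ normTree y N :=
  mul_nonneg (coeffNonneg_treeSeries N) (pow_nonneg (critical_pos hy).le _)

theorem weightedSum_nonneg {y : ℝ} (hy : 0 ≤ y) {c : ℕ → PowerSeries ℝ}
    (hc : ∀ n, CoeffNonneg (c n)) (N : ℕ) : 0 ≤ weightedSum y c N :=
  Finset.sum_nonneg fun n _ => (coeffNonneg_weightedSeries hy n).mul (hc n) N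

/-- As y² g_c = y - 1, normalising `weightedSum_sub_eq` turns its right side into a difference of
consecutive terms. The sign of the sum gives monotonicity; its smallness later gives ratio 1. -/
theorem normCount_sub {y : ℝ} (hy : 2 ≤ y) {N : ℕ} (hN : 1 ≤ N) :
    (y - 1) * (normCount y N - normCount y (N + 1)) =
      y * (weightedSum y (fun n => heightSeries (n + 2) - heightSeries n) (N + 1) *
        critical y ^ (N + 1)) := by
  rw [← mul_assoc, weightedSum_sub_eq y hN, normCount, normCount]
  linear_combination (-weightedCount y N * critical y ^ N) * sq_mul_critical hy

theorem normCount_succ_le {y : ℝ} (hy : 2 ≤ y) {N : ℕ} (hN : 1 ≤ N) :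
    normCount y (N + 1) ≤ normCount y N := by
  have h := normCount_sub hy hN
  have h1 : 0 ≤ weightedSum y (fun n => heightSeries (n + 2) - heightSeries n) (N + 1) :=
    weightedSum_nonneg (by linarith) (fun n => coeffNonneg_heightSeries_sub (by omega)) _
  have h2 : 0 ≤ (y - 1) * (normCount y N - normCount y (N + 1)) := by
    rw [h]
    exact mul_nonneg (by linarith) (mul_nonneg h1 (pow_nonneg (critical_pos hy).le _))
  have := nonneg_of_mul_nonneg_right h2 (by linarith)
  linarith

theorem normCount_anti {y : ℝ} (hy : 2 ≤ y) {M N : ℕ} (hM : 1 ≤ M) (h : M ≤ N) :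
    normCount y N ≤ normCount y M := by
  induction N, h using Nat.le_induction with
  | base => exact le_rfl
  | succ n hn ih => exact (normCount_succ_le hy (hM.trans hn)).trans ih

theorem normCount_zero (y : ℝ) : normCount y 0 = 0 := by
  simp [normCount, weightedCount, weightedSum]

theorem normCount_one {y : ℝ} : normCount y 1 = y * critical y := by
  simp [normCount, weightedCount, weightedSum, weightedSeries_zero]

/-- The factor 2n + 1 makes the induction close, since (2n + 1)(2n + 3) ≤ 4(n + 1)². -/
theorem centralBinom_sq_mul_le (n : ℕ) : n.centralBinom ^ 2 * (2 * n + 1) ≤ 16 ^ n := by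
  induction n with
  | zero => simp
  | succ n ih =>
    have h := Nat.succ_mul_centralBinom_succ n
    refine le_of_mul_le_mul_left (a := (n + 1) ^ 2) ?_ (pow_pos n.succ_pos 2)
    calc (n + 1) ^ 2 * ((n + 1).centralBinom ^ 2 * (2 * (n + 1) + 1)) =
          ((n + 1) * (n + 1).centralBinom) ^ 2 * (2 * n + 3) := by ring
      _ = (n.centralBinom ^ 2 * (2 * n + 1)) * (4 * (2 * n + 1) * (2 * n + 3)) := by
          rw [h]; ring
      _ ≤ 16 ^ n * (16 * (n + 1) ^ 2) := Nat.mul_le_mul ih (by nlinarith)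
      _ = _ := by ring

/-- With g_c ≤ 1/4, one factor 1/N is the denominator of the Catalan number and N^{-1/2} comes from
the central binomial coefficient. -/
theorem normTree_le {y : ℝ} (hy : 2 ≤ y) (N : ℕ) (hN : 1 ≤ N) :
    normTree y N ≤ (N : ℝ) ^ (-(3 / 2) : ℝ) := by
  obtain ⟨n, rfl⟩ : ∃ n, N = n + 1 := ⟨N - 1, by omega⟩
  have h1 : normTree y (n + 1) ≤ catalan n * (1 / 4 : ℝ) ^ n := by
    rw [normTree, coeff_treeSeries_succ]
    refine mul_le_mul_of_nonneg_left ?_ (by positivity)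
    calc critical y ^ (n + 1) ≤ (1 / 4 : ℝ) ^ (n + 1) :=
          pow_le_pow_left₀ (critical_pos hy).le critical_le _
      _ ≤ _ := pow_le_pow_of_le_one (by norm_num) (by norm_num) (by omega)
  refine h1.trans ?_
  have hn : (0 : ℝ) < ((n + 1 : ℕ) : ℝ) := by positivity
  rw [show (-(3 / 2) : ℝ) = -1 + -(1 / 2) by norm_num, Real.rpow_add hn, Real.rpow_neg_one]
  have h2 : (catalan n : ℝ) = ((n + 1 : ℕ) : ℝ)⁻¹ * n.centralBinom := by
    rw [← succ_mul_catalan_eq_centralBinom]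
    push_cast
    field_simp
  rw [h2, mul_assoc]
  refine mul_le_mul_of_nonneg_left ?_ (by positivity)
  rw [Real.rpow_neg hn.le, ← Real.sqrt_eq_rpow]
  refine le_of_sq_le_sq ?_ (by positivity)
  have h3 : ((n.centralBinom ^ 2 * (2 * n + 1) : ℕ) : ℝ) ≤ ((16 ^ n : ℕ) : ℝ) := by
    exact_mod_cast centralBinom_sq_mul_le n
  push_cast at h3
  rw [inv_pow, Real.sq_sqrt hn.le, mul_pow, ← pow_mul, mul_comm n 2, pow_mul, ← one_div,
    le_div_iff₀ hn]
  have h4 : ((1 / 4 : ℝ) ^ 2) ^ n = 1 / 16 ^ n := by rw [← one_div_pow]; norm_num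
  rw [h4, mul_one_div, div_mul_eq_mul_div, div_le_one (by positivity)]
  push_cast
  refine le_trans (mul_le_mul_of_nonneg_left ?_ (by positivity)) h3
  linarith [(Nat.cast_nonneg n : (0 : ℝ) ≤ n)]

section Subcritical

/-- Closed form, written without division, of the iterates of the Möbius map v ↦ ξ(1 - ξ)/(1 - v).
Its fixed points are ξ and 1 - ξ, and ξ/(1 - ξ) is the multiplier at ξ. -/
theorem heightValue_eq {ξ : ℝ} (h0 : 0 < ξ) (h1 : ξ < 1 / 2) (n : ℕ) :
    heightValue (ξ * (1 - ξ)) n * (1 - (ξ / (1 - ξ)) ^ (n + 1)) = ξ * (1 - (ξ / (1 - ξ)) ^ n) := by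
  have h2 : 0 < 1 - ξ := by linarith
  have hx0 : 0 < ξ / (1 - ξ) := div_pos h0 h2
  have hx1 : ξ / (1 - ξ) < 1 := by rw [div_lt_one h2]; linarith
  induction n with
  | zero => simp [heightValue]
  | succ n ih =>
    have h3 := heightValue_le h0 (by linarith) n
    have h4 : 1 - heightValue (ξ * (1 - ξ)) n ≠ 0 := by linarith
    rw [heightValue, mul_comm, ← div_eq_mul_inv, ← mul_div_assoc, div_eq_iff h4]
    have hx : ξ / (1 - ξ) * (1 - ξ) = ξ := by field_simp
    generalize ξ / (1 - ξ) = x at *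
    generalize heightValue (ξ * (1 - ξ)) n = v at *
    rw [pow_succ x (n + 1), pow_succ x n]
    rw [pow_succ x n] at ih
    linear_combination ξ * ih + ξ * (x ^ n - x ^ n * x) * hx

/-- The closed form of `heightValue_eq` makes the product over heights telescope. -/
theorem weightedValue_ge {ξ y : ℝ} (hy : 0 ≤ y) (h0 : 0 < ξ) (h1 : ξ < 1 / 2) (n : ℕ) :
    (1 - ξ / (1 - ξ)) * (y * ξ) ^ (n + 1) ≤ weightedValue y (ξ * (1 - ξ)) n := by
  have h2 : 0 < 1 - ξ := by linarith
  have hx0 : 0 < ξ / (1 - ξ) := div_pos h0 h2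
  have hx1 : ξ / (1 - ξ) < 1 := by rw [div_lt_one h2]; linarith
  have key : ∀ m, (∏ j ∈ Finset.range m, heightValue (ξ * (1 - ξ)) (j + 1)) *
      (1 - (ξ / (1 - ξ)) ^ (m + 1)) = ξ ^ m * (1 - ξ / (1 - ξ)) := by
    intro m
    induction m with
    | zero => simp
    | succ m ih =>
      rw [Finset.prod_range_succ, mul_assoc, heightValue_eq h0 h1, pow_succ]
      linear_combination ξ * ih
  rw [weightedValue, mul_pow, ← mul_assoc, mul_comm (1 - _) (y ^ _), mul_assoc]
  refine mul_le_mul_of_nonneg_left ?_ (by positivity)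
  rw [mul_comm, ← key (n + 1)]
  refine mul_le_of_le_one_right (Finset.prod_nonneg fun _ _ => heightValue_nonneg h0 h1.le _) ?_
  have : 0 ≤ (ξ / (1 - ξ)) ^ (n + 1 + 1) := by positivity
  linarith

theorem sum_normCount_bound {y s : ℝ} (hy : 2 ≤ y) (hs0 : 0 ≤ s) (hs1 : s < 1) (M : ℕ)
    (hM : 1 ≤ M) :
    Summable (fun N => normCount y N * s ^ N) ∧
      ∑' N, normCount y N * s ^ N ≤ M * normCount y 1 + normCount y M / (1 - s) := by
  have hb : ∀ N, normCount y N ≤ normCount y 1 := by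
    intro N
    rcases Nat.eq_zero_or_pos N with rfl | h
    · rw [normCount_zero]; exact normCount_nonneg hy 1
    · exact normCount_anti hy le_rfl h
  have hgeo := summable_geometric_of_lt_one hs0 hs1
  have hsum : Summable (fun N => normCount y N * s ^ N) :=
    Summable.of_nonneg_of_le (fun N => mul_nonneg (normCount_nonneg hy N) (by positivity))
      (fun N => mul_le_mul_of_nonneg_right (hb N) (by positivity)) (hgeo.mul_left _)
  refine ⟨hsum, ?_⟩
  rw [← hsum.sum_add_tsum_nat_add M]
  refine add_le_add ?_ ?_
  · calc _ ≤ ∑ _N ∈ Finset.range M, normCount y 1 := Finset.sum_le_sum fun N _ =>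
          (mul_le_of_le_one_right (normCount_nonneg hy N) (pow_le_one₀ hs0 hs1.le)).trans (hb N)
      _ = _ := by simp
  · rw [div_eq_mul_inv, ← tsum_geometric_of_lt_one hs0 hs1, ← tsum_mul_left]
    refine Summable.tsum_le_tsum (fun N => ?_) ((summable_nat_add_iff M).mpr hsum)
      (hgeo.mul_left _)
    refine mul_le_mul (normCount_anti hy hM (by omega)) ?_ (by positivity) (normCount_nonneg hy M)
    exact pow_le_pow_of_le_one hs0 hs1.le (by omega)

/-- Tauberian argument at a simple pole. The series of b_N at s = g/g_c is bounded below by a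
geometric series in yξ and above, by monotonicity, by M b_1 + b_M/(1 - s). Multiplying by 1 - s and
letting ξ ↑ 1/y removes the first term. -/
theorem normCount_ge_of_two_lt {y : ℝ} (hy : 2 < y) :
    ∃ κ : ℝ, 0 < κ ∧ ∀ N, 1 ≤ N → κ ≤ normCount y N := by
  have hy2 := hy.le
  have hc0 : 0 < y⁻¹ := by positivity
  have hc1 : y⁻¹ < 1 / 2 := by rw [one_div]; exact inv_strictAnti₀ two_pos hy
  have hgc := critical_pos hy2
  have hx1 : y⁻¹ / (1 - y⁻¹) < 1 := by rw [div_lt_one (by linarith)]; linarith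
  -- This is the left side of `key` at ξ = 1/y; it is positive because y > 2.
  refine ⟨(1 - y⁻¹ / (1 - y⁻¹)) * y⁻¹ * (1 - 2 * y⁻¹) / critical y,
    div_pos (mul_pos (mul_pos (by linarith) hc0) (by linarith)) hgc, fun M hM => ?_⟩
  have key : ∀ ξ : ℝ, 0 < ξ → ξ < y⁻¹ →
      (1 - ξ / (1 - ξ)) * ξ * (1 - y⁻¹ - ξ) / critical y ≤
        (1 - ξ * (1 - ξ) / critical y) * (M * normCount y 1) + normCount y M := by
    intro ξ h0 h1
    have h2 : ξ < 1 / 2 := h1.trans hc1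
    have hyξ : y * ξ < 1 := by
      rw [lt_inv_comm₀ h0 (by linarith)] at h1
      rwa [← lt_div_iff₀ h0, one_div]
    -- The zero at ξ = 1/y cancels the pole of the geometric series.
    have hs : 1 - ξ * (1 - ξ) / critical y = (1 - y * ξ) * (1 - y⁻¹ - ξ) / (y * critical y) := by
      have : critical y = y⁻¹ * (1 - y⁻¹) := rfl
      field_simp
      rw [this]
      field_simp
      ring
    have hs1 : 0 < 1 - ξ * (1 - ξ) / critical y := by
      rw [hs]
      exact div_pos (mul_pos (by linarith) (by linarith)) (by positivity)
    have hs0 : 0 ≤ ξ * (1 - ξ) / critical y := by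
      have : 0 < 1 - ξ := by linarith
      positivity
    obtain ⟨hsum, hle⟩ := sum_normCount_bound hy2 hs0 (by linarith) M hM
    have e : ∀ N, normCount y N * (ξ * (1 - ξ) / critical y) ^ N =
        weightedCount y N * (ξ * (1 - ξ)) ^ N := by
      intro N
      rw [normCount, mul_assoc, ← mul_pow, mul_div_cancel₀ _ hgc.ne']
    have hlow : (1 - ξ / (1 - ξ)) * (y * ξ * (1 - y * ξ)⁻¹) ≤
        ∑' N, normCount y N * (ξ * (1 - ξ) / critical y) ^ N := by
      have hgeo := ((hasSum_geometric_of_lt_one (by positivity) hyξ).mul_left (y * ξ)).mul_left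
        (1 - ξ / (1 - ξ))
      refine le_of_tendsto hgeo.tendsto_sum_nat (Eventually.of_forall fun K => ?_)
      have hv : HasSum (fun N => weightedCount y N * (ξ * (1 - ξ)) ^ N)
          (∑' N, normCount y N * (ξ * (1 - ξ) / critical y) ^ N) :=
        hasSum_congr_left hsum.hasSum fun N => (e N).symm
      refine le_trans (Finset.sum_le_sum fun n _ => ?_)
        (sum_weightedValue_le (by linarith) h0 h2.le hv K)
      rw [← pow_succ']
      exact weightedValue_ge (by linarith) h0 h2 n
    have h3 := mul_le_mul_of_nonneg_left (hlow.trans hle) hs1.le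
    have h4 : (1 - ξ * (1 - ξ) / critical y) * ((1 - ξ / (1 - ξ)) * (y * ξ * (1 - y * ξ)⁻¹)) =
        (1 - ξ / (1 - ξ)) * ξ * (1 - y⁻¹ - ξ) / critical y := by
      rw [hs]
      have : 1 - y * ξ ≠ 0 := by linarith
      generalize ξ / (1 - ξ) = x
      generalize 1 - y⁻¹ - ξ = z
      field_simp
    rw [h4, mul_add, mul_div_cancel₀ _ hs1.ne'] at h3
    exact h3
  have hcont1 : ContinuousAt (fun ξ : ℝ => (1 - ξ / (1 - ξ)) * ξ * (1 - y⁻¹ - ξ) / critical y) y⁻¹ := by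
    have : 1 - y⁻¹ ≠ 0 := by linarith
    fun_prop (disch := assumption)
  have hcont2 : ContinuousAt (fun ξ : ℝ => (1 - ξ * (1 - ξ) / critical y) * (M * normCount y 1) +
      normCount y M) y⁻¹ := by fun_prop
  have hl1 := hcont1.tendsto.mono_left (nhdsWithin_le_nhds (s := Set.Iio y⁻¹))
  have hl2 := hcont2.tendsto.mono_left (nhdsWithin_le_nhds (s := Set.Iio y⁻¹))
  have hle := le_of_tendsto_of_tendsto hl1 hl2 (by
    filter_upwards [Ioo_mem_nhdsLT hc0] with ξ hξ using key ξ hξ.1 hξ.2)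
  have e1 : y⁻¹ * (1 - y⁻¹) / critical y = 1 := div_self hgc.ne'
  rw [e1, sub_self, zero_mul, zero_add] at hle
  rwa [two_mul, ← sub_sub]

end Subcritical

end PlanarTree

end

/-! ### The case y = 2: logarithmic singularity and counts of order 1/N -/

noncomputable section

namespace PlanarTree

theorem critical_two : critical 2 = 1 / 4 := by norm_num [critical]

/-- The parametrisation of the subcritical fugacities used for `y = 2`. -/
theorem weightedValue_two_le {η : ℝ} (h0 : 0 < η) (h1 : η < 1) (n : ℕ) :
    weightedValue 2 ((1 - η) / 2 * (1 - (1 - η) / 2)) n ≤ 1 / (n + 2) := by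
  have hmono : ∀ j, 2 * heightValue ((1 - η) / 2 * (1 - (1 - η) / 2)) j ≤ j / (j + 1) := by
    intro j
    induction j with
    | zero => simp [heightValue]
    | succ j ih =>
      have hj : (0 : ℝ) < j + 1 := by positivity
      have h2 : heightValue ((1 - η) / 2 * (1 - (1 - η) / 2)) j ≤ 1 / 2 * (j / (j + 1)) := by
        linarith
      have h3 : (j / (j + 1) : ℝ) < 1 := by rw [div_lt_one hj]; linarith
      calc _ ≤ 2 * (1 / 4 * (1 - 1 / 2 * (j / (j + 1) : ℝ))⁻¹) := by
            rw [heightValue]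
            refine mul_le_mul_of_nonneg_left (mul_le_mul (by nlinarith [sq_nonneg η])
              (inv_anti₀ (by linarith) (by linarith)) (inv_nonneg.mpr (by linarith))
              (by norm_num)) (by norm_num)
        _ = _ := by
            push_cast
            have : (1 - 1 / 2 * (j / (j + 1)) : ℝ) = (j + 2) / (2 * (j + 1)) := by
              field_simp; ring
            rw [this]
            field_simp
            ring
  have hnn := fun j => heightValue_nonneg (ξ := (1 - η) / 2) (by linarith) (by linarith) j
  induction n with
  | zero =>
    have := hmono 1
    norm_num [weightedValue] at this ⊢
    linarith
  | succ n ih =>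
    have e : weightedValue 2 ((1 - η) / 2 * (1 - (1 - η) / 2)) (n + 1) =
        weightedValue 2 ((1 - η) / 2 * (1 - (1 - η) / 2)) n *
          (2 * heightValue ((1 - η) / 2 * (1 - (1 - η) / 2)) (n + 2)) := by
      rw [weightedValue, Finset.prod_range_succ, weightedValue, pow_succ]
      ring
    rw [e]
    refine (mul_le_mul ih (hmono (n + 2)) (mul_nonneg two_pos.le (hnn _)) (by positivity)).trans ?_
    push_cast
    apply le_of_eq
    field_simp
    ring

/-- Each further factor 2 X_j is at most 2ξ = 1 - η. -/
theorem weightedValue_two_succ_le {η : ℝ} (h0 : 0 < η) (h1 : η < 1) (n k : ℕ) :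
    weightedValue 2 ((1 - η) / 2 * (1 - (1 - η) / 2)) (n + k) ≤
      weightedValue 2 ((1 - η) / 2 * (1 - (1 - η) / 2)) n * (1 - η) ^ k := by
  induction k with
  | zero => simp
  | succ k ih =>
    have e : weightedValue 2 ((1 - η) / 2 * (1 - (1 - η) / 2)) (n + (k + 1)) =
        weightedValue 2 ((1 - η) / 2 * (1 - (1 - η) / 2)) (n + k) *
          (2 * heightValue ((1 - η) / 2 * (1 - (1 - η) / 2)) (n + k + 2)) := by
      rw [← add_assoc, weightedValue, Finset.prod_range_succ, weightedValue, pow_succ]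
      ring
    have h2 := heightValue_le (ξ := (1 - η) / 2) (by linarith) (by linarith) (n + k + 2)
    have h3 := heightValue_nonneg (ξ := (1 - η) / 2) (by linarith) (by linarith) (n + k + 2)
    have h4 := weightedValue_nonneg (ξ := (1 - η) / 2) (y := 2) (by norm_num) (by linarith)
      (by linarith) n
    rw [e, pow_succ (1 - η) k, ← mul_assoc (weightedValue _ _ n)]
    exact mul_le_mul ih (by linarith) (by linarith)
      (mul_nonneg h4 (pow_nonneg (by linarith) _))

/-- The bounds of `le_heightValue` telescope to (1 - η)^{n+1}/(n + 2), and Bernoulli's inequality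
finishes. -/
theorem weightedValue_two_ge {η : ℝ} (h0 : 0 < η) (h1 : η < 1) (n : ℕ) :
    1 / (n + 2) - η ≤ weightedValue 2 ((1 - η) / 2 * (1 - (1 - η) / 2)) n := by
  have key : (1 - η) ^ (n + 1) * (1 / (n + 2)) ≤
      weightedValue 2 ((1 - η) / 2 * (1 - (1 - η) / 2)) n := by
    have e : ∀ m : ℕ, (1 - η) ^ m * (1 / (m + 1)) = 2 ^ m * ∏ j ∈ Finset.range m,
        ((1 - η) / 2 * (((j + 1 : ℕ) : ℝ) / ((j + 1 : ℕ) + 1))) := by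
      intro m
      induction m with
      | zero => simp
      | succ m ih =>
        rw [Finset.prod_range_succ, pow_succ 2 m]
        calc _ = ((1 - η) ^ m * (1 / (m + 1))) * (2 * ((1 - η) / 2 *
              (((m + 1 : ℕ) : ℝ) / ((m + 1 : ℕ) + 1)))) := by
              push_cast; field_simp; ring
          _ = _ := by rw [ih]; ring
    have := e (n + 1)
    push_cast at this
    rw [show (n + 2 : ℝ) = n + 1 + 1 by ring, this, weightedValue]
    refine mul_le_mul_of_nonneg_left (Finset.prod_le_prod (fun j _ => ?_) fun j _ => ?_)
      (by positivity)
    · have : 0 ≤ 1 - η := by linarith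
      positivity
    · have := le_heightValue (ξ := (1 - η) / 2) (by linarith) (by linarith) (j + 1)
      push_cast at this
      exact this
  refine le_trans ?_ key
  have h2 := one_add_mul_le_pow (a := -η) (by linarith) (n + 1)
  have h3 : (0 : ℝ) < n + 2 := by positivity
  rw [mul_one_div, sub_le_iff_le_add, div_add' _ _ _ h3.ne', div_le_div_iff_of_pos_right h3]
  push_cast at h2
  rw [← sub_eq_add_neg] at h2
  nlinarith

theorem sum_inv_le_log (K : ℕ) :
    ∑ n ∈ Finset.range K, (1 / (n + 2) : ℝ) ≤ Real.log (K + 1) := by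
  induction K with
  | zero => simp
  | succ K ih =>
    rw [Finset.sum_range_succ]
    have h : (0 : ℝ) < K + 1 := by positivity
    have h1 := Real.one_sub_inv_le_log_of_pos (x := (K + 2) / (K + 1)) (by positivity)
    rw [Real.log_div (by positivity) (by positivity)] at h1
    have : 1 - ((K + 2 : ℝ) / (K + 1))⁻¹ = 1 / (K + 2) := by field_simp; ring
    push_cast
    rw [show (K + 1 + 1 : ℝ) = K + 2 by ring]
    linarith

theorem log_le_sum_inv (K : ℕ) :
    Real.log (K + 2) - Real.log 2 ≤ ∑ n ∈ Finset.range K, (1 / (n + 2) : ℝ) := by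
  induction K with
  | zero => simp
  | succ K ih =>
    rw [Finset.sum_range_succ]
    have h1 := Real.log_le_sub_one_of_pos (x := (K + 3) / (K + 2)) (by positivity)
    rw [Real.log_div (by positivity) (by positivity)] at h1
    have : (K + 3 : ℝ) / (K + 2) - 1 = 1 / (K + 2) := by field_simp; ring
    push_cast
    rw [show (K + 1 + 2 : ℝ) = K + 3 by ring]
    linarith

/-- Cut at K ≈ 1/η: below K there is a harmonic sum, beyond K a geometric series of total at most
1/((K + 2)η) ≤ 1. -/
theorem sum_weightedValue_two_le {η : ℝ} (h0 : 0 < η) (h1 : η ≤ 1 / 2) (M : ℕ) :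
    ∑ n ∈ Finset.range M, weightedValue 2 ((1 - η) / 2 * (1 - (1 - η) / 2)) n ≤
      Real.log (1 / η) + 2 := by
  have hη : η < 1 := by linarith
  have hnn := fun j => weightedValue_nonneg (ξ := (1 - η) / 2) (y := 2) (by norm_num)
    (by linarith) (by linarith) j
  set K := ⌈1 / η⌉₊ with hK
  have hK1 : 1 / η ≤ K := Nat.le_ceil _
  have hK2 : (K : ℝ) < 1 / η + 1 := Nat.ceil_lt_add_one (by positivity)
  have hinv : 2 ≤ 1 / η := by rw [le_div_iff₀ h0]; linarith
  calc _ ≤ ∑ n ∈ Finset.range (K + M), weightedValue 2 ((1 - η) / 2 * (1 - (1 - η) / 2)) n :=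
        Finset.sum_le_sum_of_subset_of_nonneg (Finset.range_mono (by omega)) fun n _ _ => hnn n
    _ = ∑ n ∈ Finset.range K, weightedValue 2 ((1 - η) / 2 * (1 - (1 - η) / 2)) n +
        ∑ k ∈ Finset.range M, weightedValue 2 ((1 - η) / 2 * (1 - (1 - η) / 2)) (K + k) :=
        Finset.sum_range_add _ _ _
    _ ≤ ∑ n ∈ Finset.range K, (1 / (n + 2) : ℝ) +
        ∑ k ∈ Finset.range M, 1 / (K + 2) * (1 - η) ^ k := by
        refine add_le_add (Finset.sum_le_sum fun n _ => weightedValue_two_le h0 hη n)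
          (Finset.sum_le_sum fun k _ => (weightedValue_two_succ_le h0 hη K k).trans ?_)
        exact mul_le_mul_of_nonneg_right (weightedValue_two_le h0 hη K)
          (pow_nonneg (by linarith) _)
    _ ≤ Real.log (K + 1) + 1 := by
        refine add_le_add (sum_inv_le_log K) ?_
        rw [← Finset.mul_sum]
        have h3 := sum_le_hasSum (Finset.range M) (fun k _ => pow_nonneg (by linarith) k)
          (hasSum_geometric_of_lt_one (r := 1 - η) (by linarith) (by linarith))
        rw [sub_sub_cancel] at h3
        calc _ ≤ 1 / (K + 2 : ℝ) * η⁻¹ := mul_le_mul_of_nonneg_left h3 (by positivity)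
          _ ≤ 1 := by
            rw [← one_div, div_mul_eq_mul_div, one_mul, div_le_one (by positivity)]
            linarith
    _ ≤ Real.log (2 * (1 / η)) + 1 := by
        gcongr
        linarith
    _ = Real.log 2 + Real.log (1 / η) + 1 := by rw [Real.log_mul (by norm_num) (by positivity)]
    _ ≤ _ := by linarith [Real.log_two_lt_d9]

/-- Only about 1/η terms are kept; each loses at most η against the harmonic sum, so the total loss
is at most 1. -/
theorem exists_le_sum_weightedValue_two {η : ℝ} (h0 : 0 < η) (h1 : η ≤ 1 / 2) :
    ∃ M, Real.log (1 / η) - 2 ≤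
      ∑ n ∈ Finset.range M, weightedValue 2 ((1 - η) / 2 * (1 - (1 - η) / 2)) n := by
  have hη : η < 1 := by linarith
  set K := ⌊1 / η⌋₊ with hK
  have hK1 : (K : ℝ) ≤ 1 / η := Nat.floor_le (by positivity)
  have hK2 : 1 / η < K + 1 := Nat.lt_floor_add_one _
  refine ⟨K, ?_⟩
  calc Real.log (1 / η) - 2 ≤ (Real.log (K + 2) - Real.log 2) - 1 := by
        have : Real.log (1 / η) ≤ Real.log (K + 2) :=
          Real.log_le_log (by positivity) (by linarith)
        linarith [Real.log_two_lt_d9]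
    _ ≤ ∑ n ∈ Finset.range K, (1 / (n + 2) : ℝ) - K * η := by
        refine sub_le_sub (log_le_sum_inv K) ?_
        rwa [← le_div_iff₀ h0]
    _ = ∑ n ∈ Finset.range K, (1 / (n + 2) - η : ℝ) := by simp
    _ ≤ _ := Finset.sum_le_sum fun n _ => weightedValue_two_ge h0 hη n

/-- The logarithmic singularity of the partition function at the critical point, for `y = 2`. -/
theorem summable_normCount_two {η : ℝ} (h0 : 0 < η) (h1 : η ≤ 1 / 2) :
    Summable (fun N => normCount 2 N * (1 - η ^ 2) ^ N) ∧
      |∑' N, normCount 2 N * (1 - η ^ 2) ^ N - Real.log (1 / η)| ≤ 2 := by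
  have hη2 : 0 ≤ 1 - η ^ 2 := by nlinarith
  -- For ξ = (1 - η)/2 one has ξ(1 - ξ) = (1 - η²)/4, and g_c = 1/4.
  have e : ∀ N, normCount 2 N * (1 - η ^ 2) ^ N =
      weightedCount 2 N * ((1 - η) / 2 * (1 - (1 - η) / 2)) ^ N := by
    intro N
    rw [normCount, mul_assoc, ← mul_pow, critical_two]
    congr 2
    ring
  have hnn : ∀ N, 0 ≤ normCount 2 N * (1 - η ^ 2) ^ N := fun N =>
    mul_nonneg (normCount_nonneg le_rfl N) (pow_nonneg hη2 N)
  have hb : ∀ M, ∑ N ∈ Finset.range M, normCount 2 N * (1 - η ^ 2) ^ N ≤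
      Real.log (1 / η) + 2 := by
    intro M
    rw [Finset.sum_congr rfl fun N _ => e N]
    exact (sum_weightedCount_le (by norm_num) (by linarith) (by linarith) M).trans
      (sum_weightedValue_two_le h0 h1 M)
  have hs := summable_of_sum_range_le hnn hb
  refine ⟨hs, abs_le.mpr ⟨?_, ?_⟩⟩
  · obtain ⟨M, hM⟩ := exists_le_sum_weightedValue_two h0 h1
    have := sum_weightedValue_le (ξ := (1 - η) / 2) (y := 2) (by norm_num) (by linarith)
      (by linarith) (hasSum_congr_left hs.hasSum fun N => (e N).symm) M
    linarith
  · linarith [Real.tsum_le_of_sum_range_le hnn hb]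

/-- Comparing two scales replaces the diverging logarithm by a fixed one, and the kernel
concentrates on N between η⁻² and δ⁻². The errors 2 + 2 add up. -/
theorem log_sub_le_tsum {η δ : ℝ} (h0 : 0 < η) (h1 : η ≤ 1 / 2) (hδ : 0 < δ) (hδη : δ ≤ η) :
    Summable (fun N => normCount 2 N * ((1 - δ ^ 2) ^ N - (1 - η ^ 2) ^ N)) ∧
    |∑' N, normCount 2 N * ((1 - δ ^ 2) ^ N - (1 - η ^ 2) ^ N) - Real.log (η / δ)| ≤ 4 := by
  obtain ⟨s1, b1⟩ := summable_normCount_two h0 h1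
  obtain ⟨s2, b2⟩ := summable_normCount_two hδ (hδη.trans h1)
  simp only [mul_sub]
  refine ⟨s2.sub s1, ?_⟩
  rw [s2.tsum_sub s1]
  have : Real.log (η / δ) = Real.log (1 / δ) - Real.log (1 / η) := by
    rw [Real.log_div h0.ne' hδ.ne', one_div, one_div, Real.log_inv, Real.log_inv]
    ring
  rw [this]
  rw [abs_le] at *
  constructor <;> linarith

/-- Take η = N^{-1/2} and δ = η/2. By monotonicity the terms with N ≤ n < 2N contribute at least N
b_{2N}/10, while the total is at most log 2 + 4 < 5. -/
theorem normCount_two_le : ∃ C : ℝ, 0 < C ∧ ∀ N : ℕ, 1 ≤ N → normCount 2 N ≤ C / N := by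
  have key : ∀ N : ℕ, 4 ≤ N → normCount 2 (2 * N) ≤ 50 / N := by
    intro N hN
    have hN4 : (4 : ℝ) ≤ N := by exact_mod_cast hN
    have hN0 : (0 : ℝ) < N := by linarith
    have hsq : (2 : ℝ) ≤ √N := Real.le_sqrt_of_sq_le (by linarith)
    have hη0 : 0 < 1 / √(N : ℝ) := by positivity
    have hη1 : 1 / √(N : ℝ) ≤ 1 / 2 := one_div_le_one_div_of_le two_pos hsq
    obtain ⟨hs, hb⟩ := log_sub_le_tsum (δ := 1 / √(N : ℝ) / 2) hη0 hη1 (by positivity)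
      (by linarith)
    have e1 : (1 / √(N : ℝ)) ^ 2 = 1 / N := by rw [div_pow, Real.sq_sqrt hN0.le, one_pow]
    have e2 : (1 / √(N : ℝ) / 2) ^ 2 = 1 / (4 * N) := by rw [div_pow, e1]; field_simp; norm_num
    have e3 : 1 / √(N : ℝ) / (1 / √(N : ℝ) / 2) = 2 := by field_simp
    rw [e1, e2, e3] at hb
    rw [e1, e2] at hs
    have hN1 : 1 / (N : ℝ) ≤ 1 / 4 := one_div_le_one_div_of_le (by norm_num) hN4
    have hNN : 1 / (4 * (N : ℝ)) ≤ 1 / N :=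
      one_div_le_one_div_of_le hN0 (by linarith)
    have hpos : (0 : ℝ) < 1 / N := by positivity
    have hpos4 : (0 : ℝ) < 1 / (4 * N) := by positivity
    have hnn : ∀ n, 0 ≤ normCount 2 n * ((1 - 1 / (4 * (N : ℝ))) ^ n - (1 - 1 / (N : ℝ)) ^ n) := by
      intro n
      refine mul_nonneg (normCount_nonneg le_rfl n) (sub_nonneg.mpr ?_)
      exact pow_le_pow_left₀ (by linarith) (by linarith) n
    -- In this range (1 - 1/(4N))^n ≥ 1/2 by Bernoulli and (1 - 1/N)^n ≤ e⁻¹ < 0.4, so the kernel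
    -- exceeds 1/10.
    have hle : ∑ n ∈ Finset.Ico N (2 * N), normCount 2 (2 * N) * (1 / 10) ≤
        ∑' n, normCount 2 n * ((1 - 1 / (4 * (N : ℝ))) ^ n - (1 - 1 / (N : ℝ)) ^ n) := by
      refine le_trans (Finset.sum_le_sum fun n hn => ?_) (hs.sum_le_tsum _ fun n _ => hnn n)
      rw [Finset.mem_Ico] at hn
      refine mul_le_mul (normCount_anti le_rfl (by omega) hn.2.le) ?_ (by norm_num)
        (normCount_nonneg le_rfl n)
      have hn1 : (N : ℝ) ≤ n := by exact_mod_cast hn.1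
      have hn2 : (n : ℝ) ≤ 2 * N := by exact_mod_cast hn.2.le
      have h3 := one_add_mul_le_pow (a := -(1 / (4 * (N : ℝ)))) (by linarith) n
      rw [← sub_eq_add_neg] at h3
      have h4 : (n : ℝ) * (1 / (4 * N)) ≤ 1 / 2 := by
        rw [mul_one_div, div_le_iff₀ (by positivity)]; linarith
      have h5 : (1 - 1 / (N : ℝ)) ^ n ≤ Real.exp (-1) := by
        calc (1 - 1 / (N : ℝ)) ^ n ≤ Real.exp (-(1 / N)) ^ n :=
              pow_le_pow_left₀ (by linarith) (by
                have := Real.add_one_le_exp (-(1 / (N : ℝ))); linarith) n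
          _ = Real.exp (-(n / N)) := by rw [← Real.exp_nat_mul]; congr 1; ring
          _ ≤ _ := by
              rw [Real.exp_le_exp, neg_le_neg_iff, le_div_iff₀ hN0]; linarith
      have h6 := Real.exp_neg_one_lt_d9
      linarith
    rw [Finset.sum_const, Nat.card_Ico, nsmul_eq_mul, show 2 * N - N = N by omega] at hle
    rw [le_div_iff₀ hN0]
    have := (abs_le.mp hb).2
    linarith [Real.log_two_lt_d9]
  have h1 := normCount_nonneg le_rfl (y := 2) 1
  -- 150 = 3 · 50 because N ≤ 3⌊N/2⌋ for large N; the other term covers N < 8.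
  refine ⟨150 + 8 * normCount 2 1, by positivity, fun N hN => ?_⟩
  have hN0 : (0 : ℝ) < N := by exact_mod_cast hN
  rw [le_div_iff₀ hN0]
  rcases lt_or_ge N 8 with h | h
  · have h2 : (N : ℝ) ≤ 8 := by exact_mod_cast h.le
    calc normCount 2 N * N ≤ normCount 2 1 * 8 :=
          mul_le_mul (normCount_anti le_rfl le_rfl hN) h2 hN0.le h1
      _ ≤ _ := by linarith
  · have h2 := key (N / 2) (by omega)
    have h3 : normCount 2 N ≤ normCount 2 (2 * (N / 2)) :=
      normCount_anti le_rfl (by omega) (by omega)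
    have h4 : (N : ℝ) ≤ 3 * ((N / 2 : ℕ) : ℝ) := by
      exact_mod_cast (show N ≤ 3 * (N / 2) by omega)
    have h5 : (0 : ℝ) < ((N / 2 : ℕ) : ℝ) := by exact_mod_cast (show 0 < N / 2 by omega)
    calc normCount 2 N * N ≤ 50 / ((N / 2 : ℕ) : ℝ) * (3 * ((N / 2 : ℕ) : ℝ)) :=
          mul_le_mul (h3.trans h2) h4 hN0.le (by positivity)
      _ = 150 := by field_simp; norm_num
      _ ≤ _ := by linarith

/-- Take η = N^{-1/2} and δ = η/L with log L = C + 5, so that the total is at least C + 1. For n < N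
the kernel is at most n/N, and the upper bound C/n on b_n limits this part to C. The rest is
therefore at least 1, and by monotonicity at most b_N L² N. -/
theorem normCount_two_ge : ∃ c : ℝ, 0 < c ∧ ∀ N : ℕ, 1 ≤ N → c / N ≤ normCount 2 N := by
  obtain ⟨C, hC, hCle⟩ := normCount_two_le
  set L := Real.exp (C + 5) with hL
  have hL1 : 1 ≤ L := Real.one_le_exp (by linarith)
  have hL0 : 0 < L := by linarith
  have key : ∀ N : ℕ, 4 ≤ N → 1 / L ^ 2 / N ≤ normCount 2 N := by
    intro N hN
    have hN4 : (4 : ℝ) ≤ N := by exact_mod_cast hN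
    have hN0 : (0 : ℝ) < N := by linarith
    have hsq : (2 : ℝ) ≤ √N := Real.le_sqrt_of_sq_le (by linarith)
    have hη0 : 0 < 1 / √(N : ℝ) := by positivity
    have hη1 : 1 / √(N : ℝ) ≤ 1 / 2 := one_div_le_one_div_of_le two_pos hsq
    obtain ⟨hs, hb⟩ := log_sub_le_tsum (δ := 1 / √(N : ℝ) / L) hη0 hη1 (by positivity)
      (div_le_self hη0.le hL1)
    have e1 : (1 / √(N : ℝ)) ^ 2 = 1 / N := by rw [div_pow, Real.sq_sqrt hN0.le, one_pow]
    have e2 : (1 / √(N : ℝ) / L) ^ 2 = 1 / (L ^ 2 * N) := by rw [div_pow, e1]; field_simp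
    have e3 : 1 / √(N : ℝ) / (1 / √(N : ℝ) / L) = L := by field_simp
    rw [e1, e2, e3, hL, Real.log_exp, ← hL] at hb
    rw [e1, e2] at hs
    have hN1 : 1 / (N : ℝ) ≤ 1 / 4 := one_div_le_one_div_of_le (by norm_num) hN4
    have hpos : (0 : ℝ) < 1 / N := by positivity
    have hδ : 0 < 1 / (L ^ 2 * (N : ℝ)) := by positivity
    have hδ1 : 1 / (L ^ 2 * (N : ℝ)) ≤ 1 / N :=
      one_div_le_one_div_of_le hN0 (le_mul_of_one_le_left hN0.le (one_le_pow₀ hL1))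
    set s := 1 - 1 / (L ^ 2 * (N : ℝ)) with hsdef
    have hs0 : 0 ≤ s := by linarith
    have hs1 : s < 1 := by linarith
    have hgeo := summable_geometric_of_lt_one hs0 hs1
    have hsplit := hs.sum_add_tsum_nat_add N
    have hA : ∑ n ∈ Finset.range N, normCount 2 n * (s ^ n - (1 - 1 / (N : ℝ)) ^ n) ≤ C := by
      calc _ ≤ ∑ _n ∈ Finset.range N, C / N := by
            refine Finset.sum_le_sum fun n hn => ?_
            rcases Nat.eq_zero_or_pos n with rfl | hn0
            · rw [normCount_zero, zero_mul]; positivity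
            · have hn0' : (0 : ℝ) < n := by exact_mod_cast hn0
              have h3 := one_add_mul_le_pow (a := -(1 / (N : ℝ))) (by linarith) n
              rw [← sub_eq_add_neg] at h3
              have h4 : s ^ n ≤ 1 := pow_le_one₀ hs0 hs1.le
              calc _ ≤ C / n * (n * (1 / N)) := by
                    refine mul_le_mul (hCle n hn0) (by linarith) (sub_nonneg.mpr ?_)
                      (by positivity)
                    exact pow_le_pow_left₀ (by linarith) (by linarith) n
                _ = C / N := by field_simp
        _ = C := by rw [Finset.sum_const, Finset.card_range, nsmul_eq_mul]; field_simp
    have hB : ∑' n, normCount 2 (n + N) * (s ^ (n + N) - (1 - 1 / (N : ℝ)) ^ (n + N)) ≤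
        normCount 2 N * (L ^ 2 * N) := by
      have e4 : (1 - s)⁻¹ = L ^ 2 * N := by rw [hsdef, sub_sub_cancel, one_div, inv_inv]
      rw [← e4, ← tsum_geometric_of_lt_one hs0 hs1, ← tsum_mul_left]
      refine Summable.tsum_le_tsum (fun n => ?_) ((summable_nat_add_iff N).mpr hs)
        (hgeo.mul_left _)
      have h5 : (1 - 1 / (N : ℝ)) ^ (n + N) ≤ s ^ (n + N) :=
        pow_le_pow_left₀ (by linarith) (by linarith) _
      have h6 : 0 ≤ (1 - 1 / (N : ℝ)) ^ (n + N) := pow_nonneg (by linarith) _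
      have h7 : s ^ (n + N) ≤ s ^ n := pow_le_pow_of_le_one hs0 hs1.le (by omega)
      exact mul_le_mul (normCount_anti le_rfl (by omega) (by omega)) (by linarith)
        (by linarith) (normCount_nonneg le_rfl N)
    have := (abs_le.mp hb).1
    rw [div_div, div_le_iff₀ (by positivity)]
    linarith
  refine ⟨min (1 / L ^ 2) (normCount 2 4), lt_min (by positivity)
    (lt_of_lt_of_le (by positivity) (key 4 le_rfl)), fun N hN => ?_⟩
  have hN0 : (0 : ℝ) < N := by exact_mod_cast hN
  rcases lt_or_ge N 4 with h | h
  · calc _ ≤ normCount 2 4 / N := by gcongr; exact min_le_right _ _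
      _ ≤ normCount 2 4 := div_le_self (normCount_nonneg le_rfl 4) (by exact_mod_cast hN)
      _ ≤ _ := normCount_anti le_rfl hN h.le
  · exact le_trans (by gcongr; exact min_le_left _ _) (key N h)

end PlanarTree

end

/-! ### Ratio limits: negligible terms and the weight of a branch -/

noncomputable section

namespace PlanarTree

theorem normCount_one_pos {y : ℝ} (hy : 2 ≤ y) : 0 < normCount y 1 := by
  rw [normCount_one]
  exact mul_pos (by linarith) (critical_pos hy)

/-- b_N lies between positive constants if y > 2 and between multiples of 1/N if y = 2. This
supplies the majorant for convolutions with small index. -/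
theorem normCount_doubling {y : ℝ} (hy : 2 ≤ y) :
    ∃ D : ℝ, 0 < D ∧ ∀ N j : ℕ, 1 ≤ N → 2 * j ≤ N → normCount y (N - j) ≤ D * normCount y N := by
  rcases hy.eq_or_lt with rfl | hy2
  · obtain ⟨C, hC, hCle⟩ := normCount_two_le
    obtain ⟨c, hc, hcle⟩ := normCount_two_ge
    refine ⟨2 * C / c, by positivity, fun N j hN hj => (hCle _ (by omega)).trans ?_⟩
    have hN0 : (0 : ℝ) < N := by exact_mod_cast hN
    have h2 : (N : ℝ) ≤ 2 * ((N - j : ℕ) : ℝ) := by exact_mod_cast (show N ≤ 2 * (N - j) by omega)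
    calc C / ((N - j : ℕ) : ℝ) ≤ 2 * C / c * (c / N) := by
          have h3 : (0 : ℝ) < ((N - j : ℕ) : ℝ) := by linarith
          have : 2 * C / c * (c / N) = 2 * C / N := by field_simp
          rw [this, div_le_div_iff₀ h3 hN0]
          nlinarith
      _ ≤ _ := mul_le_mul_of_nonneg_left (hcle N hN) (by positivity)
  · obtain ⟨κ, hκ, hle⟩ := normCount_ge_of_two_lt hy2
    have h1 := normCount_one_pos hy
    refine ⟨normCount y 1 / κ, by positivity, fun N j hN hj =>
      (normCount_anti hy le_rfl (by omega)).trans ?_⟩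
    rw [div_mul_eq_mul_div, le_div_iff₀ hκ]
    exact mul_le_mul_of_nonneg_left (hle N hN) h1.le

/-- The sum relative to b_N is at most of order N for y > 2 and N log N for y = 2. Any exponent
below 3/2 suffices against the tree counts; 5/4 absorbs the logarithm. -/
theorem sum_normCount_le {y : ℝ} (hy : 2 ≤ y) :
    ∃ C : ℝ, 0 < C ∧ ∀ N : ℕ, 1 ≤ N →
      ∑ i ∈ Finset.range (N + 1), normCount y i ≤ C * (N : ℝ) ^ (5 / 4 : ℝ) * normCount y N := by
  rcases hy.eq_or_lt with rfl | hy2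
  · obtain ⟨C, hC, hCle⟩ := normCount_two_le
    obtain ⟨c, hc, hcle⟩ := normCount_two_ge
    refine ⟨5 * C / c, by positivity, fun N hN => ?_⟩
    have hN0 : (0 : ℝ) < N := by exact_mod_cast hN
    have hN1 : (1 : ℝ) ≤ N := by exact_mod_cast hN
    have hr : (1 : ℝ) ≤ (N : ℝ) ^ (1 / 4 : ℝ) := Real.one_le_rpow hN1 (by norm_num)
    rw [Finset.sum_range_succ', normCount_zero, add_zero]
    calc ∑ i ∈ Finset.range N, normCount 2 (i + 1) ≤
          ∑ i ∈ Finset.range N, C * ((i + 1 : ℝ))⁻¹ := by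
            refine Finset.sum_le_sum fun i _ => (hCle (i + 1) (by omega)).trans ?_
            push_cast
            rw [div_eq_mul_inv]
      _ = C * ((harmonic N : ℚ) : ℝ) := by
            rw [← Finset.mul_sum, harmonic]
            push_cast
            rfl
      _ ≤ C * (1 + Real.log N) := mul_le_mul_of_nonneg_left (harmonic_le_one_add_log N) hC.le
      _ ≤ C * (5 * (N : ℝ) ^ (1 / 4 : ℝ)) := by
            refine mul_le_mul_of_nonneg_left ?_ hC.le
            have := Real.log_le_rpow_div hN0.le (show (0 : ℝ) < 1 / 4 by norm_num)
            linarith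
      _ = 5 * C / c * (N : ℝ) ^ (5 / 4 : ℝ) * (c / N) := by
            rw [show (5 / 4 : ℝ) = 1 / 4 + 1 by norm_num, Real.rpow_add hN0, Real.rpow_one]
            field_simp
      _ ≤ _ := mul_le_mul_of_nonneg_left (hcle N hN) (by positivity)
  · obtain ⟨κ, hκ, hle⟩ := normCount_ge_of_two_lt hy2
    have h1 := normCount_one_pos hy
    refine ⟨normCount y 1 / κ, by positivity, fun N hN => ?_⟩
    have hN0 : (0 : ℝ) < N := by exact_mod_cast hN
    have hN1 : (1 : ℝ) ≤ N := by exact_mod_cast hN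
    rw [Finset.sum_range_succ', normCount_zero, add_zero]
    calc ∑ i ∈ Finset.range N, normCount y (i + 1) ≤ ∑ _i ∈ Finset.range N, normCount y 1 :=
          Finset.sum_le_sum fun i _ => normCount_anti hy le_rfl (by omega)
      _ = normCount y 1 / κ * N * κ := by
          rw [Finset.sum_const, Finset.card_range, nsmul_eq_mul]
          field_simp
      _ ≤ _ := by
          refine mul_le_mul (mul_le_mul_of_nonneg_left ?_ (by positivity)) (hle N hN) hκ.le
            (by positivity)
          conv_lhs => rw [← Real.rpow_one (N : ℝ)]
          exact Real.rpow_le_rpow_of_exponent_le hN1 (by norm_num)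

theorem normCount_pos {y : ℝ} (hy : 2 ≤ y) {N : ℕ} (hN : 1 ≤ N) : 0 < normCount y N := by
  obtain ⟨C, hC, h⟩ := sum_normCount_le hy
  have h1 : normCount y 1 ≤ ∑ i ∈ Finset.range (N + 1), normCount y i :=
    Finset.single_le_sum (f := normCount y) (fun i _ => normCount_nonneg hy i)
      (Finset.mem_range.mpr (by omega))
  have h2 := (normCount_one_pos hy).trans_le (h1.trans (h N hN))
  have hN0 : (0 : ℝ) < N := by exact_mod_cast hN
  exact pos_of_mul_pos_right h2 (by positivity)

theorem tendsto_rpow_neg_quarter (C : ℝ) :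
    Tendsto (fun N : ℕ => C * (N : ℝ) ^ (-(1 / 4) : ℝ)) atTop (𝓝 0) := by
  have := ((tendsto_rpow_neg_atTop (show (0 : ℝ) < 1 / 4 by norm_num)).comp
    tendsto_natCast_atTop_atTop).const_mul C
  rwa [mul_zero] at this

theorem tendsto_normTree_div {y : ℝ} (hy : 2 ≤ y) :
    Tendsto (fun N => normTree y N / normCount y N) atTop (𝓝 0) := by
  obtain ⟨C, hC, h⟩ := sum_normCount_le hy
  have hb1 := normCount_one_pos hy
  refine squeeze_zero' (Eventually.of_forall fun N => div_nonneg (normTree_nonneg hy N)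
    (normCount_nonneg hy N)) ?_ (tendsto_rpow_neg_quarter (C / normCount y 1))
  filter_upwards [eventually_ge_atTop 1] with N hN
  have hN0 : (0 : ℝ) < N := by exact_mod_cast hN
  have h1 : normCount y 1 ≤ C * (N : ℝ) ^ (5 / 4 : ℝ) * normCount y N :=
    le_trans (Finset.single_le_sum (f := normCount y) (fun i _ => normCount_nonneg hy i)
      (Finset.mem_range.mpr (by omega))) (h N hN)
  rw [div_le_iff₀ (normCount_pos hy hN)]
  refine (normTree_le hy N hN).trans ?_
  have e : (N : ℝ) ^ (-(1 / 4) : ℝ) = (N : ℝ) ^ (-(3 / 2) : ℝ) * (N : ℝ) ^ (5 / 4 : ℝ) := by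
    rw [← Real.rpow_add hN0]; norm_num
  calc (N : ℝ) ^ (-(3 / 2) : ℝ) = (N : ℝ) ^ (-(3 / 2) : ℝ) / normCount y 1 * normCount y 1 := by
        field_simp
    _ ≤ (N : ℝ) ^ (-(3 / 2) : ℝ) / normCount y 1 * (C * (N : ℝ) ^ (5 / 4 : ℝ) * normCount y N) :=
        mul_le_mul_of_nonneg_left h1 (by positivity)
    _ = _ := by rw [e]; ring

/-- The contribution of large trees to the convolution of `normTree` and `normCount`. -/
def convTail (y : ℝ) (N : ℕ) : ℝ :=
  ∑ j ∈ Finset.range (N + 1) with N < 2 * j, normTree y j * normCount y (N - j)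

/-- A tree with more than N/2 edges costs a factor of order N^{-3/2}, and the remaining sum is at
most of order N^{5/4} b_N. -/
theorem tendsto_convTail_div {y : ℝ} (hy : 2 ≤ y) :
    Tendsto (fun N => convTail y N / normCount y N) atTop (𝓝 0) := by
  obtain ⟨C, hC, h⟩ := sum_normCount_le hy
  have hnn : ∀ N j, 0 ≤ normTree y j * normCount y (N - j) := fun N j =>
    mul_nonneg (normTree_nonneg hy j) (normCount_nonneg hy _)
  refine squeeze_zero' (Eventually.of_forall fun N => div_nonneg
    (Finset.sum_nonneg fun j _ => hnn N j) (normCount_nonneg hy N)) ?_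
    (tendsto_rpow_neg_quarter (4 * C))
  filter_upwards [eventually_ge_atTop 1] with N hN
  have hN0 : (0 : ℝ) < N := by exact_mod_cast hN
  rw [div_le_iff₀ (normCount_pos hy hN)]
  have e : (N : ℝ) ^ (-(1 / 4) : ℝ) = (N : ℝ) ^ (-(3 / 2) : ℝ) * (N : ℝ) ^ (5 / 4 : ℝ) := by
    rw [← Real.rpow_add hN0]; norm_num
  have hx : ∀ j, N < 2 * j → normTree y j ≤ 4 * (N : ℝ) ^ (-(3 / 2) : ℝ) := by
    intro j hj
    have hj1 : 1 ≤ j := by omega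
    have hj2 : (N : ℝ) / 2 ≤ j := by
      have : (N : ℝ) ≤ 2 * j := by exact_mod_cast hj.le
      linarith
    refine (normTree_le hy j hj1).trans ?_
    calc (j : ℝ) ^ (-(3 / 2) : ℝ) ≤ ((N : ℝ) / 2) ^ (-(3 / 2) : ℝ) :=
          Real.rpow_le_rpow_of_nonpos (by positivity) hj2 (by norm_num)
      _ = 2 ^ (3 / 2 : ℝ) * (N : ℝ) ^ (-(3 / 2) : ℝ) := by
          rw [Real.div_rpow hN0.le two_pos.le, Real.rpow_neg two_pos.le (3 / 2), div_inv_eq_mul,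
            mul_comm]
      _ ≤ 4 * (N : ℝ) ^ (-(3 / 2) : ℝ) := by
          refine mul_le_mul_of_nonneg_right ?_ (by positivity)
          calc (2 : ℝ) ^ (3 / 2 : ℝ) ≤ 2 ^ (2 : ℝ) :=
                Real.rpow_le_rpow_of_exponent_le (by norm_num) (by norm_num)
            _ = 4 := by norm_num
  calc convTail y N ≤ ∑ j ∈ Finset.range (N + 1) with N < 2 * j,
          4 * (N : ℝ) ^ (-(3 / 2) : ℝ) * normCount y (N - j) := by
        refine Finset.sum_le_sum fun j hj => ?_
        exact mul_le_mul_of_nonneg_right (hx j (Finset.mem_filter.mp hj).2) (normCount_nonneg hy _)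
    _ ≤ ∑ j ∈ Finset.range (N + 1), 4 * (N : ℝ) ^ (-(3 / 2) : ℝ) * normCount y (N - j) :=
        Finset.sum_le_sum_of_subset_of_nonneg (Finset.filter_subset _ _) fun j _ _ =>
          mul_nonneg (by positivity) (normCount_nonneg hy _)
    _ = 4 * (N : ℝ) ^ (-(3 / 2) : ℝ) * ∑ i ∈ Finset.range (N + 1), normCount y i := by
        rw [← Finset.mul_sum, ← Finset.sum_range_reflect (normCount y) (N + 1)]
        simp
    _ ≤ 4 * (N : ℝ) ^ (-(3 / 2) : ℝ) * (C * (N : ℝ) ^ (5 / 4 : ℝ) * normCount y N) :=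
        mul_le_mul_of_nonneg_left (h N hN) (by positivity)
    _ = _ := by rw [e]; ring

/-- The coefficients of `Q`, normalised by the critical point. -/
def normCoeff (y : ℝ) (Q : PowerSeries ℝ) (N : ℕ) : ℝ := PowerSeries.coeff N Q * critical y ^ N

theorem weightedSum_const (y : ℝ) (Q : PowerSeries ℝ) (N : ℕ) :
    weightedSum y (fun _ => Q) N * critical y ^ N =
      ∑ j ∈ Finset.range (N + 1), normCoeff y Q j * normCount y (N - j) := by
  have e : weightedSum y (fun _ => Q) N = ∑ p ∈ Finset.HasAntidiagonal.antidiagonal N,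
      PowerSeries.coeff p.1 Q * weightedCount y p.2 := by
    rw [weightedSum, ← map_sum, ← Finset.sum_mul, mul_comm, PowerSeries.coeff_mul]
    refine Finset.sum_congr rfl fun p hp => ?_
    have := Finset.HasAntidiagonal.mem_antidiagonal.mp hp
    rw [weightedCount, weightedSum_eq y _ (show p.2 ≤ N by omega), map_sum]
    simp
  rw [e, Finset.Nat.sum_antidiagonal_eq_sum_range_succ
    (fun i j => PowerSeries.coeff i Q * weightedCount y j), Finset.sum_mul]
  refine Finset.sum_congr rfl fun j hj => ?_
  have : critical y ^ N = critical y ^ j * critical y ^ (N - j) := by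
    rw [← pow_add]; congr 1; have := Finset.mem_range.mp hj; omega
  rw [normCoeff, normCount, this]
  ring

theorem normCoeff_nonneg {y : ℝ} (hy : 2 ≤ y) {Q : PowerSeries ℝ} (hQ : CoeffNonneg Q) (N : ℕ) :
    0 ≤ normCoeff y Q N := mul_nonneg (hQ N) (pow_nonneg (critical_pos hy).le _)

theorem normCoeff_le {y : ℝ} (hy : 2 ≤ y) {Q : PowerSeries ℝ} (hQ : CoeffNonneg (treeSeries - Q))
    (N : ℕ) : normCoeff y Q N ≤ normTree y N := by
  refine mul_le_mul_of_nonneg_right ?_ (pow_nonneg (critical_pos hy).le _)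
  have := hQ N
  rw [map_sub] at this
  linarith

theorem conv_split {y : ℝ} (hy : 2 ≤ y) {Q : PowerSeries ℝ} (hT : CoeffNonneg (treeSeries - Q))
    (N : ℕ) :
    ∑ j ∈ Finset.range (N + 1), normCoeff y Q j * normCount y (N - j) ≤
      ∑ j ∈ Finset.range (N + 1) with 2 * j ≤ N, normCoeff y Q j * normCount y (N - j) +
        convTail y N := by
  rw [← Finset.sum_filter_add_sum_filter_not _ (fun j => 2 * j ≤ N)]
  simp only [not_le]
  gcongr with j hj
  exact Finset.sum_le_sum fun j _ =>
    mul_le_mul_of_nonneg_right (normCoeff_le hy hT j) (normCount_nonneg hy _)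

/-- Sums of series that become small compared to `treeSeries` are negligible. -/
theorem tendsto_weightedSum_zero {y : ℝ} (hy : 2 ≤ y) {c Q : ℕ → PowerSeries ℝ} {q : ℕ → ℝ}
    (hc : ∀ n, CoeffNonneg (c n)) (hcQ : ∀ n, CoeffNonneg (Q n - c n))
    (hQ : ∀ n, CoeffNonneg (Q n - Q (n + 1))) (hT : CoeffNonneg (treeSeries - Q 0))
    (hq : ∀ n, SumsTo (Q n) (critical y) (q n)) (hq0 : Tendsto q atTop (𝓝 0)) :
    Tendsto (fun N => weightedSum y c N * critical y ^ N / normCount y N) atTop (𝓝 0) := by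
  have hy0 : (0 : ℝ) ≤ y := by linarith
  have hg := critical_pos hy
  obtain ⟨D, hD, hdoub⟩ := normCount_doubling hy
  have hQm : ∀ m n, m ≤ n → CoeffNonneg (Q m - Q n) := by
    intro m n h
    induction n, h using Nat.le_induction with
    | base => simpa using CoeffNonneg.zero
    | succ n _ ih => simpa using ih.add (hQ n)
  have hQT : ∀ n, CoeffNonneg (treeSeries - Q n) := fun n => by
    simpa using hT.add (hQm 0 n (Nat.zero_le n))
  have hQ0 : ∀ n, CoeffNonneg (Q n) := fun n => by simpa using (hcQ n).add (hc n)
  have hcT : ∀ n, CoeffNonneg (treeSeries - c n) := fun n => by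
    simpa using (hQT n).add (hcQ n)
  have hW : ∀ m, CoeffNonneg (treeSeries ^ m - oneSidedSeries m) := by
    intro m
    induction m with
    | zero => simpa [oneSidedSeries] using CoeffNonneg.zero
    | succ m ih =>
      have e : treeSeries ^ (m + 1) - oneSidedSeries (m + 1) =
          (treeSeries ^ m - oneSidedSeries m) * treeSeries +
            oneSidedSeries m * (treeSeries - heightSeries (m + 1)) := by
        rw [oneSidedSeries_succ]; ring
      rw [e]
      exact (ih.mul coeffNonneg_treeSeries).add
        ((coeffNonneg_oneSidedSeries m).mul (coeffNonneg_treeSeries_sub _))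
  -- For fixed n there are n + 2 factors dominated by X, and X^{n+2} is dominated by X.
  have hfirst : ∀ n N, PowerSeries.coeff N (weightedSeries y n * c n) ≤
      y ^ (n + 1) * PowerSeries.coeff N treeSeries := by
    intro n N
    have e : PowerSeries.C (y ^ (n + 1)) * treeSeries - weightedSeries y n * c n =
        PowerSeries.C (y ^ (n + 1)) * ((treeSeries - treeSeries ^ (n + 1 + 1)) +
          ((treeSeries ^ (n + 1) - oneSidedSeries (n + 1)) * treeSeries +
          oneSidedSeries (n + 1) * (treeSeries - c n))) := by
      rw [weightedSeries]; ring
    have h1 : CoeffNonneg (PowerSeries.C (y ^ (n + 1)) * treeSeries - weightedSeries y n * c n) := by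
      rw [e]
      exact (CoeffNonneg.C (by positivity)).mul ((coeffNonneg_treeSeries_sub_pow (n + 1)).add
        (((hW _).mul coeffNonneg_treeSeries).add ((coeffNonneg_oneSidedSeries _).mul (hcT n))))
    have h2 := h1 N
    rw [map_sub, PowerSeries.coeff_C_mul] at h2
    linarith
  -- The terms n < K have the size of tree counts. For n ≥ K, c_n ≤ Q_n ≤ Q_K gives a convolution of
  -- Q_K with W, whose half of small indices is at most D q_K b_N.
  have hbound : ∀ K N, 1 ≤ N → weightedSum y c N * critical y ^ N ≤
      (∑ n ∈ Finset.range K, y ^ (n + 1)) * normTree y N +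
        (D * q K * normCount y N + convTail y N) := by
    intro K N hN
    have h1 : weightedSum y c N ≤ (∑ n ∈ Finset.range K, y ^ (n + 1)) *
        PowerSeries.coeff N treeSeries + weightedSum y (fun _ => Q K) N := by
      rw [weightedSum_eq y c (Nat.le_add_left N K), weightedSum_eq y (fun _ => Q K)
        (Nat.le_add_left N K), Finset.sum_range_add, Finset.sum_range_add]
      refine add_le_add ?_ ?_
      · rw [Finset.sum_mul]
        exact Finset.sum_le_sum fun n _ => hfirst n N
      · refine le_trans (Finset.sum_le_sum fun n _ => ?_) (le_add_of_nonneg_left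
          (Finset.sum_nonneg fun n _ => (coeffNonneg_weightedSeries hy0 n).mul (hQ0 K) N))
        have e : Q K - c (K + n) = (Q K - Q (K + n)) + (Q (K + n) - c (K + n)) := by ring
        have h3 : CoeffNonneg (Q K - c (K + n)) := by
          rw [e]; exact (hQm _ _ (by omega)).add (hcQ _)
        have h4 := (coeffNonneg_weightedSeries hy0 (K + n)).mul h3 N
        rw [mul_sub, map_sub] at h4
        linarith
    have h2 : ∑ j ∈ Finset.range (N + 1) with 2 * j ≤ N,
        normCoeff y (Q K) j * normCount y (N - j) ≤ D * q K * normCount y N := by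
      calc _ ≤ ∑ j ∈ Finset.range (N + 1) with 2 * j ≤ N,
            normCoeff y (Q K) j * (D * normCount y N) :=
            Finset.sum_le_sum fun j hj => mul_le_mul_of_nonneg_left
              (hdoub N j hN (Finset.mem_filter.mp hj).2) (normCoeff_nonneg hy (hQ0 K) j)
        _ ≤ q K * (D * normCount y N) := by
            rw [← Finset.sum_mul]
            refine mul_le_mul_of_nonneg_right ?_ (mul_nonneg hD.le (normCount_nonneg hy N))
            exact sum_le_hasSum _ (fun j _ => normCoeff_nonneg hy (hQ0 K) j) (hq K)
        _ = _ := by ring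
    have h3 := mul_le_mul_of_nonneg_right h1 (pow_nonneg hg.le N)
    rw [add_mul, weightedSum_const, mul_assoc] at h3
    exact h3.trans (add_le_add le_rfl ((conv_split hy (hQT K) N).trans (by gcongr)))
  refine tendsto_order.2 ⟨fun a ha => Eventually.of_forall fun N => ha.trans_le (div_nonneg
    (mul_nonneg (weightedSum_nonneg hy0 hc N) (pow_nonneg hg.le N)) (normCount_nonneg hy N)),
    fun ε hε => ?_⟩
  -- K is fixed first to make D q_K small; only then N → ∞.
  obtain ⟨K, hK⟩ := ((hq0.const_mul D).eventually (gt_mem_nhds (show D * 0 < ε / 2 by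
    rw [mul_zero]; positivity))).exists
  have hlim : Tendsto (fun N => (∑ n ∈ Finset.range K, y ^ (n + 1)) *
      (normTree y N / normCount y N) + convTail y N / normCount y N) atTop (𝓝 0) := by
    simpa using ((tendsto_normTree_div hy).const_mul _).add (tendsto_convTail_div hy)
  filter_upwards [hlim.eventually (gt_mem_nhds (half_pos hε)), eventually_ge_atTop 1] with N h hN
  have hb := normCount_pos hy hN
  have h5 := div_le_div_of_nonneg_right (hbound K N hN) hb.le
  have e : ((∑ n ∈ Finset.range K, y ^ (n + 1)) * normTree y N +
        (D * q K * normCount y N + convTail y N)) / normCount y N =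
      ((∑ n ∈ Finset.range K, y ^ (n + 1)) *
      (normTree y N / normCount y N) + convTail y N / normCount y N) + D * q K := by
    field_simp; ring
  rw [e] at h5
  linarith

theorem sumsTo_treeSeries_critical {y : ℝ} (hy : 2 ≤ y) : SumsTo treeSeries (critical y) y⁻¹ :=
  sumsTo_treeSeries (by positivity) (inv_le_half hy)

/-- The error terms that arise from replacing trees of bounded height by arbitrary trees. -/
theorem tendsto_pow_error {y : ℝ} (hy : 2 ≤ y) (k : ℕ) :
    Tendsto (fun N => weightedSum y (fun n => treeSeries ^ (k + 1) - heightSeries n ^ (k + 1)) N *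
      critical y ^ N / normCount y N) atTop (𝓝 0) := by
  have hg := (critical_pos hy).le
  -- The errors are their own decreasing majorants; since X_0 = 0, the first one is X^{k+1}, which
  -- is dominated by X.
  refine tendsto_weightedSum_zero hy
    (Q := fun n => treeSeries ^ (k + 1) - heightSeries n ^ (k + 1))
    (q := fun n => y⁻¹ ^ (k + 1) - heightValue (critical y) n ^ (k + 1))
    (fun n => (coeffNonneg_heightSeries n).pow_sub_pow (coeffNonneg_treeSeries_sub n) _)
    (fun n => by simpa using CoeffNonneg.zero) (fun n => ?_) ?_ (fun n => ?_) ?_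
  · simpa using (coeffNonneg_heightSeries n).pow_sub_pow (coeffNonneg_heightSeries_succ_sub n) _
  · simpa [heightSeries_zero] using coeffNonneg_treeSeries_sub_pow k
  · exact ((sumsTo_treeSeries_critical hy).pow hg coeffNonneg_treeSeries _).sub
      ((sumsTo_heightSeries (by positivity) (inv_le_half hy) n).pow hg
        (coeffNonneg_heightSeries n) _)
  · have := (tendsto_heightValue (ξ := y⁻¹) (by positivity) (inv_le_half hy)).pow (k + 1)
    simpa [critical] using this.const_sub (y⁻¹ ^ (k + 1))

theorem weightedSum_mono {y : ℝ} (hy : 0 ≤ y) {c d : ℕ → PowerSeries ℝ}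
    (h : ∀ n, CoeffNonneg (d n - c n)) (N : ℕ) : weightedSum y c N ≤ weightedSum y d N := by
  refine Finset.sum_le_sum fun n _ => ?_
  have := (coeffNonneg_weightedSeries hy n).mul (h n) N
  rw [mul_sub, map_sub] at this
  linarith

/-- The defect in `normCount_sub` involves X_{n+2} - X_n ≤ X - X_n, which is negligible by
`tendsto_pow_error` with k = 0. -/
theorem tendsto_normCount_succ_div {y : ℝ} (hy : 2 ≤ y) :
    Tendsto (fun N => normCount y N / normCount y (N + 1)) atTop (𝓝 1) := by
  have hy0 : (0 : ℝ) ≤ y := by linarith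
  have h := (tendsto_add_atTop_iff_nat 1).mpr (tendsto_pow_error hy 0)
  simp only [zero_add, pow_one] at h
  have h2 : Tendsto (fun N => weightedSum y (fun n => heightSeries (n + 2) - heightSeries n)
      (N + 1) * critical y ^ (N + 1) / normCount y (N + 1)) atTop (𝓝 0) := by
    refine squeeze_zero (fun N => div_nonneg (mul_nonneg (weightedSum_nonneg hy0
      (fun n => coeffNonneg_heightSeries_sub (by omega)) _) (pow_nonneg (critical_pos hy).le _))
      (normCount_nonneg hy _)) (fun N => ?_) h
    refine div_le_div_of_nonneg_right (mul_le_mul_of_nonneg_right (weightedSum_mono hy0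
      (fun n => ?_) _) (pow_nonneg (critical_pos hy).le _)) (normCount_nonneg hy _)
    simpa using coeffNonneg_treeSeries_sub (n + 2)
  have h3 := (h2.const_mul (y / (y - 1))).const_add 1
  rw [mul_zero, add_zero] at h3
  refine h3.congr' ?_
  filter_upwards [eventually_ge_atTop 1] with N hN
  have hb := normCount_pos hy (show 1 ≤ N + 1 by omega)
  have hy1 : y - 1 ≠ 0 := by linarith
  have := normCount_sub hy hN
  rw [eq_div_iff hb.ne', add_mul, mul_assoc, div_mul_cancel₀ _ hb.ne', div_mul_eq_mul_div, ← this]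
  field_simp
  ring

theorem tendsto_normCount_sub_div {y : ℝ} (hy : 2 ≤ y) (j : ℕ) :
    Tendsto (fun N => normCount y (N - j) / normCount y N) atTop (𝓝 1) := by
  rw [← tendsto_add_atTop_iff_nat j]
  simp only [Nat.add_sub_cancel]
  induction j with
  | zero =>
    refine Tendsto.congr' ?_ tendsto_const_nhds
    filter_upwards [eventually_ge_atTop 1] with N hN
    rw [add_zero, div_self (normCount_pos hy hN).ne']
  | succ j ih =>
    have h := (tendsto_add_atTop_iff_nat j).mpr (tendsto_normCount_succ_div hy)
    have h2 := ih.mul h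
    rw [mul_one] at h2
    refine h2.congr' ?_
    filter_upwards [eventually_ge_atTop 1] with N hN
    rw [div_mul_div_cancel₀ (normCount_pos hy (show 1 ≤ N + j by omega)).ne', add_assoc]

/-- Dominated convergence for the indices j ≤ N/2, with `normCount_doubling` as majorant and
b_{N-j}/b_N → 1 termwise; the other indices form `convTail`. -/
theorem tendsto_conv {y : ℝ} (hy : 2 ≤ y) {Q : PowerSeries ℝ} {q : ℝ} (hQ : CoeffNonneg Q)
    (hT : CoeffNonneg (treeSeries - Q)) (hq : SumsTo Q (critical y) q) :
    Tendsto (fun N => weightedSum y (fun _ => Q) N * critical y ^ N / normCount y N)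
      atTop (𝓝 q) := by
  obtain ⟨D, hD, hdoub⟩ := normCount_doubling hy
  have hs : Summable fun j => normCoeff y Q j * D := hq.summable.mul_right D
  have hmain : Tendsto (fun N => ∑' j, if 2 * j ≤ N then
      normCoeff y Q j * (normCount y (N - j) / normCount y N) else 0) atTop
      (𝓝 (∑' j, normCoeff y Q j)) := by
    refine tendsto_tsum_of_dominated_convergence hs (fun j => ?_) ?_
    · have h1 := (tendsto_normCount_sub_div hy j).const_mul (normCoeff y Q j)
      rw [mul_one] at h1
      refine h1.congr' ?_
      filter_upwards [eventually_ge_atTop (2 * j)] with N hN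
      rw [if_pos hN]
    · filter_upwards [eventually_ge_atTop 1] with N hN j
      split_ifs with h
      · have hb := normCount_pos hy hN
        rw [Real.norm_of_nonneg (mul_nonneg (normCoeff_nonneg hy hQ j)
          (div_nonneg (normCount_nonneg hy _) hb.le))]
        refine mul_le_mul_of_nonneg_left ?_ (normCoeff_nonneg hy hQ j)
        rw [div_le_iff₀ hb]
        exact hdoub N j hN h
      · rw [norm_zero]; exact mul_nonneg (normCoeff_nonneg hy hQ j) hD.le
  have e : ∀ N, (∑' j, if 2 * j ≤ N then
      normCoeff y Q j * (normCount y (N - j) / normCount y N) else 0) =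
      (∑ j ∈ Finset.range (N + 1) with 2 * j ≤ N, normCoeff y Q j * normCount y (N - j)) /
        normCount y N := by
    intro N
    rw [tsum_eq_sum (s := Finset.range (N + 1)) fun j hj => if_neg (by
      rw [Finset.mem_range] at hj; omega), Finset.sum_filter, Finset.sum_div]
    refine Finset.sum_congr rfl fun j _ => ?_
    split_ifs
    · rw [mul_div_assoc]
    · rw [zero_div]
  have hq' : ∑' j, normCoeff y Q j = q := hq.tsum_eq
  simp only [e, hq'] at hmain
  have hupper := hmain.add (tendsto_convTail_div hy)
  rw [add_zero] at hupper
  refine tendsto_of_tendsto_of_tendsto_of_le_of_le hmain hupper (fun N => ?_) fun N => ?_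
  · simp only
    rw [weightedSum_const]
    refine div_le_div_of_nonneg_right (Finset.sum_le_sum_of_subset_of_nonneg
      (Finset.filter_subset _ _) fun j _ _ => ?_) (normCount_nonneg hy N)
    exact mul_nonneg (normCoeff_nonneg hy hQ j) (normCount_nonneg hy _)
  · simp only
    rw [weightedSum_const, ← add_div]
    exact div_le_div_of_nonneg_right (conv_split hy hT N) (normCount_nonneg hy N)

/-- Asymptotically, `k` additional branches contribute the factor `X(g_c) ^ k`. -/
theorem tendsto_weightedSum_pow {y : ℝ} (hy : 2 ≤ y) (k : ℕ) :
    Tendsto (fun N => weightedSum y (fun n => heightSeries (n + 1) ^ k) N * critical y ^ N /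
      normCount y N) atTop (𝓝 (y⁻¹ ^ k)) := by
  have hy0 : (0 : ℝ) ≤ y := by linarith
  have hg := (critical_pos hy).le
  cases k with
  | zero =>
    simp only [pow_zero]
    refine Tendsto.congr' ?_ tendsto_const_nhds
    filter_upwards [eventually_ge_atTop 1] with N hN
    exact (div_self (normCount_pos hy hN).ne').symm
  | succ k =>
    have h1 := tendsto_conv hy (coeffNonneg_treeSeries.pow (k + 1))
      (coeffNonneg_treeSeries_sub_pow k)
      ((sumsTo_treeSeries_critical hy).pow hg coeffNonneg_treeSeries _)
    have h2 := h1.sub (tendsto_pow_error hy k)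
    rw [sub_zero] at h2
    refine tendsto_of_tendsto_of_tendsto_of_le_of_le h2 h1 (fun N => ?_) fun N => ?_
    · simp only
      rw [← sub_div, ← sub_mul]
      refine div_le_div_of_nonneg_right (mul_le_mul_of_nonneg_right ?_ (pow_nonneg hg _))
        (normCount_nonneg hy N)
      -- Termwise this is X_n^{k+1} ≤ X_{n+1}^{k+1}, since the error was stated with X_n.
      rw [sub_le_iff_le_add, weightedSum, weightedSum, weightedSum, ← Finset.sum_add_distrib]
      refine Finset.sum_le_sum fun n _ => ?_
      rw [← map_add, ← mul_add]
      have h3 := (coeffNonneg_weightedSeries hy0 n).mul ((coeffNonneg_heightSeries n).pow_sub_pow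
        (coeffNonneg_heightSeries_succ_sub n) (k + 1)) N
      have e : weightedSeries y n * (heightSeries (n + 1) ^ (k + 1) +
          (treeSeries ^ (k + 1) - heightSeries n ^ (k + 1))) = weightedSeries y n *
          treeSeries ^ (k + 1) + weightedSeries y n *
          (heightSeries (n + 1) ^ (k + 1) - heightSeries n ^ (k + 1)) := by ring
      rw [e, map_add]
      linarith
    · simp only
      refine div_le_div_of_nonneg_right (mul_le_mul_of_nonneg_right (weightedSum_mono hy0
        (fun n => ?_) N) (pow_nonneg hg _)) (normCount_nonneg hy N)
      exact (coeffNonneg_heightSeries _).pow_sub_pow (coeffNonneg_treeSeries_sub _) _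

/-- The ratios that give the limits of the probabilities of balls. -/
theorem tendsto_weightedSum_div {y : ℝ} (hy : 2 ≤ y) (k e : ℕ) :
    Tendsto (fun N => weightedSum y (fun n => heightSeries (n + 1) ^ k) (N - e) /
      weightedCount y N) atTop (𝓝 (critical y ^ e * y⁻¹ ^ k)) := by
  have h2 := ((tendsto_weightedSum_pow hy k).comp (tendsto_sub_atTop_nat e)).mul
    (tendsto_normCount_sub_div hy e)
  have h3 := h2.const_mul (critical y ^ e)
  rw [mul_one] at h3
  refine h3.congr' ?_
  filter_upwards [eventually_ge_atTop (e + 1)] with N hN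
  have hg := (critical_pos hy).ne'
  simp only [Function.comp_apply]
  rw [div_mul_div_cancel₀ (normCount_pos hy (by omega)).ne', normCount]
  have : critical y ^ N = critical y ^ e * critical y ^ (N - e) := by
    rw [← pow_add]; congr 1; omega
  rw [this]
  field_simp

end PlanarTree

end

/-! ### Decomposition of a tree at its first vertex -/

noncomputable section

namespace PlanarTree

theorem mem_of_append_mem (T : PlanarTree) (w v : List ℕ) (h : w ++ v ∈ T.verts) : w ∈ T.verts := by
  induction v using List.reverseRecOn with
  | nil => simpa using h
  | append_singleton v n ih => exact ih (T.parent_mem _ n (by rwa [List.append_assoc]))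

theorem head_eq_zero (T : PlanarTree) {a : ℕ} {u : List ℕ} (h : a :: u ∈ T.verts) : a = 0 :=
  (T.root_degree_one a).mp (T.mem_of_append_mem [a] u h)

theorem stem_mem (T : PlanarTree) : [0] ∈ T.verts := (T.root_degree_one 0).mpr rfl

/-- The number of offspring of a vertex. -/
def offspring (T : PlanarTree) (w : List ℕ) : ℕ := {n : ℕ | w ++ [n] ∈ T.verts}.ncard

/-- By `left_mem` the positions of the offspring form a finite initial segment of `ℕ`, determined by
its cardinality. -/
theorem append_mem_iff (T : PlanarTree) (w : List ℕ) (n : ℕ) :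
    w ++ [n] ∈ T.verts ↔ n < T.offspring w := by
  have hfin := T.finite_offspring w
  have hdown : ∀ m n, m ≤ n → w ++ [n] ∈ T.verts → w ++ [m] ∈ T.verts := by
    intro m n h
    induction n, h using Nat.le_induction with
    | base => exact id
    | succ n _ ih => exact fun h => ih (T.left_mem w n h)
  constructor
  · intro h
    have h1 : (Set.Iic n) ⊆ {n : ℕ | w ++ [n] ∈ T.verts} := fun m hm => hdown m n hm h
    have h2 := Set.ncard_le_ncard h1 hfin
    rw [Set.ncard_eq_toFinset_card', Set.toFinset_Iic, Nat.card_Iic] at h2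
    exact h2
  · intro h
    by_contra hn
    have h1 : {n : ℕ | w ++ [n] ∈ T.verts} ⊆ Set.Iio n := fun m hm =>
      lt_of_not_ge fun hle => hn (hdown n m hle hm)
    have h2 := Set.ncard_le_ncard h1 (Set.finite_Iio n)
    rw [Set.ncard_eq_toFinset_card' (Set.Iio n), Set.toFinset_Iio, Nat.card_Iio] at h2
    exact absurd h (not_lt.mpr h2)

/-- The vertices of the tree whose first vertex has the given branches. -/
def nodeVerts (l : List PlanarTree) : List ℕ → Prop
  | [] => True
  | [a] => a = 0
  | a :: i :: u => a = 0 ∧ ∃ T, l[i]? = some T ∧ 0 :: u ∈ T.verts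

/-- The tree whose first vertex above the root has the given branches, from left to right. -/
def node (l : List PlanarTree) : PlanarTree where
  verts := {w | nodeVerts l w}
  root_mem := trivial
  parent_mem := by
    rintro (_ | ⟨a, _ | ⟨i, u⟩⟩) n h
    · trivial
    · exact h.1
    · obtain ⟨h0, T, hT, h⟩ := h
      exact ⟨h0, T, hT, T.parent_mem (0 :: u) n h⟩
  left_mem := by
    rintro (_ | ⟨a, _ | ⟨i, u⟩⟩) n h
    · exact absurd h (Nat.succ_ne_zero n)
    · obtain ⟨h0, T, hT, h⟩ := h
      obtain ⟨hn, -⟩ := List.getElem?_eq_some_iff.mp hT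
      exact ⟨h0, l[n], List.getElem?_eq_getElem (by omega), stem_mem _⟩
    · obtain ⟨h0, T, hT, h⟩ := h
      exact ⟨h0, T, hT, T.left_mem (0 :: u) n h⟩
  finite_offspring := by
    rintro (_ | ⟨a, _ | ⟨i, u⟩⟩)
    · exact Set.finite_singleton 0
    · refine (Set.finite_Iio l.length).subset ?_
      rintro n ⟨-, T, hT, -⟩
      exact (List.getElem?_eq_some_iff.mp hT).1
    · by_cases hi : i < l.length
      · refine (l[i].finite_offspring (0 :: u)).subset ?_
        rintro n ⟨-, T, hT, h⟩
        rw [List.getElem?_eq_getElem hi, Option.some_inj] at hT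
        subst hT
        exact h
      · refine Set.finite_empty.subset ?_
        rintro n ⟨-, T, hT, -⟩
        exact absurd (List.getElem?_eq_some_iff.mp hT).1 hi
  root_degree_one := fun _ => Iff.rfl

theorem cons_cons_mem_node (l : List PlanarTree) (a i : ℕ) (u : List ℕ) :
    a :: i :: u ∈ (node l).verts ↔ a = 0 ∧ ∃ T, l[i]? = some T ∧ 0 :: u ∈ T.verts := Iff.rfl

theorem pair_mem_node (l : List PlanarTree) (i : ℕ) :
    [0, i] ∈ (node l).verts ↔ i < l.length := by
  rw [cons_cons_mem_node]
  constructor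
  · rintro ⟨-, T, hT, -⟩
    exact (List.getElem?_eq_some_iff.mp hT).1
  · exact fun h => ⟨rfl, l[i], List.getElem?_eq_getElem h, stem_mem _⟩

/-- A branch has the common first vertex as its root and so keeps root degree one: its stem, coded
by `[0]`, becomes the vertex `[0, i]`. -/
theorem cons_mem_branch (l : List PlanarTree) {i : ℕ} (hi : i < l.length) (u : List ℕ) :
    0 :: i :: u ∈ (node l).verts ↔ 0 :: u ∈ l[i].verts := by
  rw [cons_cons_mem_node, List.getElem?_eq_getElem hi]
  simp

/-- The branch of `T` at the `i`-th offspring of its first vertex. -/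
def branch (T : PlanarTree) (i : ℕ) (hi : [0, i] ∈ T.verts) : PlanarTree where
  verts := {w | w = [] ∨ ∃ u, w = 0 :: u ∧ 0 :: i :: u ∈ T.verts}
  root_mem := Or.inl rfl
  parent_mem := by
    rintro (_ | ⟨a, u⟩) n h
    · exact Or.inl rfl
    · rcases h with h | ⟨v, hv, h⟩
      · simp at h
      · obtain ⟨rfl, rfl⟩ := List.cons.inj hv
        exact Or.inr ⟨u, rfl, T.parent_mem (0 :: i :: u) n h⟩
  left_mem := by
    rintro (_ | ⟨a, u⟩) n h
    · rcases h with h | ⟨v, hv, h⟩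
      · simp at h
      · simp at hv
    · rcases h with h | ⟨v, hv, h⟩
      · simp at h
      · obtain ⟨rfl, rfl⟩ := List.cons.inj hv
        exact Or.inr ⟨_, rfl, T.left_mem (0 :: i :: u) n h⟩
  finite_offspring := by
    rintro (_ | ⟨a, u⟩)
    · refine (Set.finite_singleton 0).subset ?_
      rintro n (h | ⟨v, hv, h⟩)
      · simp at h
      · exact (List.cons.inj hv).1
    · refine (T.finite_offspring (0 :: i :: u)).subset ?_
      rintro n (h | ⟨v, hv, h⟩)
      · simp at h
      · obtain ⟨rfl, rfl⟩ := List.cons.inj hv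
        exact h
  root_degree_one := by
    intro n
    constructor
    · rintro (h | ⟨v, hv, h⟩)
      · simp at h
      · exact (List.cons.inj hv).1
    · rintro rfl
      exact Or.inr ⟨[], rfl, hi⟩

theorem node_injective : Function.Injective node := by
  intro l l' h
  have hlen : l.length = l'.length := by
    refine le_antisymm (le_of_forall_lt fun i hi => ?_) (le_of_forall_lt fun i hi => ?_)
    · rwa [← pair_mem_node, ← h, pair_mem_node]
    · rwa [← pair_mem_node, h, pair_mem_node]
  refine List.ext_getElem hlen fun i hi hi' => ?_
  ext w
  rcases w with _ | ⟨a, u⟩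
  · simp [root_mem]
  · by_cases ha : a = 0
    · subst ha
      rw [← cons_mem_branch l hi, ← cons_mem_branch l' hi', h]
    · exact iff_of_false (fun h => ha (head_eq_zero _ h)) fun h => ha (head_eq_zero _ h)

theorem node_surjective : Function.Surjective node := by
  intro T
  have hmem : ∀ i : Fin (T.offspring [0]), [0, (i : ℕ)] ∈ T.verts := fun i =>
    (T.append_mem_iff [0] i).mpr i.2
  refine ⟨List.ofFn fun i : Fin (T.offspring [0]) => T.branch i (hmem i), ?_⟩
  ext w
  rcases w with _ | ⟨a, _ | ⟨i, u⟩⟩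
  · simp [root_mem]
  · rw [root_degree_one, root_degree_one]
  · by_cases ha : a = 0
    · subst ha
      by_cases hi : i < T.offspring [0]
      · rw [cons_mem_branch _ (by simpa using hi), List.getElem_ofFn]
        simp [branch]
      · refine iff_of_false (fun h => hi ?_) (fun h => hi ?_)
        · simpa using (pair_mem_node _ i).mp (mem_of_append_mem _ [0, i] u h)
        · exact (T.append_mem_iff [0] i).mp (T.mem_of_append_mem [0, i] u h)
    · exact iff_of_false (fun h => ha (head_eq_zero _ h)) fun h => ha (head_eq_zero _ h)

/-- Trees correspond to the lists of the branches at their first vertex. -/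
def nodeEquiv : List PlanarTree ≃ PlanarTree :=
  Equiv.ofBijective node ⟨node_injective, node_surjective⟩

/-- All vertices have distance at most `n` from the root. -/
def HeightLE (T : PlanarTree) (n : ℕ) : Prop := ∀ w ∈ T.verts, w.length ≤ n

/-- The leftmost path has length at least `n`. -/
def HasSpine (T : PlanarTree) (n : ℕ) : Prop := List.replicate n 0 ∈ T.verts

theorem height_le_iff (T : PlanarTree) (n : ℕ) : T.height ≤ n ↔ T.HeightLE n := by
  simp [height, HeightLE]

theorem not_heightLE_zero (T : PlanarTree) : ¬ T.HeightLE 0 := fun h => by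
  have := h [0] T.stem_mem
  simp at this

theorem heightLE_node (l : List PlanarTree) (n : ℕ) :
    (node l).HeightLE (n + 1) ↔ ∀ T ∈ l, T.HeightLE n := by
  constructor
  · intro h T hT
    obtain ⟨i, hi, rfl⟩ := List.mem_iff_getElem.mp hT
    rintro (_ | ⟨a, u⟩) hw
    · simp
    · obtain rfl := head_eq_zero _ hw
      have := h (0 :: i :: u) ((cons_mem_branch l hi u).mpr hw)
      simpa using this
  · rintro h (_ | ⟨a, _ | ⟨i, u⟩⟩) hw
    · simp
    · simp
    · obtain ⟨-, T, hT, hu⟩ := hw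
      have := h T (List.mem_of_getElem? hT) _ hu
      simpa using this

theorem hasSpine_node_cons (T : PlanarTree) (l : List PlanarTree) (n : ℕ) :
    (node (T :: l)).HasSpine (n + 2) ↔ T.HasSpine (n + 1) :=
  cons_mem_branch (T :: l) (i := 0) (by simp) (List.replicate n 0)

theorem not_hasSpine_node_nil (n : ℕ) : ¬ (node []).HasSpine (n + 2) := by
  rintro ⟨-, T, hT, -⟩
  simp at hT

theorem hasSpine_one (T : PlanarTree) : T.HasSpine 1 := T.stem_mem

theorem HasSpine.mono {T : PlanarTree} {m n : ℕ} (h : T.HasSpine n) (hmn : m ≤ n) :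
    T.HasSpine m := by
  refine T.mem_of_append_mem (List.replicate m 0) (List.replicate (n - m) 0) ?_
  rw [← List.replicate_add, Nat.add_sub_cancel' hmn]
  exact h

/-- At a finite height the equality of suprema splits into two conditions, each of which is
inherited through `node`. -/
theorem isOneSided_iff (T : PlanarTree) (n : ℕ) :
    T.IsOneSided ∧ T.height = n ↔ T.HeightLE n ∧ T.HasSpine n := by
  rw [← height_le_iff]
  have hle : T.leftmostPathLength ≤ T.height :=
    iSup₂_le fun k hk => by
      rw [height]
      simpa using le_iSup₂ (f := fun (w : List ℕ) (_ : w ∈ T.verts) => (w.length : ℕ∞)) _ hk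
  constructor
  · rintro ⟨h1, h2⟩
    refine ⟨h2.le, ?_⟩
    rcases n with _ | n
    · exact T.root_mem
    · by_contra hn
      have h3 : T.leftmostPathLength ≤ n := by
        refine iSup₂_le fun k hk => ?_
        by_contra hkn
        have : n + 1 ≤ k := by
          have h4 : n < k := by simpa using hkn
          omega
        exact hn (HasSpine.mono (n := k) hk this)
      rw [h1, h2] at h3
      have : n + 1 ≤ n := by exact_mod_cast h3
      omega
  · rintro ⟨h1, h2⟩
    have h3 : (n : ℕ∞) ≤ T.leftmostPathLength :=
      le_iSup₂ (f := fun (k : ℕ) (_ : List.replicate k 0 ∈ T.verts) => (k : ℕ∞)) n h2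
    have h4 : T.height = n := le_antisymm h1 (h3.trans hle)
    exact ⟨le_antisymm hle (h1.trans h3), h4⟩

/-- The number of edges whose upper endpoint has a distance from the root satisfying `p`. -/
def edgeCount (p : ℕ → Prop) (T : PlanarTree) : ℕ∞ := {w ∈ T.edges | p w.length}.encard

theorem edgeCount_node_nil (p : ℕ → Prop) [Decidable (p 1)] :
    edgeCount p (node []) = if p 1 then 1 else 0 := by
  have : {w ∈ (node []).edges | p w.length} = {w | w = [0] ∧ p 1} := by
    ext w
    rcases w with _ | ⟨a, _ | ⟨i, u⟩⟩
    · simp [edges]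
    · simp [edges, root_degree_one]
    · simp [edges, cons_cons_mem_node]
  rw [edgeCount, this]
  split_ifs with h <;> simp [h]

/-- Shifting the branches by one position to the right. -/
def shiftBranch : List ℕ → List ℕ
  | a :: i :: u => a :: (i + 1) :: u
  | w => w

/-- Grafting a branch to the leftmost position. -/
def graftBranch : List ℕ → List ℕ
  | a :: u => a :: 0 :: u
  | [] => []

/-- The edges of the leftmost branch are disjoint from the others, whose positions shift by one; the
stem is counted with the others. A general `p` treats size, levels and balls in one induction. -/
theorem edgeCount_node_cons (p : ℕ → Prop) (T : PlanarTree) (l : List PlanarTree) :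
    edgeCount p (node (T :: l)) = edgeCount (fun n => p (n + 1)) T + edgeCount p (node l) := by
  have hunion : {w ∈ (node (T :: l)).edges | p w.length} =
      graftBranch '' {w ∈ T.edges | p (w.length + 1)} ∪
        shiftBranch '' {w ∈ (node l).edges | p w.length} := by
    ext w
    constructor
    · rintro ⟨⟨hw, hne⟩, hp⟩
      rcases w with _ | ⟨a, _ | ⟨_ | i, u⟩⟩
      · exact absurd rfl hne
      · exact Or.inr ⟨[a], ⟨⟨hw, hne⟩, hp⟩, rfl⟩
      · obtain ⟨rfl, S, hS, hu⟩ := hw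
        obtain rfl : T = S := by simpa using hS
        exact Or.inl ⟨0 :: u, ⟨⟨hu, by simp⟩, hp⟩, rfl⟩
      · obtain ⟨rfl, S, hS, hu⟩ := hw
        exact Or.inr ⟨0 :: i :: u, ⟨⟨⟨rfl, S, by simpa using hS, hu⟩, by simp⟩, hp⟩, rfl⟩
    · rintro (⟨v, ⟨⟨hv, hne⟩, hp⟩, rfl⟩ | ⟨v, ⟨⟨hv, hne⟩, hp⟩, rfl⟩)
      · rcases v with _ | ⟨a, u⟩
        · exact absurd rfl hne
        · obtain rfl := head_eq_zero _ hv
          exact ⟨⟨⟨rfl, T, rfl, hv⟩, by simp [graftBranch]⟩, hp⟩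
      · rcases v with _ | ⟨a, _ | ⟨i, u⟩⟩
        · exact absurd rfl hne
        · exact ⟨⟨hv, hne⟩, hp⟩
        · obtain ⟨rfl, S, hS, hu⟩ := hv
          exact ⟨⟨⟨rfl, S, by simpa using hS, hu⟩, by simp [shiftBranch]⟩, hp⟩
  have hdisj : Disjoint (graftBranch '' {w ∈ T.edges | p (w.length + 1)})
      (shiftBranch '' {w ∈ (node l).edges | p w.length}) := by
    rw [Set.disjoint_left]
    rintro _ ⟨v, ⟨⟨-, hne⟩, -⟩, rfl⟩ ⟨v', ⟨⟨-, hne'⟩, -⟩, h⟩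
    rcases v with _ | ⟨a, u⟩
    · exact hne rfl
    · rcases v' with _ | ⟨b, _ | ⟨i, u'⟩⟩ <;> simp [graftBranch, shiftBranch] at h
  have hinj1 : Set.InjOn graftBranch {w ∈ T.edges | p (w.length + 1)} := by
    rintro (_ | ⟨a, u⟩) ⟨⟨-, hne⟩, -⟩ (_ | ⟨b, v⟩) ⟨⟨-, hne'⟩, -⟩ h
    · rfl
    · exact absurd rfl hne
    · exact absurd rfl hne'
    · simpa [graftBranch] using h
  have hinj2 : Function.Injective shiftBranch := by
    rintro (_ | ⟨a, _ | ⟨i, u⟩⟩) (_ | ⟨b, _ | ⟨j, v⟩⟩) h <;> simp_all [shiftBranch]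
  rw [edgeCount, hunion, Set.encard_union_eq hdisj, hinj1.encard_image, hinj2.encard_image]
  rfl

theorem edgeCount_node (p : ℕ → Prop) [Decidable (p 1)] (l : List PlanarTree) :
    edgeCount p (node l) =
      (l.map (edgeCount fun n => p (n + 1))).sum + if p 1 then 1 else 0 := by
  induction l with
  | nil => rw [edgeCount_node_nil]; simp
  | cons T l ih => rw [edgeCount_node_cons, ih, List.map_cons, List.sum_cons, add_assoc]

theorem size_eq_edgeCount (T : PlanarTree) : T.size = edgeCount (fun _ => True) T := by
  simp [size, edgeCount]

theorem size_node (l : List PlanarTree) : (node l).size = (l.map size).sum + 1 := by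
  have e : size = edgeCount fun _ => True := funext size_eq_edgeCount
  rw [e, edgeCount_node]
  simp

theorem ball_finite (T : PlanarTree) (r : ℕ) : (T.ball r).Finite := by
  refine (Set.Finite.biUnion (Set.finite_Iic r) fun n _ => T.level_finite n).subset ?_
  intro w hw
  simp only [Set.mem_iUnion]
  exact ⟨w.length, hw.2, hw.1, rfl⟩

theorem cast_levelCard (T : PlanarTree) (r : ℕ) :
    (T.levelCard (r + 1) : ℕ∞) = edgeCount (fun n => n = r + 1) T := by
  rw [levelCard, (T.level_finite _).cast_ncard_eq, edgeCount]
  congr 1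
  ext w
  simp only [level, edges, Set.mem_ofPred_eq]
  constructor
  · rintro ⟨h1, h2⟩
    exact ⟨⟨h1, by rintro rfl; simp at h2⟩, h2⟩
  · rintro ⟨⟨h1, -⟩, h2⟩
    exact ⟨h1, h2⟩

theorem cast_ballSize (T : PlanarTree) (r : ℕ) :
    (T.ballSize r : ℕ∞) = edgeCount (fun n => n ≤ r) T := by
  rw [ballSize, ((T.ball_finite r).inter_of_left _).cast_ncard_eq, edgeCount]
  congr 1
  ext w
  simp only [ball, edges, Set.mem_ofPred_eq, Set.mem_inter_iff]
  tauto

theorem levelCard_node (l : List PlanarTree) (r : ℕ) :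
    (node l).levelCard (r + 2) = (l.map fun T => T.levelCard (r + 1)).sum := by
  have h := edgeCount_node (fun n => n = r + 2) l
  rw [← cast_levelCard, if_neg (by omega), add_zero] at h
  have e : (edgeCount fun n => n + 1 = r + 2) = fun T => ((T.levelCard (r + 1) : ℕ) : ℕ∞) := by
    funext T
    rw [cast_levelCard]
    simp
  rw [e] at h
  have h2 : (l.map fun T => ((T.levelCard (r + 1) : ℕ) : ℕ∞)).sum =
      (((l.map fun T => T.levelCard (r + 1)).sum : ℕ) : ℕ∞) := by
    rw [Nat.cast_list_sum, List.map_map]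
    rfl
  rw [h2] at h
  exact_mod_cast h

theorem ballSize_node (l : List PlanarTree) (r : ℕ) :
    (node l).ballSize (r + 1) = (l.map fun T => T.ballSize r).sum + 1 := by
  have h := edgeCount_node (fun n => n ≤ r + 1) l
  rw [← cast_ballSize, if_pos (by omega)] at h
  have e : (edgeCount fun n => n + 1 ≤ r + 1) = fun T => ((T.ballSize r : ℕ) : ℕ∞) := by
    funext T
    rw [cast_ballSize]
    simp
  rw [e] at h
  have h2 : (l.map fun T => ((T.ballSize r : ℕ) : ℕ∞)).sum =
      (((l.map fun T => T.ballSize r).sum : ℕ) : ℕ∞) := by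
    rw [Nat.cast_list_sum, List.map_map]
    rfl
  rw [h2] at h
  exact_mod_cast h

theorem ball_eq_iff (T T' : PlanarTree) (r : ℕ) :
    T.ball r = T'.ball r ↔ ∀ w : List ℕ, w.length ≤ r → (w ∈ T.verts ↔ w ∈ T'.verts) := by
  simp only [Set.ext_iff, ball, Set.mem_ofPred_eq]
  exact forall_congr' fun w => by tauto

/-- A radius of at least 2 makes the number of branches visible, so that the two lists have equal
length and can be compared entrywise. -/
theorem ball_node_eq_iff (l l' : List PlanarTree) (r : ℕ) :
    (node l).ball (r + 2) = (node l').ball (r + 2) ↔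
      List.Forall₂ (fun T T' => T.ball (r + 1) = T'.ball (r + 1)) l l' := by
  rw [List.forall₂_iff_get, ball_eq_iff]
  simp only [ball_eq_iff, List.get_eq_getElem]
  constructor
  · intro h
    have hpair : ∀ i, i < l.length ↔ i < l'.length := fun i => by
      rw [← pair_mem_node, ← pair_mem_node]
      exact h [0, i] (by simp)
    refine ⟨le_antisymm (le_of_forall_lt fun i hi => (hpair i).mp hi)
      (le_of_forall_lt fun i hi => (hpair i).mpr hi), ?_⟩
    rintro i hi hi' (_ | ⟨a, u⟩) hw
    · simp [root_mem]
    · by_cases ha : a = 0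
      · subst ha
        rw [← cons_mem_branch l hi, ← cons_mem_branch l' hi']
        exact h _ (by simpa using hw)
      · exact iff_of_false (fun h => ha (head_eq_zero _ h)) fun h => ha (head_eq_zero _ h)
  · rintro ⟨hlen, h⟩ (_ | ⟨a, _ | ⟨i, u⟩⟩) hw
    · simp [root_mem]
    · rw [root_degree_one, root_degree_one]
    · by_cases ha : a = 0
      · subst ha
        by_cases hi : i < l.length
        · have hi' : i < l'.length := by omega
          rw [cons_mem_branch l hi, cons_mem_branch l' hi']
          exact h i hi hi' _ (by simpa using hw)
        · refine iff_of_false (fun h => hi ?_) (fun h => hi ?_)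
          · exact (pair_mem_node _ i).mp (mem_of_append_mem _ [0, i] u h)
          · rw [hlen]
            exact (pair_mem_node _ i).mp (mem_of_append_mem _ [0, i] u h)
      · exact iff_of_false (fun h => ha (head_eq_zero _ h)) fun h => ha (head_eq_zero _ h)

end PlanarTree

end

/-! ### Counting trees: from decompositions to generating series -/

noncomputable section

namespace PlanarTree

open Classical in
/-- The number of objects of size `N` with the property `p`. -/
def countBy {α : Type*} (s : α → ℕ∞) (p : α → Prop) (N : ℕ) : ℝ≥0∞ :=
  ∑' a, if p a ∧ s a = N then 1 else 0

/-- The number of edges of a list of trees. -/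
def listSize (l : List PlanarTree) : ℕ∞ := (l.map size).sum

/-- The counting sequence `A` has the generating series `P`. -/
def Represents (A : ℕ → ℝ≥0∞) (P : PowerSeries ℝ) : Prop :=
  CoeffNonneg P ∧ ∀ N, A N = ENNReal.ofReal (PowerSeries.coeff N P)

theorem countBy_congr {α : Type*} {s : α → ℕ∞} {p q : α → Prop} (h : ∀ a, p a ↔ q a) :
    countBy s p = countBy s q := by
  rw [funext fun a => propext (h a)]

theorem antidiagonal_sum_ite (a b : ℕ∞) (N : ℕ) :
    ∑ x ∈ Finset.HasAntidiagonal.antidiagonal N,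
      (if a = x.1 then (1 : ℝ≥0∞) else 0) * (if b = x.2 then 1 else 0) =
      if a + b = N then 1 else 0 := by
  split_ifs with h
  · obtain ⟨i, rfl⟩ := ENat.ne_top_iff_exists.mp (show a ≠ ⊤ by rintro rfl; simp at h)
    obtain ⟨j, rfl⟩ := ENat.ne_top_iff_exists.mp (show b ≠ ⊤ by rintro rfl; simp at h)
    have hN : i + j = N := by exact_mod_cast h
    rw [Finset.sum_eq_single (i, j)]
    · simp
    · rintro ⟨k, l⟩ - hne
      by_cases h1 : i = k
      · have h2 : j ≠ l := fun h2 => hne (by rw [h1, h2])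
        simp [h2]
      · simp [h1]
    · intro hn
      exact absurd (Finset.HasAntidiagonal.mem_antidiagonal.mpr hN) hn
  · refine Finset.sum_eq_zero fun x hx => ?_
    split_ifs with h1 h2
    · refine absurd ?_ h
      rw [h1, h2, ← Finset.HasAntidiagonal.mem_antidiagonal.mp hx]
      push_cast
      rfl
    all_goals simp

open Classical in
theorem countBy_prod {α β : Type*} (s : α → ℕ∞) (t : β → ℕ∞) (p : α → Prop) (q : β → Prop)
    (N : ℕ) :
    countBy (fun x : α × β => s x.1 + t x.2) (fun x => p x.1 ∧ q x.2) N =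
      ∑ x ∈ Finset.HasAntidiagonal.antidiagonal N, countBy s p x.1 * countBy t q x.2 := by
  have e : ∀ x : ℕ × ℕ, countBy s p x.1 * countBy t q x.2 = ∑' z : α × β,
      (if p z.1 ∧ s z.1 = x.1 then (1 : ℝ≥0∞) else 0) * (if q z.2 ∧ t z.2 = x.2 then 1 else 0) := by
    intro x
    rw [ENNReal.tsum_prod (f := fun a b => (if p a ∧ s a = x.1 then (1 : ℝ≥0∞) else 0) *
      (if q b ∧ t b = x.2 then 1 else 0)), countBy, countBy, ← ENNReal.tsum_mul_right]
    simp only [ENNReal.tsum_mul_left]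
  rw [Finset.sum_congr rfl fun x _ => e x, ← Summable.tsum_finsetSum fun _ _ => ENNReal.summable,
    countBy]
  refine tsum_congr fun z => ?_
  by_cases hp : p z.1
  · by_cases hq : q z.2
    · simp only [hp, hq, true_and]
      exact (antidiagonal_sum_ite _ _ _).symm
    · simp [hq]
  · simp [hp]

theorem tsum_list {α : Type*} (f : List α → ℝ≥0∞) :
    ∑' l, f l = f [] + ∑' x : α × List α, f (x.1 :: x.2) := by
  let e : Unit ⊕ α × List α ≃ List α :=
    { toFun := Sum.elim (fun _ => []) fun x => x.1 :: x.2
      invFun := fun l => match l with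
        | [] => Sum.inl ()
        | a :: l => Sum.inr (a, l)
      left_inv := by rintro (_ | ⟨a, l⟩) <;> rfl
      right_inv := by rintro (_ | ⟨a, l⟩) <;> rfl }
  have h := HasSum.sum (f := f ∘ e) (a := f []) (b := ∑' x : α × List α, f (x.1 :: x.2))
    (by simp [e, Function.comp_def])
    ENNReal.summable.hasSum
  rw [← e.tsum_eq f]
  exact h.tsum_eq

namespace Represents

variable {A B : ℕ → ℝ≥0∞} {P Q : PowerSeries ℝ}

theorem coeff_mul_antidiagonal (hA : Represents A P) (hB : Represents B Q) (N : ℕ) :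
    ∑ x ∈ Finset.HasAntidiagonal.antidiagonal N, A x.1 * B x.2 =
      ENNReal.ofReal (PowerSeries.coeff N (P * Q)) := by
  rw [PowerSeries.coeff_mul, ENNReal.ofReal_sum_of_nonneg fun x _ => mul_nonneg (hA.1 _) (hB.1 _)]
  refine Finset.sum_congr rfl fun x _ => ?_
  rw [hA.2, hB.2, ENNReal.ofReal_mul (hA.1 _)]

/-- Product rule for a first tree and the remaining list. Counts take values in `ℝ≥0∞`, so no
summability has to be checked. -/
theorem cons {p : PlanarTree → Prop} {q r : List PlanarTree → Prop} (h0 : ¬ r [])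
    (hr : ∀ T l, r (T :: l) ↔ p T ∧ q l) (hA : Represents (countBy size p) P)
    (hB : Represents (countBy listSize q) Q) : Represents (countBy listSize r) (P * Q) := by
  classical
  refine ⟨hA.1.mul hB.1, fun N => ?_⟩
  rw [← hA.coeff_mul_antidiagonal hB, ← countBy_prod, countBy, tsum_list, countBy, if_neg
    (fun h => h0 h.1), zero_add]
  refine tsum_congr fun x => ?_
  simp only [hr, listSize, List.map_cons, List.sum_cons]
  congr

theorem nil {r : List PlanarTree → Prop} (hr : ∀ l, r l ↔ l = []) :
    Represents (countBy listSize r) 1 := by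
  classical
  refine ⟨CoeffNonneg.one, fun N => ?_⟩
  rw [countBy, tsum_list]
  simp only [hr, reduceCtorEq, false_and, if_false, tsum_zero, add_zero, true_and]
  rw [PowerSeries.coeff_one]
  have : listSize [] = 0 := rfl
  rw [this]
  by_cases h : N = 0
  · simp [h]
  · have : (0 : ℕ∞) ≠ N := by exact_mod_cast (Ne.symm h)
    simp [h, this]

/-- Sequence rule: splitting off the first tree gives the recursion I = 1 + P I on both sides, which
is well-founded because P has no constant term. -/
theorem all {p : PlanarTree → Prop} (h0 : PowerSeries.constantCoeff P = 0)
    (hA : Represents (countBy size p) P) :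
    Represents (countBy listSize fun l => ∀ T ∈ l, p T) (1 - P)⁻¹ := by
  classical
  have hI := hA.1.inv_one_sub h0
  refine ⟨hI, fun N => ?_⟩
  induction N using Nat.strong_induction_on with
  | _ N ih =>
    have hterm : ∀ x : ℕ × ℕ, 0 ≤ PowerSeries.coeff x.1 P * PowerSeries.coeff x.2 (1 - P)⁻¹ :=
      fun x => mul_nonneg (hA.1 _) (hI _)
    rw [coeff_inv_one_sub h0, ENNReal.ofReal_add (by split_ifs <;> norm_num)
      (Finset.sum_nonneg fun x _ => hterm x), ENNReal.ofReal_sum_of_nonneg fun x _ => hterm x,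
      countBy, tsum_list]
    congr 1
    · have : listSize [] = 0 := rfl
      rw [this]
      by_cases h : N = 0
      · simp [h]
      · have : (0 : ℕ∞) ≠ N := by exact_mod_cast (Ne.symm h)
        simp [h, this]
    · have e := countBy_prod size listSize p (fun l => ∀ T ∈ l, p T) N
      rw [countBy] at e
      simp only [List.forall_mem_cons, listSize, List.map_cons, List.sum_cons] at e ⊢
      refine Eq.trans (tsum_congr fun x => by congr) (e.trans ?_)
      refine Finset.sum_congr rfl fun x hx => ?_
      have hx' := Finset.HasAntidiagonal.mem_antidiagonal.mp hx
      rw [hA.2, ENNReal.ofReal_mul (hA.1 _)]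
      rcases Nat.eq_zero_or_pos x.1 with h | h
      · rw [h, PowerSeries.coeff_zero_eq_constantCoeff_apply, h0, ENNReal.ofReal_zero, zero_mul,
          zero_mul]
      · have := ih x.2 (by omega)
        rw [← this]

theorem node {p : PlanarTree → Prop} {q : List PlanarTree → Prop}
    (hp : ∀ l, p (PlanarTree.node l) ↔ q l) (h : Represents (countBy listSize q) P) :
    Represents (countBy size p) (PowerSeries.X * P) := by
  classical
  refine ⟨CoeffNonneg.X.mul h.1, fun N => ?_⟩
  rw [countBy, ← nodeEquiv.tsum_eq]
  have e : ∀ l, nodeEquiv l = PlanarTree.node l := fun _ => rfl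
  simp only [e, hp, size_node]
  rcases N with _ | N
  · rw [PowerSeries.coeff_zero_X_mul, ENNReal.ofReal_zero]
    simp
  · rw [PowerSeries.coeff_succ_X_mul, ← h.2, countBy]
    refine tsum_congr fun l => ?_
    have : (List.map size l).sum + 1 = ((N + 1 : ℕ) : ℕ∞) ↔ listSize l = N := by
      push_cast
      exact (ENat.add_left_injective_of_ne_top ENat.one_ne_top).eq_iff
    simp only [this]

end Represents

theorem represents_heightLE (n : ℕ) :
    Represents (countBy size fun T => T.HeightLE n) (heightSeries n) := by
  induction n with
  | zero =>
    refine ⟨CoeffNonneg.zero, fun N => ?_⟩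
    simp [countBy, not_heightLE_zero, heightSeries_zero]
  | succ n ih =>
    exact Represents.node (fun l => heightLE_node l n)
      (Represents.all (constantCoeff_heightSeries n) ih)

/-- The leftmost branch is one-sided and one level lower, while the others only obey the height
bound. Together with the stem they contribute g/(1 - X_{n+1}) = X_{n+2}. -/
theorem represents_oneSided (n : ℕ) :
    Represents (countBy size fun T => T.HeightLE (n + 1) ∧ T.HasSpine (n + 1))
      (oneSidedSeries (n + 1)) := by
  induction n with
  | zero =>
    have e : oneSidedSeries 1 = PowerSeries.X * 1 := by
      rw [oneSidedSeries, Finset.prod_range_one, zero_add, heightSeries_one, mul_one]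
    rw [e, zero_add]
    refine Represents.node (fun l => ?_) (Represents.nil (r := fun l => l = []) fun l => Iff.rfl)
    rw [and_iff_left (hasSpine_one _), ← zero_add 1, heightLE_node]
    simp only [not_heightLE_zero, imp_false]
    exact List.eq_nil_iff_forall_not_mem.symm
  | succ n ih =>
    have e : oneSidedSeries (n + 2) =
        PowerSeries.X * (oneSidedSeries (n + 1) * (1 - heightSeries (n + 1))⁻¹) := by
      rw [oneSidedSeries_succ (n + 1), heightSeries_succ (n + 1)]
      ring
    rw [e]
    refine Represents.node (q := fun l => (PlanarTree.node l).HeightLE (n + 2) ∧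
      (PlanarTree.node l).HasSpine (n + 2)) (fun l => Iff.rfl) (Represents.cons
      (fun h => not_hasSpine_node_nil n h.2) (fun T l => ?_) ih
      (Represents.all (constantCoeff_heightSeries _) (represents_heightLE (n + 1))))
    rw [heightLE_node, hasSpine_node_cons, List.forall_mem_cons]
    tauto

theorem ball_one_eq (T T' : PlanarTree) : T.ball 1 = T'.ball 1 := by rw [ball_one, ball_one]

theorem ballSize_zero (T : PlanarTree) : T.ballSize 0 = 0 := by
  have e : T.ball 0 ∩ T.edges = ∅ := by
    ext w
    simp only [ball, edges, Set.mem_inter_iff, Set.mem_ofPred_eq, Set.mem_empty_iff_false,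
      iff_false, not_and, Nat.le_zero, List.length_eq_zero_iff]
    tauto
  rw [ballSize, e, Set.ncard_empty]

theorem levelCard_one (T : PlanarTree) : T.levelCard 1 = 1 := by
  have e : T.level 1 = {[0]} := by
    ext w
    rcases w with _ | ⟨a, _ | ⟨i, u⟩⟩
    · simp [level]
    · simp [level, root_degree_one]
    · simp [level]
  rw [levelCard, e, Set.ncard_singleton]

/-- The induction hypothesis is an assumption here, so that this serves inside the induction of
`represents_ball` and again in `represents_oneSided_ball`. -/
theorem represents_list_ball_of (n r : ℕ)
    (ih : ∀ T₀ : PlanarTree, Represents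
      (countBy size fun T => T₀.ball (r + 1) = T.ball (r + 1) ∧ T.HeightLE (r + 1 + n))
      (PowerSeries.X ^ T₀.ballSize r * heightSeries (n + 1) ^ T₀.levelCard (r + 1)))
    (l₀ : List PlanarTree) :
    Represents (countBy listSize fun l => List.Forall₂
        (fun T₀ T => T₀.ball (r + 1) = T.ball (r + 1)) l₀ l ∧ ∀ T ∈ l, T.HeightLE (r + 1 + n))
      (PowerSeries.X ^ (l₀.map fun T => T.ballSize r).sum *
        heightSeries (n + 1) ^ (l₀.map fun T => T.levelCard (r + 1)).sum) := by
  induction l₀ with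
  | nil =>
    rw [List.map_nil, List.map_nil, List.sum_nil, pow_zero, pow_zero, one_mul]
    refine Represents.nil fun l => ?_
    rw [List.forall₂_nil_left_iff]
    constructor
    · exact fun h => h.1
    · rintro rfl
      simp
  | cons T₀ l₀ ihl =>
    have e : PowerSeries.X ^ ((T₀ :: l₀).map fun T => T.ballSize r).sum *
        heightSeries (n + 1) ^ ((T₀ :: l₀).map fun T => T.levelCard (r + 1)).sum =
        (PowerSeries.X ^ T₀.ballSize r * heightSeries (n + 1) ^ T₀.levelCard (r + 1)) *
        (PowerSeries.X ^ (l₀.map fun T => T.ballSize r).sum *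
          heightSeries (n + 1) ^ (l₀.map fun T => T.levelCard (r + 1)).sum) := by
      simp only [List.map_cons, List.sum_cons, pow_add]
      ring
    rw [e]
    refine Represents.cons (fun h => ?_) (fun T l => ?_) (ih T₀) ihl
    · simp at h
    · rw [List.forall₂_cons, List.forall_mem_cons]
      tauto

/-- The edges of B_r are fixed. Each vertex of level r + 1, with the edge to its parent as stem,
starts a free tree of height at most n + 1. -/
theorem represents_ball (n r : ℕ) (T₀ : PlanarTree) :
    Represents (countBy size fun T => T₀.ball (r + 1) = T.ball (r + 1) ∧ T.HeightLE (r + 1 + n))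
      (PowerSeries.X ^ T₀.ballSize r * heightSeries (n + 1) ^ T₀.levelCard (r + 1)) := by
  induction r generalizing T₀ with
  | zero =>
    rw [ballSize_zero, zero_add, levelCard_one, pow_zero, one_mul, pow_one, add_comm 1 n]
    rw [countBy_congr fun T => and_iff_right (ball_one_eq T₀ T)]
    exact represents_heightLE (n + 1)
  | succ r ih =>
    obtain ⟨l₀, rfl⟩ := node_surjective T₀
    rw [ballSize_node, levelCard_node, pow_succ', mul_assoc]
    refine Represents.node (fun l => ?_) (represents_list_ball_of n r ih l₀)
    rw [ball_node_eq_iff, show r + 1 + 1 + n = (r + 1 + n) + 1 by omega, heightLE_node]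

theorem levelCard_pos_of_hasSpine {T : PlanarTree} {r : ℕ} (h : T.HasSpine r) :
    0 < T.levelCard r :=
  (Set.ncard_pos (T.level_finite r)).mpr ⟨_, h, List.length_replicate⟩

/-- As in `represents_ball`, except that the leftmost vertex of level r + 1 starts a one-sided tree
of height exactly n + 1. -/
theorem represents_oneSided_ball (n r : ℕ) (T₀ : PlanarTree) (h : T₀.HasSpine (r + 1)) :
    Represents (countBy size fun T => T₀.ball (r + 1) = T.ball (r + 1) ∧
        T.HeightLE (r + 1 + n) ∧ T.HasSpine (r + 1 + n))
      (PowerSeries.X ^ T₀.ballSize r * (oneSidedSeries (n + 1) *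
        heightSeries (n + 1) ^ (T₀.levelCard (r + 1) - 1))) := by
  induction r generalizing T₀ with
  | zero =>
    rw [ballSize_zero, zero_add, levelCard_one, pow_zero, one_mul, Nat.sub_self, pow_zero, mul_one,
      add_comm 1 n]
    rw [countBy_congr fun T => and_iff_right (ball_one_eq T₀ T)]
    exact represents_oneSided n
  | succ r ih =>
    obtain ⟨_ | ⟨T₁, l₁⟩, rfl⟩ := node_surjective T₀
    · exact absurd h (not_hasSpine_node_nil r)
    rw [hasSpine_node_cons] at h
    -- Lets the truncated subtraction of 1 pass to the leftmost branch.
    have hpos := levelCard_pos_of_hasSpine h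
    rw [ballSize_node, levelCard_node, pow_succ', mul_assoc]
    have e : PowerSeries.X ^ ((T₁ :: l₁).map fun T => T.ballSize r).sum *
        (oneSidedSeries (n + 1) * heightSeries (n + 1) ^
          (((T₁ :: l₁).map fun T => T.levelCard (r + 1)).sum - 1)) =
        (PowerSeries.X ^ T₁.ballSize r * (oneSidedSeries (n + 1) *
          heightSeries (n + 1) ^ (T₁.levelCard (r + 1) - 1))) *
        (PowerSeries.X ^ (l₁.map fun T => T.ballSize r).sum *
          heightSeries (n + 1) ^ (l₁.map fun T => T.levelCard (r + 1)).sum) := by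
      simp only [List.map_cons, List.sum_cons]
      rw [Nat.sub_add_comm hpos, pow_add, pow_add]
      ring
    rw [e]
    refine Represents.node (q := fun l => (node (T₁ :: l₁)).ball (r + 2) = (node l).ball (r + 2) ∧
      (node l).HeightLE (r + 2 + n) ∧ (node l).HasSpine (r + 2 + n)) (fun l => Iff.rfl)
      (Represents.cons (fun h => ?_) (fun T l => ?_) (ih T₁ h) 
        (represents_list_ball_of n r (represents_ball n r) l₁))
    · rw [ball_node_eq_iff] at h
      simp at h
    · rw [ball_node_eq_iff, List.forall₂_cons, show r + 2 + n = (r + 1 + n) + 1 by omega,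
        heightLE_node, List.forall_mem_cons, show r + 1 + n + 1 = (r + n) + 2 by omega,
        hasSpine_node_cons, show r + n + 1 = r + 1 + n by omega]
      tauto

end PlanarTree

end

/-! ### Partition function, probabilities of balls and weak convergence -/

noncomputable section

namespace PlanarTree

/-- The nonempty prefixes of a vertex are distinct edges. -/
theorem height_le_size (T : PlanarTree) : T.height ≤ T.size := by
  refine iSup₂_le fun w hw => ?_
  have hinj : Set.InjOn (fun i => w.take (i + 1)) (Finset.range w.length : Set ℕ) := by
    intro i hi j hj h
    have h1 := congrArg List.length h
    simp only [List.length_take, Finset.coe_range, Set.mem_Iio] at h1 hi hj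
    omega
  have hsub : (fun i => w.take (i + 1)) '' (Finset.range w.length : Set ℕ) ⊆ T.edges := by
    rintro _ ⟨i, hi, rfl⟩
    simp only [Finset.coe_range, Set.mem_Iio] at hi
    refine ⟨T.mem_of_append_mem _ (w.drop (i + 1)) (by rwa [List.take_append_drop]), fun h => ?_⟩
    have := congrArg List.length h
    rw [List.length_take, List.length_nil] at this
    omega
  have h := Set.encard_le_encard hsub
  rw [hinj.encard_image, Set.encard_coe_eq_coe_finsetCard, Finset.card_range] at h
  exact h

theorem finite_verts_iff (T : PlanarTree) : T.verts.Finite ↔ T.size ≠ ⊤ := by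
  rw [size, Set.encard_ne_top_iff]
  constructor
  · exact fun h => h.subset fun w hw => hw.1
  · intro h
    refine (h.insert []).subset fun w hw => ?_
    by_cases h0 : w = []
    · exact Or.inl h0
    · exact Or.inr ⟨hw, h0⟩

theorem weight_eq (μ : ℝ) (T : PlanarTree) : weight μ T = Real.exp (-μ) ^ T.height.toNat := by
  rw [weight, ← Real.exp_nat_mul, mul_comm]

theorem weight_pos (μ : ℝ) (T : PlanarTree) : 0 < weight μ T := Real.exp_pos _

open Classical in
/-- The total weight of the one-sided trees with `N` edges satisfying `p`. -/
theorem tsum_weight (μ : ℝ) (p : PlanarTree → Prop) (N : ℕ) :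
    ∑' T : oneSided N, (if p T then ENNReal.ofReal (weight μ T) else 0) =
      ∑' h : ℕ, ENNReal.ofReal (Real.exp (-μ) ^ h) *
        countBy size (fun T => p T ∧ T.HeightLE h ∧ T.HasSpine h) N := by
  rw [tsum_subtype (oneSided N) fun T => if p T then ENNReal.ofReal (weight μ T) else 0]
  simp only [countBy, ← ENNReal.tsum_mul_left]
  rw [ENNReal.tsum_comm]
  refine tsum_congr fun T => ?_
  by_cases hT : T ∈ oneSided N
  · obtain ⟨h1, h2⟩ := hT
    have hfin : T.height ≠ ⊤ := by
      have := T.height_le_size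
      rw [h2] at this
      exact ne_top_of_le_ne_top (ENat.natCast_ne_top N) this
    obtain ⟨n, hn⟩ := ENat.ne_top_iff_exists.mp hfin
    have hs := (isOneSided_iff T n).mp ⟨h1, hn.symm⟩
    rw [Set.indicator_of_mem (show T ∈ oneSided N from ⟨h1, h2⟩), tsum_eq_single n]
    · have : T.height.toNat = n := by rw [← hn]; rfl
      simp [hs, h2, weight_eq, this]
    · intro h hne
      have : ¬ (T.HeightLE h ∧ T.HasSpine h) := by
        intro hh
        have h3 := ((isOneSided_iff T h).mpr hh).2
        rw [← hn] at h3
        exact hne (by exact_mod_cast h3.symm)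
      simp [this]
  · rw [Set.indicator_of_notMem hT]
    symm
    rw [ENNReal.tsum_eq_zero]
    intro h
    rw [if_neg, mul_zero]
    rintro ⟨⟨-, hh⟩, hN⟩
    exact hT ⟨((isOneSided_iff T h).mpr hh).1, hN⟩

theorem tsum_weightedSeries {y : ℝ} (hy : 0 ≤ y) {c : ℕ → PowerSeries ℝ}
    (hc : ∀ n, CoeffNonneg (c n)) (N : ℕ) :
    ∑' n, ENNReal.ofReal (PowerSeries.coeff N (weightedSeries y n * c n)) =
      ENNReal.ofReal (weightedSum y c N) := by
  rw [weightedSum, ENNReal.ofReal_sum_of_nonneg fun n _ =>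
    (coeffNonneg_weightedSeries hy n).mul (hc n) N]
  refine tsum_eq_sum fun n hn => ?_
  rw [coeff_weightedSeries_mul_eq_zero _ _ (by simpa using hn), ENNReal.ofReal_zero]

-- Sum over the height h = r + 1 + n. Heights h ≤ r do not occur, as the leftmost path of T₀ reaches
-- level r + 1. Since V_n already carries y^{n+1}, a factor y^r is left over.
open Classical in
theorem tsum_weight_ball (μ : ℝ) (r : ℕ) {T₀ : PlanarTree} (h₀ : T₀.HasSpine (r + 1)) {N : ℕ}
    (hN : T₀.ballSize r ≤ N) :
    ∑' T : oneSided N, (if T₀.ball (r + 1) = T.1.ball (r + 1) then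
        ENNReal.ofReal (weight μ T) else 0) =
      ENNReal.ofReal (Real.exp (-μ) ^ r * weightedSum (Real.exp (-μ))
        (fun n => heightSeries (n + 1) ^ (T₀.levelCard (r + 1) - 1)) (N - T₀.ballSize r)) := by
  have hy := (Real.exp_pos (-μ)).le
  refine Eq.trans (tsum_congr fun T => if_congr Iff.rfl rfl rfl)
    ((tsum_weight μ (fun T => T₀.ball (r + 1) = T.ball (r + 1)) N).trans ?_)
  have hzero : ∀ h ∈ Finset.range (r + 1), ENNReal.ofReal (Real.exp (-μ) ^ h) * countBy size
      (fun T => T₀.ball (r + 1) = T.ball (r + 1) ∧ T.HeightLE h ∧ T.HasSpine h) N = 0 := by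
    intro h hh
    rw [Finset.mem_range] at hh
    have : ∀ T : PlanarTree, ¬ (T₀.ball (r + 1) = T.ball (r + 1) ∧ T.HeightLE h ∧ T.HasSpine h) := by
      rintro T ⟨hb, hle, -⟩
      have h1 := ((ball_eq_iff T₀ T (r + 1)).mp hb (List.replicate (r + 1) 0) (by simp)).mp h₀
      have := hle _ h1
      rw [List.length_replicate] at this
      omega
    simp [countBy, this]
  have hser := tsum_weightedSeries hy (fun n => (coeffNonneg_heightSeries (n + 1)).pow
    (T₀.levelCard (r + 1) - 1)) (N - T₀.ballSize r)
  rw [ENNReal.ofReal_mul (pow_nonneg hy r), ← hser, ← ENNReal.tsum_mul_left]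
  rw [← Summable.sum_add_tsum_nat_add' (k := r + 1) ENNReal.summable]
  rw [Finset.sum_eq_zero hzero, zero_add]
  refine tsum_congr fun n => ?_
  rw [add_comm n (r + 1), (represents_oneSided_ball n r T₀ h₀).2, ← ENNReal.ofReal_mul (by positivity),
    ← ENNReal.ofReal_mul (by positivity), PowerSeries.coeff_X_pow_mul', if_pos hN, weightedSeries,
    mul_assoc, PowerSeries.coeff_C_mul, ← mul_assoc, ← pow_add, show r + 1 + n = r + (n + 1) by omega]

/-- This is `tsum_weight_ball` with r = 0, where the condition is void because all balls of radius 1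
agree. -/
theorem tsum_weight_eq (μ : ℝ) (N : ℕ) :
    ∑' T : oneSided N, ENNReal.ofReal (weight μ T) =
      ENNReal.ofReal (weightedCount (Real.exp (-μ)) N) := by
  classical
  have h := tsum_weight_ball μ 0 (hasSpine_one (node [])) (N := N) (by rw [ballSize_zero]; omega)
  refine Eq.trans (tsum_congr fun T => (if_pos (ball_one_eq _ _)).symm) (h.trans ?_)
  simp [weightedCount, levelCard_one, ballSize_zero]

theorem partitionFunction_eq (μ : ℝ) (N : ℕ) :
    partitionFunction μ N = weightedCount (Real.exp (-μ)) N := by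
  have h := congrArg ENNReal.toReal (tsum_weight_eq μ N)
  rw [ENNReal.toReal_ofReal (weightedCount_nonneg (Real.exp_pos _).le N),
    ENNReal.tsum_toReal_eq fun _ => ENNReal.ofReal_ne_top] at h
  rw [← h, partitionFunction]
  exact tsum_congr fun T => (ENNReal.toReal_ofReal (weight_pos μ T).le).symm

theorem ball_eq_of_dist_lt {T T' : PlanarTree} {R : ℕ} (h : dist T T' < 1 / (R : ℝ)) :
    T.ball R = T'.ball R := by
  obtain ⟨x, ⟨r, hr, hb, rfl⟩, hx⟩ := exists_lt_of_csInf_lt ⟨1, one_mem_distSet T T'⟩ h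
  have hr0 : (0 : ℝ) < r := by exact_mod_cast hr
  rcases Nat.eq_zero_or_pos R with rfl | hR
  · have : (0 : ℝ) < 1 / r := by positivity
    simp only [Nat.cast_zero, div_zero] at hx
    linarith
  · have h1 := (one_div_lt_one_div hr0 (by exact_mod_cast hR)).mp hx
    exact ball_eq_of_le (by exact_mod_cast h1.le) hb

theorem dist_le_of_ball_eq {T T' : PlanarTree} {R : ℕ} (hR : 1 ≤ R) (h : T.ball R = T'.ball R) :
    dist T T' ≤ 1 / (R : ℝ) :=
  csInf_le (bddBelow_distSet T T') ⟨R, hR, h, rfl⟩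

/-- The trees with the same ball of radius `R` as `T₀`. -/
def cylinder (T₀ : PlanarTree) (R : ℕ) : Set PlanarTree := {T | T₀.ball R = T.ball R}

theorem isOpen_cylinder (T₀ : PlanarTree) {R : ℕ} (hR : 1 ≤ R) : IsOpen (cylinder T₀ R) := by
  rw [Metric.isOpen_iff]
  intro T hT
  have hR0 : (0 : ℝ) < R := by exact_mod_cast hR
  refine ⟨1 / R, by positivity, fun T' hT' => ?_⟩
  have h1 : T'.ball R = T.ball R := ball_eq_of_dist_lt hT'
  exact Eq.trans hT h1.symm

theorem finiteSizeMeasure_apply (μ : ℝ) {N : ℕ} (hN : 0 < weightedCount (Real.exp (-μ)) N)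
    {B : Set PlanarTree} (hB : MeasurableSet B) [DecidablePred (· ∈ B)] :
    finiteSizeMeasure μ N B =
      (∑' T : oneSided N, (if (T : PlanarTree) ∈ B then ENNReal.ofReal (weight μ T) else 0)) /
        ENNReal.ofReal (weightedCount (Real.exp (-μ)) N) := by
  rw [finiteSizeMeasure, Measure.sum_apply _ hB, div_eq_mul_inv, ← ENNReal.tsum_mul_right]
  refine tsum_congr fun T => ?_
  rw [Measure.smul_apply, Measure.dirac_apply' _ hB, partitionFunction_eq,
    ENNReal.ofReal_div_of_pos hN, smul_eq_mul, div_eq_mul_inv]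
  by_cases h : (T : PlanarTree) ∈ B
  · rw [Set.indicator_of_mem h, if_pos h, Pi.one_apply, mul_one]
  · rw [Set.indicator_of_notMem h, if_neg h, mul_zero, zero_mul]

theorem weightedCount_pos {y : ℝ} (hy : 2 ≤ y) {N : ℕ} (hN : 1 ≤ N) : 0 < weightedCount y N :=
  pos_of_mul_pos_left (normCount_pos hy hN) (pow_nonneg (critical_pos hy).le _)

theorem isProbabilityMeasure_finiteSizeMeasure {μ : ℝ} (hμ : 2 ≤ Real.exp (-μ)) {N : ℕ}
    (hN : 1 ≤ N) : IsProbabilityMeasure (finiteSizeMeasure μ N) := by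
  classical
  have h := weightedCount_pos hμ hN
  refine ⟨?_⟩
  rw [finiteSizeMeasure_apply μ h MeasurableSet.univ]
  simp only [Set.mem_univ, if_true]
  rw [tsum_weight_eq, ENNReal.div_self (by simpa using h) ENNReal.ofReal_ne_top]

theorem tendsto_finiteSizeMeasure_cylinder {μ : ℝ} (hμ : 2 ≤ Real.exp (-μ)) (r : ℕ)
    {T₀ : PlanarTree} (h₀ : T₀.HasSpine (r + 1)) :
    Tendsto (fun N => finiteSizeMeasure μ N (cylinder T₀ (r + 1))) atTop
      (𝓝 (ENNReal.ofReal (critical (Real.exp (-μ)) ^ T₀.ballSize r * Real.exp (-μ) ^ r *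
        (Real.exp (-μ))⁻¹ ^ (T₀.levelCard (r + 1) - 1)))) := by
  classical
  have h := (tendsto_weightedSum_div hμ (T₀.levelCard (r + 1) - 1)
    (T₀.ballSize r)).const_mul (Real.exp (-μ) ^ r)
  rw [mul_left_comm, ← mul_assoc] at h
  refine (ENNReal.tendsto_ofReal h).congr' ?_
  filter_upwards [eventually_ge_atTop (T₀.ballSize r + 1)] with N hN
  have hpos := weightedCount_pos hμ (show 1 ≤ N by omega)
  rw [finiteSizeMeasure_apply μ hpos (isOpen_cylinder T₀ (by omega)).measurableSet,
    ← mul_div_assoc, ENNReal.ofReal_div_of_pos hpos, ← tsum_weight_ball μ r h₀ (by omega)]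
  rfl

/-- Ratio test: W_N/W_{N+1} = g_c b_N/b_{N+1} tends to g_c. -/
theorem criticalPoint_eq {μ : ℝ} (hμ : 2 ≤ Real.exp (-μ)) :
    criticalPoint μ = critical (Real.exp (-μ)) := by
  have hg := critical_pos hμ
  have h := (tendsto_normCount_succ_div hμ).const_mul (critical (Real.exp (-μ)))
  rw [mul_one] at h
  have h2 : Tendsto (fun n => ‖partitionFunction μ n‖ / ‖partitionFunction μ n.succ‖) atTop
      (𝓝 ((⟨critical (Real.exp (-μ)), hg.le⟩ : NNReal) : ℝ)) := by
    refine h.congr fun N => ?_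
    rw [partitionFunction_eq, partitionFunction_eq,
      Real.norm_of_nonneg (weightedCount_nonneg (Real.exp_pos _).le _),
      Real.norm_of_nonneg (weightedCount_nonneg (Real.exp_pos _).le _), normCount, normCount,
      pow_succ]
    have := (weightedCount_pos hμ (show 1 ≤ N + 1 by omega)).ne'
    field_simp
  have h3 : (⟨critical (Real.exp (-μ)), hg.le⟩ : NNReal) ≠ 0 := fun h0 =>
    hg.ne' (Subtype.ext_iff.mp h0)
  rw [criticalPoint, FormalMultilinearSeries.ofScalars_radius_eq_of_tendsto ℝ _ h3 h2]
  rfl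

theorem countBy_size (N : ℕ) :
    countBy size (fun _ => True) N = ENNReal.ofReal (PowerSeries.coeff N treeSeries) := by
  classical
  rw [← coeff_heightSeries_eq le_rfl, ← (represents_heightLE N).2, countBy, countBy]
  refine tsum_congr fun T => ?_
  have : T.size = N → T.HeightLE N := fun h => by
    rw [← height_le_iff, ← h]
    exact T.height_le_size
  by_cases h : T.size = N
  · simp [h, this h]
  · simp [h]

theorem generatingFunction_eq {y : ℝ} (hy : 2 ≤ y) : generatingFunction (critical y) = y⁻¹ := by
  classical
  have hg := (critical_pos hy).le
  have h1 : ∑' T : {T : PlanarTree // T.verts.Finite},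
      ENNReal.ofReal (critical y ^ T.1.size.toNat) = ENNReal.ofReal y⁻¹ := by
    have hs := sumsTo_treeSeries_critical hy
    rw [← hs.tsum_eq, ENNReal.ofReal_tsum_of_nonneg
      (fun n => mul_nonneg (coeffNonneg_treeSeries n) (pow_nonneg hg n)) hs.summable]
    simp only [ENNReal.ofReal_mul (coeffNonneg_treeSeries _), ← countBy_size, countBy,
      ← ENNReal.tsum_mul_right]
    rw [ENNReal.tsum_comm]
    refine (tsum_subtype {T : PlanarTree | T.verts.Finite}
      fun T => ENNReal.ofReal (critical y ^ T.size.toNat)).trans (tsum_congr fun T => ?_)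
    by_cases hT : T.verts.Finite
    · obtain ⟨n, hn⟩ := ENat.ne_top_iff_exists.mp ((finite_verts_iff T).mp hT)
      rw [Set.indicator_of_mem (show T ∈ {T : PlanarTree | T.verts.Finite} from hT), ← hn,
        tsum_eq_single n]
      · simp
      · intro m hm
        have : ¬ ((n : ℕ∞) = m) := fun h => hm (by exact_mod_cast h.symm)
        simp [this]
    · rw [Set.indicator_of_notMem (show T ∉ {T : PlanarTree | T.verts.Finite} from hT)]
      symm
      rw [ENNReal.tsum_eq_zero]
      intro n
      rw [if_neg, zero_mul]
      rintro ⟨-, h⟩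
      exact hT ((finite_verts_iff T).mpr (by rw [h]; exact ENat.natCast_ne_top n))
  have h2 := congrArg ENNReal.toReal h1
  rw [ENNReal.toReal_ofReal (by positivity),
    ENNReal.tsum_toReal_eq fun _ => ENNReal.ofReal_ne_top] at h2
  rw [← h2, generatingFunction]
  exact tsum_congr fun T => (ENNReal.toReal_ofReal (pow_nonneg hg _)).symm

theorem offspringMean_eq {μ : ℝ} (hμ : 2 ≤ Real.exp (-μ)) :
    offspringMean μ = (Real.exp (-μ))⁻¹ / (1 - (Real.exp (-μ))⁻¹) := by
  have h := inv_le_half hμ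
  have h0 : 0 < (Real.exp (-μ))⁻¹ := by positivity
  have h1 : ‖(Real.exp (-μ))⁻¹‖ < 1 := by rw [Real.norm_of_nonneg h0.le]; linarith
  have h2 := tsum_coe_mul_geometric_of_norm_lt_one h1
  simp only [offspringMean, offspringProb, criticalPoint_eq hμ, generatingFunction_eq hμ,
    ← mul_assoc]
  rw [tsum_mul_right, h2]
  have : 1 - (Real.exp (-μ))⁻¹ ≠ 0 := by linarith
  field_simp

/-- Weak convergence follows from the convergence of the probabilities of balls. -/
theorem tendsto_of_cylinder {μs : ℕ → ProbabilityMeasure PlanarTree}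
    {μ : ProbabilityMeasure PlanarTree}
    (h : ∀ (r : ℕ) (T₀ : PlanarTree), (μ : Measure PlanarTree) (cylinder T₀ (r + 1)) = 0 ∨
      Tendsto (fun N => (μs N : Measure PlanarTree) (cylinder T₀ (r + 1))) atTop
        (𝓝 ((μ : Measure PlanarTree) (cylinder T₀ (r + 1))))) :
    Tendsto μs atTop (𝓝 μ) := by
  classical
  -- Portmanteau: a liminf bound on open sets suffices, the limit being a probability measure.
  refine tendsto_of_forall_isOpen_le_liminf_nat' fun G hG => ?_
  refine le_of_forall_lt fun a ha => ?_
  have hGU : G = ⋃ R : ℕ, {T | cylinder T (R + 1) ⊆ G} := by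
    ext T
    simp only [Set.mem_iUnion]
    constructor
    · intro hT
      obtain ⟨ε, hε, hball⟩ := Metric.isOpen_iff.mp hG T hT
      obtain ⟨n, hn⟩ := exists_nat_one_div_lt hε
      refine ⟨n, fun T' hT' => hball ?_⟩
      have h1 := dist_le_of_ball_eq (R := n + 1) (by omega) (Eq.symm hT' : T'.ball _ = T.ball _)
      push_cast at h1
      exact h1.trans_lt hn
    · rintro ⟨R, hR⟩
      exact hR rfl
  have hmono : Monotone fun R : ℕ => {T | cylinder T (R + 1) ⊆ G} := by
    intro R S hRS T hT T' hT'
    exact hT (ball_eq_of_le (by omega) hT')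
  rw [hGU, hmono.measure_iUnion, lt_iSup_iff] at ha
  obtain ⟨R, hR⟩ := ha
  -- Indexing by the possible balls, which are finite sets of words, makes the family countable and
  -- disjoint; an index that is not a ball gives the empty set.
  obtain ⟨C, hC⟩ : ∃ C : Finset (List ℕ) → Set PlanarTree, C =
      fun s : Finset (List ℕ) =>
      {T | T.ball (R + 1) = (s : Set (List ℕ)) ∧ cylinder T (R + 1) ⊆ G} := ⟨_, rfl⟩
  have hCcyl : ∀ s, C s = ∅ ∨ ∃ T₀, C s = cylinder T₀ (R + 1) ∧ cylinder T₀ (R + 1) ⊆ G := by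
    intro s
    rcases (C s).eq_empty_or_nonempty with h0 | ⟨T₀, hT₀⟩
    · exact Or.inl h0
    · right
      rw [hC] at hT₀ ⊢
      refine ⟨T₀, ?_, hT₀.2⟩
      ext T
      constructor
      · exact fun hT => hT₀.1.trans hT.1.symm
      · intro hT
        refine ⟨Eq.trans (Eq.symm hT) hT₀.1, fun T' hT' => hT₀.2 (Eq.trans hT hT')⟩
  have hCm : ∀ s, MeasurableSet (C s) := by
    intro s
    rcases hCcyl s with h0 | ⟨T₀, h0, -⟩ <;> rw [h0]
    · exact MeasurableSet.empty
    · exact (isOpen_cylinder T₀ (by omega)).measurableSet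
  have hCd : Pairwise (Function.onFun Disjoint C) := by
    intro s t hst
    rw [Function.onFun, Set.disjoint_left, hC]
    rintro T ⟨h1, -⟩ ⟨h2, -⟩
    exact hst (Finset.coe_injective (h1.symm.trans h2))
  have hUC : {T | cylinder T (R + 1) ⊆ G} = ⋃ s, C s := by
    ext T
    simp only [Set.mem_iUnion, hC]
    constructor
    · intro hT
      exact ⟨(T.ball_finite (R + 1)).toFinset, by simp, hT⟩
    · rintro ⟨s, -, hT⟩
      exact hT
  rw [hUC, measure_iUnion hCd hCm, ENNReal.tsum_eq_iSup_sum, lt_iSup_iff] at hR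
  obtain ⟨F, hF⟩ := hR
  -- Cylinders of limit mass zero are dropped, since convergence is not assumed for them.
  set F' := F.filter fun s => (μ : Measure PlanarTree) (C s) ≠ 0 with hF'
  have hsum : ∑ s ∈ F, (μ : Measure PlanarTree) (C s) = ∑ s ∈ F', (μ : Measure PlanarTree) (C s) :=
    (Finset.sum_filter_ne_zero F).symm
  rw [hsum] at hF
  have hlim : Tendsto (fun N => ∑ s ∈ F', (μs N : Measure PlanarTree) (C s)) atTop
      (𝓝 (∑ s ∈ F', (μ : Measure PlanarTree) (C s))) := by
    refine tendsto_finsetSum _ fun s hs => ?_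
    have hne := (Finset.mem_filter.mp hs).2
    rcases hCcyl s with h0 | ⟨T₀, h0, -⟩
    · rw [h0, measure_empty] at hne
      exact absurd rfl hne
    · rw [h0] at hne ⊢
      exact (h R T₀).resolve_left hne
  rw [← hlim.liminf_eq] at hF
  refine hF.trans_le (liminf_le_liminf (Eventually.of_forall fun N => ?_))
  rw [← measure_biUnion_finset (fun s _ t _ hst => hCd hst) fun s _ => hCm s]
  refine measure_mono (Set.iUnion₂_subset fun s _ => ?_)
  rcases hCcyl s with h0 | ⟨T₀, h0, h1⟩ <;> rw [h0]
  · exact Set.empty_subset _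
  · exact h1

end PlanarTree

end

/-! ### The infinite tree built from offspring numbers -/

noncomputable section

namespace PlanarTree

open ProbabilityTheory

theorem forall_getD_append_lt (c : List ℕ → ℕ) (w : List ℕ) (n : ℕ) :
    (∀ i < (w ++ [n]).length, (w ++ [n]).getD i 0 < c ((w ++ [n]).take i)) ↔
      (∀ i < w.length, w.getD i 0 < c (w.take i)) ∧ n < c w := by
  rw [List.length_append, List.length_singleton, Nat.forall_lt_succ_right]
  refine and_congr (forall₂_congr fun i hi => ?_) ?_
  · rw [List.getD_append _ _ _ _ hi, List.take_append_of_le_length hi.le]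
  · rw [List.getD_append_right _ _ _ _ le_rfl, List.take_append_of_le_length le_rfl]
    simp

/-- The tree in which the vertex `w` has `c w` offspring. -/
def ofOffspring (c : List ℕ → ℕ) (hc : c [] = 1) : PlanarTree where
  verts := {w | ∀ i < w.length, w.getD i 0 < c (w.take i)}
  root_mem := by simp
  parent_mem w n h := ((forall_getD_append_lt c w n).mp h).1
  left_mem w n h :=
    have h' := (forall_getD_append_lt c w (n + 1)).mp h
    (forall_getD_append_lt c w n).mpr ⟨h'.1, (Nat.lt_succ_self n).trans h'.2⟩
  finite_offspring w :=
    (Set.finite_Iio (c w)).subset fun n h => ((forall_getD_append_lt c w n).mp h).2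
  root_degree_one n := (forall_getD_append_lt c [] n).trans (by simp [hc])

theorem append_mem_ofOffspring {c : List ℕ → ℕ} (hc : c [] = 1) (w : List ℕ) (n : ℕ) :
    w ++ [n] ∈ (ofOffspring c hc).verts ↔ w ∈ (ofOffspring c hc).verts ∧ n < c w :=
  forall_getD_append_lt c w n

/-- Offspring numbers up to distance r decide which words of length at most r + 1 occur. Prescribing
a ball thus becomes a condition on finitely many coordinates, one at a time. -/
theorem ball_eq_ofOffspring_iff (T : PlanarTree) {c : List ℕ → ℕ} (hc : c [] = 1) (r : ℕ) :
    T.ball (r + 1) = (ofOffspring c hc).ball (r + 1) ↔ ∀ w ∈ T.ball r, T.offspring w = c w := by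
  rw [ball_eq_iff]
  constructor
  · rintro h w ⟨hw, hl⟩
    have hw' := (h w (by omega)).mp hw
    refine eq_of_forall_lt_iff fun n => ?_
    rw [← T.append_mem_iff, h _ (by simpa using hl), append_mem_ofOffspring]
    exact and_iff_right hw'
  · intro h w
    induction w using List.reverseRecOn with
    | nil => exact fun _ => iff_of_true T.root_mem (ofOffspring c hc).root_mem
    | append_singleton w n ih =>
      intro hl
      rw [List.length_append, List.length_singleton] at hl
      rw [append_mem_ofOffspring, ← ih (by omega)]
      constructor
      · intro hn
        have hw := T.parent_mem w n hn
        exact ⟨hw, by rwa [← h w ⟨hw, by omega⟩, ← T.append_mem_iff]⟩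
      · rintro ⟨hw, hn⟩
        rwa [T.append_mem_iff, h w ⟨hw, by omega⟩]

/-- The number of offspring of the vertex `w` in terms of an independent number `k`: the root has
one offspring, and the vertices of the leftmost path have an additional one. -/
def spineOffspring (w : List ℕ) (k : ℕ) : ℕ :=
  if w = [] then 1 else if w = List.replicate w.length 0 then k + 1 else k

theorem spineOffspring_replicate_pos (n k : ℕ) : 0 < spineOffspring (List.replicate n 0) k := by
  rw [spineOffspring, List.length_replicate]
  split_ifs
  · exact one_pos
  · exact k.succ_pos
  · tauto

/-- The tree with an infinite leftmost path whose vertices have the given numbers of offspring, up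
to the modification of the leftmost path. -/
def spineTree (ω : List ℕ → ℕ) : PlanarTree :=
  ofOffspring (fun w => spineOffspring w (ω w)) (if_pos rfl)

theorem mem_spineTree (ω : List ℕ → ℕ) (w : List ℕ) :
    w ∈ (spineTree ω).verts ↔
      ∀ i < w.length, w.getD i 0 < spineOffspring (w.take i) (ω (w.take i)) := Iff.rfl

theorem ball_eq_spineTree_iff (T : PlanarTree) (ω : List ℕ → ℕ) (r : ℕ) :
    T.ball (r + 1) = (spineTree ω).ball (r + 1) ↔
      ∀ w ∈ T.ball r, T.offspring w = spineOffspring w (ω w) :=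
  ball_eq_ofOffspring_iff T _ r

theorem hasSpine_spineTree (ω : List ℕ → ℕ) (n : ℕ) : (spineTree ω).HasSpine n := by
  induction n with
  | zero => exact (spineTree ω).root_mem
  | succ n ih =>
    rw [HasSpine, List.replicate_succ']
    exact (append_mem_ofOffspring _ _ _).mpr ⟨ih, spineOffspring_replicate_pos n _⟩

/-- Each ball of the image depends on finitely many discrete coordinates. Continuity is used to
obtain measurability. -/
theorem continuous_spineTree : Continuous spineTree := by
  rw [continuous_iff_continuousAt]
  intro ω
  rw [ContinuousAt, Metric.tendsto_nhds]
  intro ε hε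
  obtain ⟨n, hn⟩ := exists_nat_one_div_lt hε
  have h : ∀ᶠ ω' in 𝓝 ω, ∀ w ∈ (spineTree ω).ball n, ω' w = ω w := by
    rw [eventually_all_finite ((spineTree ω).ball_finite n)]
    intro w _
    exact ((continuous_apply w).tendsto ω).eventually
      (show ∀ᶠ n in 𝓝 (ω w), n = ω w by rw [nhds_discrete]; exact rfl)
  filter_upwards [h] with ω' h'
  have hb : (spineTree ω).ball (n + 1) = (spineTree ω').ball (n + 1) := by
    rw [ball_eq_spineTree_iff]
    intro w hw
    rw [h' w hw]
    exact (ball_eq_spineTree_iff _ ω n).mp rfl w hw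
  refine (dist_le_of_ball_eq (by omega) hb.symm).trans_lt ?_
  push_cast
  exact hn

/-- A function of a tree that only depends on a ball is continuous. -/
theorem continuous_of_ball {α : Type*} [TopologicalSpace α] {f : PlanarTree → α} (R : ℕ)
    (h : ∀ T T' : PlanarTree, T.ball R = T'.ball R → f T = f T') : Continuous f := by
  refine IsLocallyConstant.continuous ((IsLocallyConstant.iff_eventually_eq f).mpr fun T => ?_)
  -- The radius 1/(R + 1) instead of 1/R includes R = 0.
  have hR : (0 : ℝ) < 1 / ((R + 1 : ℕ) : ℝ) := by positivity
  filter_upwards [Metric.ball_mem_nhds T hR] with T' hT'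
  exact h _ _ (ball_eq_of_le (Nat.le_succ R) (ball_eq_of_dist_lt hT'))

theorem continuous_levelCard (r : ℕ) : Continuous fun T : PlanarTree => (T.levelCard r : ℝ) := by
  refine continuous_of_ball r fun T T' h => ?_
  have e : T.level r = T'.level r := by
    ext w
    have := (ball_eq_iff T T' r).mp h w
    simp only [level, Set.mem_ofPred_eq]
    exact and_congr_left fun hl => this hl.le
  rw [levelCard, levelCard, e]

theorem ballSize_succ (T : PlanarTree) (r : ℕ) :
    T.ballSize (r + 1) = T.ballSize r + T.levelCard (r + 1) := by
  have e : T.ball (r + 1) ∩ T.edges = (T.ball r ∩ T.edges) ∪ T.level (r + 1) := by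
    ext w
    simp only [ball, edges, level, Set.mem_inter_iff, Set.mem_union, Set.mem_ofPred_eq]
    constructor
    · rintro ⟨⟨h1, h2⟩, -, h3⟩
      rcases Nat.le_succ_iff.mp h2 with h | h
      · exact Or.inl ⟨⟨h1, h⟩, h1, h3⟩
      · exact Or.inr ⟨h1, h⟩
    · rintro (⟨⟨h1, h2⟩, -, h3⟩ | ⟨h1, h2⟩)
      · exact ⟨⟨h1, by omega⟩, h1, h3⟩
      · exact ⟨⟨h1, h2.le⟩, h1, by rintro rfl; simp at h2⟩
  rw [ballSize, e, Set.ncard_union_eq _ ((T.ball_finite r).inter_of_left _) (T.level_finite _)]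
  · rfl
  · rw [Set.disjoint_left]
    rintro w ⟨⟨-, h1⟩, -⟩ ⟨-, h2⟩
    omega

theorem ballSize_eq_sum (T : PlanarTree) (r : ℕ) :
    T.ballSize r = ∑ j ∈ Finset.range r, T.levelCard (j + 1) := by
  induction r with
  | zero => rw [ballSize_zero, Finset.range_zero, Finset.sum_empty]
  | succ r ih => rw [ballSize_succ, ih, Finset.sum_range_succ]

theorem levelCard_zero (T : PlanarTree) : T.levelCard 0 = 1 := by
  have e : T.level 0 = {[]} := by
    ext w
    simp only [level, Set.mem_ofPred_eq, List.length_eq_zero_iff, Set.mem_singleton_iff]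
    exact ⟨fun h => h.2, fun h => ⟨h ▸ T.root_mem, h⟩⟩
  rw [levelCard, e, Set.ncard_singleton]

/-- Level r + 1 is partitioned by the parent, which is `List.dropLast`. -/
theorem levelCard_succ (T : PlanarTree) (r : ℕ) :
    T.levelCard (r + 1) = ∑ w ∈ (T.level_finite r).toFinset, T.offspring w := by
  classical
  rw [levelCard, Set.ncard_eq_toFinset_card _ (T.level_finite (r + 1)),
    Finset.card_eq_sum_card_fiberwise (f := List.dropLast) (t := (T.level_finite r).toFinset)]
  · refine Finset.sum_congr rfl fun w hw => ?_
    obtain ⟨-, hl⟩ := (Set.Finite.mem_toFinset _).mp hw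
    rw [offspring, ← Set.ncard_image_of_injective _ (List.append_right_injective w |>.comp
      List.singleton_injective), ← Set.ncard_coe_finset]
    congr 1
    ext u
    simp only [Finset.coe_filter, Set.Finite.mem_toFinset, Set.mem_ofPred_eq, level, Set.mem_image,
      Function.comp_apply]
    constructor
    · rintro ⟨⟨hu, hul⟩, rfl⟩
      rcases List.eq_nil_or_concat u with rfl | ⟨w, n, rfl⟩
      · simp at hul
      · refine ⟨n, ?_, ?_⟩ <;> simp_all
    · rintro ⟨n, hn, rfl⟩
      exact ⟨⟨hn, by simpa using hl⟩, by simp⟩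
  · intro u hu
    simp only [Set.Finite.coe_toFinset, level, Set.mem_ofPred_eq] at hu ⊢
    refine ⟨T.mem_of_append_mem _ (u.drop (u.length - 1)) ?_, by simp [hu.2]⟩
    rw [List.dropLast_eq_take, List.take_append_drop]
    exact hu.1

end PlanarTree

end

/-! ### The law of the infinite tree: balls and moments -/

noncomputable section

namespace PlanarTree

open ProbabilityTheory

variable {p : unitInterval}

/-- The law of the tree with an infinite leftmost path carrying independent geometric trees. -/
def spineLaw (p : unitInterval) : Measure PlanarTree :=
  (Measure.infinitePi fun _ : List ℕ => geometricMeasure p).map spineTree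

theorem measurable_spineTree : Measurable spineTree := continuous_spineTree.measurable

instance : IsProbabilityMeasure (spineLaw p) :=
  Measure.isProbabilityMeasure_map measurable_spineTree.aemeasurable

theorem spineLaw_cylinder_of_not_hasSpine (p : unitInterval) {T : PlanarTree} {r : ℕ}
    (h : ¬ T.HasSpine (r + 1)) : spineLaw p (cylinder T (r + 1)) = 0 := by
  rw [spineLaw, Measure.map_apply measurable_spineTree
    (isOpen_cylinder T (by omega)).measurableSet]
  convert measure_empty (μ := Measure.infinitePi fun _ : List ℕ => geometricMeasure p)
  rw [Set.eq_empty_iff_forall_notMem]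
  intro ω hω
  exact h (((ball_eq_iff _ _ _).mp hω _ (by simp)).mpr (hasSpine_spineTree ω (r + 1)))

/-- On the leftmost path n offspring mean k = n - 1, so n must be positive there for the subtraction
to be genuine. -/
theorem geometricMeasure_spineOffspring (hp : p ≠ 0) {w : List ℕ} (hw : w ≠ []) {n : ℕ}
    (hn : w = List.replicate w.length 0 → 0 < n) :
    geometricMeasure p {k | n = spineOffspring w k} = ENNReal.ofReal
      ((1 - p) ^ (n - if w = List.replicate w.length 0 then 1 else 0) * p) := by
  rw [← geometricMeasure_singleton hp]
  congr 1
  ext k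
  simp only [spineOffspring, if_neg hw, Set.mem_ofPred_eq, Set.mem_singleton_iff]
  split_ifs with h
  · have := hn h
    omega
  · omega

/-- There is one factor p per vertex, and the exponents of 1 - p add up to the size of the next
level without its vertex on the leftmost path. -/
theorem prod_level (T : PlanarTree) (hp : p ≠ 0) {r : ℕ} (h : T.HasSpine (r + 2)) :
    ∏ w ∈ (T.level_finite (r + 1)).toFinset,
        geometricMeasure p {k | T.offspring w = spineOffspring w k} =
      ENNReal.ofReal ((p : ℝ) ^ T.levelCard (r + 1) * (1 - p) ^ (T.levelCard (r + 2) - 1)) := by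
  have hmem : ∀ w ∈ (T.level_finite (r + 1)).toFinset, w.length = r + 1 := fun w hw =>
    ((Set.Finite.mem_toFinset _).mp hw).2
  have hspine : ∀ w ∈ (T.level_finite (r + 1)).toFinset, w = List.replicate w.length 0 →
      0 < T.offspring w := by
    intro w hw h0
    rw [← T.append_mem_iff, h0, hmem w hw, ← List.replicate_succ']
    exact h
  have h0 : List.replicate (r + 1) 0 ∈ (T.level_finite (r + 1)).toFinset :=
    (Set.Finite.mem_toFinset _).mpr ⟨h.mono (by omega), List.length_replicate⟩
  have hcard : (T.level_finite (r + 1)).toFinset.card = T.levelCard (r + 1) :=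
    (Set.ncard_eq_toFinset_card _ _).symm
  have hsum : ∑ w ∈ (T.level_finite (r + 1)).toFinset,
      (T.offspring w - if w = List.replicate w.length 0 then 1 else 0) =
        T.levelCard (r + 2) - 1 := by
    have hone : ∑ w ∈ (T.level_finite (r + 1)).toFinset,
        (if w = List.replicate w.length 0 then 1 else 0) = 1 := by
      rw [Finset.sum_eq_single_of_mem _ h0]
      · simp
      · intro w hw hne
        rw [if_neg]
        rwa [hmem w hw]
    rw [T.levelCard_succ (r + 1)]
    refine (Finset.sum_tsub_distrib _ fun w hw => ?_).trans (congrArg _ hone)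
    split_ifs with h1
    · exact hspine w hw h1
    · exact Nat.zero_le _
  rw [Finset.prod_congr rfl fun w hw => geometricMeasure_spineOffspring hp
      (by rintro rfl; simpa using hmem _ hw) (hspine w hw),
    ← ENNReal.ofReal_prod_of_nonneg fun w _ => geometricMeasure_nonneg p _, Finset.prod_mul_distrib,
    Finset.prod_pow_eq_pow_sum, hsum, Finset.prod_const, hcard, mul_comm]

theorem ball_zero (T : PlanarTree) : T.ball 0 = {[]} := by
  ext w
  simp only [ball, Set.mem_ofPred_eq, Nat.le_zero, List.length_eq_zero_iff, Set.mem_singleton_iff]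
  exact ⟨fun h => h.2, fun h => ⟨h ▸ T.root_mem, h⟩⟩

/-- The exponents of `prod_level` telescope over the levels. The form is that of
`tendsto_finiteSizeMeasure_cylinder`: for p = 1 - 1/y one has (1 - p)p = g_c and (1 - p)⁻¹ = y. -/
theorem prod_ball (T : PlanarTree) (hp : p ≠ 0) (hp1 : p ≠ 1) {r : ℕ} (h : T.HasSpine (r + 1)) :
    ∏ w ∈ (T.ball_finite r).toFinset,
        geometricMeasure p {k | T.offspring w = spineOffspring w k} =
      ENNReal.ofReal (((1 - p) * p : ℝ) ^ T.ballSize r * ((1 - p : ℝ)⁻¹) ^ r *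
        (1 - p : ℝ) ^ (T.levelCard (r + 1) - 1)) := by
  have hq : (0 : ℝ) ≤ 1 - p := by have := p.2.2; linarith
  have hq0 : (1 - p : ℝ) ≠ 0 := fun h0 => hp1 (Subtype.ext (show (p : ℝ) = 1 by linarith))
  induction r with
  | zero =>
    have e : (T.ball_finite 0).toFinset = {[]} := by
      ext w
      rw [Set.Finite.mem_toFinset, ball_zero]
      simp
    have ho : T.offspring [] = 1 := by
      refine eq_of_forall_lt_iff fun n => ?_
      rw [← T.append_mem_iff, List.nil_append, T.root_degree_one]
      omega
    rw [e, Finset.prod_singleton, ballSize_zero, levelCard_one, ho]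
    simp [spineOffspring]
  | succ r ih =>
    have e : (T.ball_finite (r + 1)).toFinset =
        (T.ball_finite r).toFinset ∪ (T.level_finite (r + 1)).toFinset := by
      ext w
      simp only [Set.Finite.mem_toFinset, Finset.mem_union, ball, level, Set.mem_ofPred_eq,
        ← and_or_left, Nat.le_succ_iff]
    have hd : Disjoint (T.ball_finite r).toFinset (T.level_finite (r + 1)).toFinset := by
      rw [Finset.disjoint_left]
      intro w h1 h2
      have h3 := ((Set.Finite.mem_toFinset _).mp h1).2
      have h4 := ((Set.Finite.mem_toFinset _).mp h2).2
      omega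
    have hpos := levelCard_pos_of_hasSpine (h.mono (show r + 1 ≤ r + 1 + 1 by omega))
    obtain ⟨k, hk⟩ : ∃ k, T.levelCard (r + 1) = k + 1 := ⟨_, (Nat.sub_add_cancel hpos).symm⟩
    rw [e, Finset.prod_union hd, ih (h.mono (by omega)), T.prod_level hp h, ← ENNReal.ofReal_mul
      (mul_nonneg (mul_nonneg (pow_nonneg (mul_nonneg hq p.2.1) _) (pow_nonneg (inv_nonneg.mpr hq) _))
        (pow_nonneg hq _)), ballSize_succ, hk, Nat.add_sub_cancel]
    congr 1
    generalize T.levelCard (r + 1 + 1) - 1 = l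
    have hinv := mul_inv_cancel₀ hq0
    generalize (1 - p : ℝ)⁻¹ = i at hinv ⊢
    generalize (1 - p : ℝ) = q at hinv ⊢
    linear_combination (-((q * p) ^ T.ballSize r * i ^ r * q ^ k * p ^ (k + 1) * q ^ l)) * hinv

theorem spineLaw_cylinder (hp : p ≠ 0) (hp1 : p ≠ 1) {T : PlanarTree} {r : ℕ}
    (h : T.HasSpine (r + 1)) :
    spineLaw p (cylinder T (r + 1)) =
      ENNReal.ofReal (((1 - p) * p : ℝ) ^ T.ballSize r * ((1 - p : ℝ)⁻¹) ^ r *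
        (1 - p : ℝ) ^ (T.levelCard (r + 1) - 1)) := by
  rw [← T.prod_ball hp hp1 h, spineLaw, Measure.map_apply measurable_spineTree
    (isOpen_cylinder T (by omega)).measurableSet, ← Measure.infinitePi_pi]
  · congr 1
    ext ω
    rw [Set.mem_preimage, cylinder, Set.mem_ofPred_eq, ball_eq_spineTree_iff]
    simp [Set.mem_pi]
  · exact fun _ _ => MeasurableSet.of_discrete

theorem tsum_list_append {α : Type*} (f : List α → ℝ≥0∞) :
    ∑' l, f l = f [] + ∑' l : List α, ∑' a, f (l ++ [a]) := by
  have e : Function.Involutive (List.reverse : List α → List α) := List.reverse_reverse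
  rw [← (e.toPerm _).tsum_eq f, tsum_list, ENNReal.tsum_prod', ENNReal.tsum_comm,
    ← (e.toPerm _).tsum_eq fun l => ∑' a, f (l ++ [a])]
  simp

theorem tsum_measure_lt {α : Type*} [MeasurableSpace α] [DiscreteMeasurableSpace α] (ν : Measure α)
    (f : α → ℕ) : ∑' n : ℕ, ν {a | n < f a} = ∫⁻ a, f a ∂ν := by
  have e : ∀ a, (f a : ℝ≥0∞) = ∑' n : ℕ, {a | n < f a}.indicator 1 a := by
    intro a
    rw [tsum_eq_sum (s := Finset.range (f a))]
    · rw [Finset.sum_congr rfl fun n hn => Set.indicator_of_mem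
        (show a ∈ {a | n < f a} from Finset.mem_range.mp hn) 1]
      simp
    · intro n hn
      exact Set.indicator_of_notMem
        (show a ∉ {a | n < f a} from fun h => hn (Finset.mem_range.mpr h)) _
  simp only [e]
  rw [lintegral_tsum fun n => Measurable.of_discrete.aemeasurable]
  exact tsum_congr fun n => (lintegral_indicator_one MeasurableSet.of_discrete).symm

theorem lintegral_geometricMeasure (hp : p ≠ 0) :
    ∫⁻ k, (k : ℝ≥0∞) ∂geometricMeasure p = ENNReal.ofReal ((1 - p) / p) := by
  have h0 : (p : ℝ) ≠ 0 := fun h => hp (Subtype.ext h)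
  have hpos : (0 : ℝ) < p := lt_of_le_of_ne p.2.1 h0.symm
  have h1 : ‖(1 - p : ℝ)‖ < 1 := by
    rw [Real.norm_of_nonneg (by have := p.2.2; linarith)]
    linarith
  have hs := (hasSum_coe_mul_geometric_of_norm_lt_one h1).mul_right (p : ℝ)
  rw [lintegral_countable']
  simp only [geometricMeasure_singleton hp, ← ENNReal.ofReal_natCast]
  have hn : ∀ n : ℕ, 0 ≤ (n : ℝ) * (1 - p : ℝ) ^ n * p := fun n => by
    rw [mul_assoc]
    exact mul_nonneg (Nat.cast_nonneg n) (geometricMeasure_nonneg p n)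
  simp only [← ENNReal.ofReal_mul (Nat.cast_nonneg _), ← mul_assoc]
  rw [← ENNReal.ofReal_tsum_of_nonneg hn hs.summable, hs.tsum_eq]
  rw [sub_sub_cancel]
  field_simp

/-- The mean number of vertices on level `r`. -/
def meanLevel (p : unitInterval) (r : ℕ) : ℝ≥0∞ := ∫⁻ T, (T.levelCard r : ℝ≥0∞) ∂spineLaw p

/-- The probability that `w` is a vertex. -/
def vertexProb (p : unitInterval) (w : List ℕ) : ℝ≥0∞ :=
  ∏ i ∈ Finset.range w.length, geometricMeasure p {k | w.getD i 0 < spineOffspring (w.take i) k}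

theorem vertexProb_append (p : unitInterval) (w : List ℕ) (n : ℕ) :
    vertexProb p (w ++ [n]) = vertexProb p w * geometricMeasure p {k | n < spineOffspring w k} := by
  rw [vertexProb, List.length_append, List.length_singleton, Finset.prod_range_succ, vertexProb]
  congr 1
  · refine Finset.prod_congr rfl fun i hi => ?_
    have hi' := Finset.mem_range.mp hi
    rw [List.getD_append _ _ _ _ hi', List.take_append_of_le_length hi'.le]
  · rw [List.getD_append_right _ _ _ _ le_rfl, List.take_append_of_le_length le_rfl]
    simp

theorem vertexProb_replicate (p : unitInterval) (n : ℕ) :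
    vertexProb p (List.replicate n 0) = 1 := by
  induction n with
  | zero => simp [vertexProb]
  | succ n ih =>
    rw [List.replicate_succ', vertexProb_append, ih, one_mul]
    simp [spineOffspring_replicate_pos]

/-- Being a vertex constrains the offspring numbers of the proper prefixes; these are distinct
coordinates, hence independent. -/
theorem measure_mem_spineTree (p : unitInterval) (w : List ℕ) :
    (Measure.infinitePi fun _ : List ℕ => geometricMeasure p) {ω | w ∈ (spineTree ω).verts} =
      vertexProb p w := by
  classical
  have hinj : Set.InjOn (fun i => w.take i) (Finset.range w.length : Set ℕ) := by
    intro i hi j hj h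
    have h1 := congrArg List.length h
    simp only [List.length_take, Finset.coe_range, Set.mem_Iio] at h1 hi hj
    omega
  have e : {ω | w ∈ (spineTree ω).verts} =
      Set.pi ((Finset.range w.length).image fun i => w.take i : Finset (List ℕ))
        fun v => {k | w.getD v.length 0 < spineOffspring v k} := by
    ext ω
    simp only [Set.mem_ofPred_eq, mem_spineTree, Set.mem_pi, Finset.coe_image, Finset.coe_range,
      Set.mem_image, Set.mem_Iio]
    constructor
    · rintro h _ ⟨i, hi, rfl⟩
      rw [List.length_take, min_eq_left hi.le]
      exact h i hi
    · intro h i hi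
      have := h _ ⟨i, hi, rfl⟩
      rwa [List.length_take, min_eq_left hi.le] at this
  rw [e, Measure.infinitePi_pi _ fun _ _ => MeasurableSet.of_discrete, Finset.prod_image hinj,
    vertexProb]
  refine Finset.prod_congr rfl fun i hi => ?_
  rw [List.length_take, min_eq_left (Finset.mem_range.mp hi).le]

theorem meanLevel_eq_tsum (p : unitInterval) (r : ℕ) :
    meanLevel p r = ∑' w : List ℕ, if w.length = r then vertexProb p w else 0 := by
  classical
  have hm : Measurable fun T : PlanarTree => (T.levelCard r : ℝ≥0∞) := by
    have := ENNReal.measurable_ofReal.comp (continuous_levelCard r).measurable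
    simpa [Function.comp_def] using this
  have e : ∀ T : PlanarTree, (T.levelCard r : ℝ≥0∞) =
      ∑' w : List ℕ, if w.length = r then {T : PlanarTree | w ∈ T.verts}.indicator 1 T else 0 := by
    intro T
    have h1 : ((T.level r).encard : ℝ≥0∞) = T.levelCard r := by
      rw [levelCard, ← (T.level_finite r).cast_ncard_eq]
      simp
    rw [← h1, ← ENNReal.tsum_set_one, tsum_subtype (T.level r) fun _ => (1 : ℝ≥0∞)]
    refine tsum_congr fun w => ?_
    simp only [Set.indicator, level, Set.mem_ofPred_eq, Pi.one_apply]
    by_cases h1 : w ∈ T.verts <;> by_cases h2 : w.length = r <;> simp [h1, h2]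
  have hv : ∀ w : List ℕ, MeasurableSet {ω | w ∈ (spineTree ω).verts} := by
    intro w
    simp only [mem_spineTree, Set.ofPred_forall]
    refine MeasurableSet.iInter fun i => MeasurableSet.iInter fun _ => ?_
    have h : MeasurableSet {k | w.getD i 0 < spineOffspring (w.take i) k} := .of_discrete
    exact (measurable_pi_apply (w.take i) : Measurable fun ω : List ℕ → ℕ => ω (w.take i)) h
  rw [meanLevel, spineLaw, lintegral_map hm measurable_spineTree]
  simp only [e]
  rw [lintegral_tsum]
  · refine tsum_congr fun w => ?_
    split_ifs
    · rw [← measure_mem_spineTree, ← lintegral_indicator_one (hv w)]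
      rfl
    · exact lintegral_zero
  · intro w
    split_ifs
    · exact (measurable_one.indicator (hv w)).aemeasurable
    · exact aemeasurable_const

theorem tsum_geometricMeasure_lt (p : unitInterval) {w : List ℕ} (hw : w ≠ []) :
    ∑' n : ℕ, geometricMeasure p {k | n < spineOffspring w k} =
      (∫⁻ k, (k : ℝ≥0∞) ∂geometricMeasure p) +
        if w = List.replicate w.length 0 then 1 else 0 := by
  rw [tsum_measure_lt]
  simp only [spineOffspring, if_neg hw]
  split_ifs
  · simp only [Nat.cast_add, Nat.cast_one]
    rw [lintegral_add_right _ measurable_const]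
    simp
  · rw [add_zero]

/-- Each vertex has the geometric mean number of offspring on average; the vertex on the leftmost
path, present with probability one, has one more. -/
theorem meanLevel_add_two (p : unitInterval) (r : ℕ) :
    meanLevel p (r + 2) =
      (∫⁻ k, (k : ℝ≥0∞) ∂geometricMeasure p) * meanLevel p (r + 1) + 1 := by
  rw [meanLevel_eq_tsum, tsum_list_append, if_neg (by simp), zero_add, meanLevel_eq_tsum]
  have e : ∀ w : List ℕ, (∑' n : ℕ, if (w ++ [n]).length = r + 2 then vertexProb p (w ++ [n]) else 0) =
      (∫⁻ k, (k : ℝ≥0∞) ∂geometricMeasure p) *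
        (if w.length = r + 1 then vertexProb p w else 0) +
      if w = List.replicate (r + 1) 0 then 1 else 0 := by
    intro w
    by_cases hl : w.length = r + 1
    · have hw : w ≠ [] := by rintro rfl; simp at hl
      have h2 : ∀ n : ℕ, (w ++ [n]).length = r + 2 := fun n => by simp [hl]
      simp only [h2, if_true, hl, vertexProb_append]
      rw [ENNReal.tsum_mul_left, tsum_geometricMeasure_lt p hw, mul_add, mul_comm, hl]
      congr 1
      split_ifs with h
      · rw [h, vertexProb_replicate, mul_one]
      · exact mul_zero _
    · have h3 : w ≠ List.replicate (r + 1) 0 := by rintro rfl; simp at hl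
      simp [hl, h3]
  simp only [e]
  rw [ENNReal.tsum_add, ENNReal.tsum_mul_left, tsum_ite_eq]

theorem meanLevel_succ (hp : p ≠ 0) (r : ℕ) :
    meanLevel p (r + 1) = ENNReal.ofReal (∑ i ∈ Finset.range (r + 1), ((1 - p) / p : ℝ) ^ i) := by
  have hm : (0 : ℝ) ≤ (1 - p) / p := div_nonneg (by have := p.2.2; linarith) p.2.1
  induction r with
  | zero => simp [meanLevel, levelCard_one]
  | succ r ih =>
    rw [meanLevel_add_two, ih, lintegral_geometricMeasure hp, ← ENNReal.ofReal_mul hm,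
      ← ENNReal.ofReal_one, ← ENNReal.ofReal_add (by positivity) zero_le_one,
      geom_sum_succ (n := r + 1)]

theorem lintegral_levelCard_ne_top (hp : p ≠ 0) (r : ℕ) : meanLevel p r ≠ ⊤ := by
  cases r with
  | zero => simp [meanLevel, levelCard_zero]
  | succ r => rw [meanLevel_succ hp]; exact ENNReal.ofReal_ne_top

theorem integrable_levelCard (hp : p ≠ 0) (r : ℕ) :
    Integrable (fun T : PlanarTree => (T.levelCard r : ℝ)) (spineLaw p) := by
  refine ⟨(continuous_levelCard r).measurable.aestronglyMeasurable, ?_⟩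
  rw [hasFiniteIntegral_iff_ofReal (Eventually.of_forall fun T => Nat.cast_nonneg _)]
  simp only [ENNReal.ofReal_natCast]
  exact (lintegral_levelCard_ne_top hp r).lt_top

theorem integral_levelCard_succ (hp : p ≠ 0) (r : ℕ) :
    ∫ T : PlanarTree, (T.levelCard (r + 1) : ℝ) ∂spineLaw p =
      ∑ i ∈ Finset.range (r + 1), ((1 - p) / p : ℝ) ^ i := by
  have hm : (0 : ℝ) ≤ (1 - p) / p := div_nonneg (by have := p.2.2; linarith) p.2.1
  rw [integral_eq_lintegral_of_nonneg_ae (Eventually.of_forall fun T => Nat.cast_nonneg _)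
    (continuous_levelCard _).measurable.aestronglyMeasurable]
  simp only [ENNReal.ofReal_natCast]
  rw [← meanLevel, meanLevel_succ hp, ENNReal.toReal_ofReal (by positivity)]

theorem integrable_ballSize (hp : p ≠ 0) (r : ℕ) :
    Integrable (fun T : PlanarTree => (T.ballSize r : ℝ)) (spineLaw p) := by
  simp only [ballSize_eq_sum, Nat.cast_sum]
  exact integrable_finsetSum _ fun j _ => integrable_levelCard hp _

theorem integral_ballSize (hp : p ≠ 0) (r : ℕ) :
    ∫ T : PlanarTree, (T.ballSize r : ℝ) ∂spineLaw p =
      ∑ j ∈ Finset.range r, ∑ i ∈ Finset.range (j + 1), ((1 - p) / p : ℝ) ^ i := by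
  simp only [ballSize_eq_sum, Nat.cast_sum]
  rw [integral_finsetSum _ fun j _ => integrable_levelCard hp _]
  exact Finset.sum_congr rfl fun j _ => integral_levelCard_succ hp j

end PlanarTree

end

/-! ### Identification of the local limit and the expansions -/

noncomputable section

namespace PlanarTree

open ProbabilityTheory

theorem inv_exp_mem {μ : ℝ} (hμ : 2 ≤ Real.exp (-μ)) :
    1 - (Real.exp (-μ))⁻¹ ∈ unitInterval := by
  have h := inv_le_half hμ
  have h0 : 0 < (Real.exp (-μ))⁻¹ := by positivity
  constructor <;> linarith

/-- The success probability of the geometric offspring distribution. -/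
def successProb {μ : ℝ} (hμ : 2 ≤ Real.exp (-μ)) : unitInterval :=
  ⟨1 - (Real.exp (-μ))⁻¹, inv_exp_mem hμ⟩

theorem one_sub_successProb {μ : ℝ} (hμ : 2 ≤ Real.exp (-μ)) :
    (1 - successProb hμ : ℝ) = (Real.exp (-μ))⁻¹ := sub_sub_cancel _ _

theorem successProb_ne_zero {μ : ℝ} (hμ : 2 ≤ Real.exp (-μ)) : successProb hμ ≠ 0 := by
  intro h
  have h1 := one_sub_successProb hμ
  rw [h] at h1
  have h2 := inv_le_half hμ
  rw [← h1] at h2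
  norm_num at h2

theorem successProb_ne_one {μ : ℝ} (hμ : 2 ≤ Real.exp (-μ)) : successProb hμ ≠ 1 := by
  intro h
  have h1 := one_sub_successProb hμ
  rw [h] at h1
  have h0 : 0 < (Real.exp (-μ))⁻¹ := by positivity
  rw [← h1] at h0
  norm_num at h0

theorem successProb_ratio {μ : ℝ} (hμ : 2 ≤ Real.exp (-μ)) :
    ((1 - successProb hμ) / successProb hμ : ℝ) = offspringMean μ := by
  rw [one_sub_successProb, offspringMean_eq hμ]
  rfl

theorem isLocalLimit_spineLaw {μ : ℝ} (hμ : 2 ≤ Real.exp (-μ)) :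
    IsLocalLimit μ (spineLaw (successProb hμ)) := by
  refine ⟨inferInstance, fun F => ?_⟩
  -- Ω_0 is empty, so the sequence is shifted by one.
  have hprob : ∀ N : ℕ, IsProbabilityMeasure (finiteSizeMeasure μ (N + 1)) := fun N =>
    isProbabilityMeasure_finiteSizeMeasure hμ (by omega)
  let ν : ProbabilityMeasure PlanarTree := ⟨spineLaw (successProb hμ), inferInstance⟩
  let νs : ℕ → ProbabilityMeasure PlanarTree := fun N => ⟨finiteSizeMeasure μ (N + 1), hprob N⟩
  have hlim : Tendsto νs atTop (𝓝 ν) := by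
    refine tendsto_of_cylinder fun r T => ?_
    by_cases h : T.HasSpine (r + 1)
    · right
      have h1 := (tendsto_add_atTop_iff_nat 1).mpr (tendsto_finiteSizeMeasure_cylinder hμ r h)
      have h2 := spineLaw_cylinder (successProb_ne_zero hμ) (successProb_ne_one hμ) h
      rw [one_sub_successProb, inv_inv] at h2
      change Tendsto _ _ (𝓝 (spineLaw (successProb hμ) (cylinder T (r + 1))))
      rw [h2]
      exact h1
    · exact Or.inl (spineLaw_cylinder_of_not_hasSpine _ h)
  exact (tendsto_add_atTop_iff_nat 1).mp
    (ProbabilityMeasure.tendsto_iff_forall_integral_tendsto.mp hlim F)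

/-- Bounded continuous functions separate finite Borel measures on a metric space; claims about any
local limit thereby reduce to `spineLaw`. -/
theorem IsLocalLimit.unique {μ : ℝ} {τ τ' : Measure PlanarTree} (h : IsLocalLimit μ τ)
    (h' : IsLocalLimit μ τ') : τ = τ' := by
  have := h.1
  have := h'.1
  exact ext_of_forall_integral_eq_of_IsFiniteMeasure fun F =>
    tendsto_nhds_unique (h.2 F) (h'.2 F)

/-- The expected sizes of the levels and balls in the local limit. -/
theorem IsLocalLimit.expectations {μ : ℝ} (hμ : 2 ≤ Real.exp (-μ)) {τ : Measure PlanarTree}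
    (h : IsLocalLimit μ τ) :
    (∀ r : ℕ, Integrable (fun T : PlanarTree => (T.levelCard r : ℝ)) τ ∧
      Integrable (fun T : PlanarTree => (T.ballSize r : ℝ)) τ) ∧
    (∀ r : ℕ, 1 ≤ r → ∫ T, (T.levelCard r : ℝ) ∂τ = ∑ i ∈ Finset.range r, offspringMean μ ^ i) ∧
    ∀ r : ℕ, ∫ T, (T.ballSize r : ℝ) ∂τ =
      ∑ j ∈ Finset.range r, ∑ i ∈ Finset.range (j + 1), offspringMean μ ^ i := by
  have hp := successProb_ne_zero hμ
  rw [h.unique (isLocalLimit_spineLaw hμ), ← successProb_ratio hμ]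
  refine ⟨fun r => ⟨integrable_levelCard hp r, integrable_ballSize hp r⟩, fun r hr => ?_,
    integral_ballSize hp⟩
  obtain ⟨r, rfl⟩ := Nat.exists_eq_add_of_le' hr
  exact integral_levelCard_succ hp r

theorem sum_geom_sum (m : ℝ) (hm : m ≠ 1) (r : ℕ) :
    ∑ j ∈ Finset.range r, ∑ i ∈ Finset.range (j + 1), m ^ i =
      r / (1 - m) - m * (1 - m ^ r) / (1 - m) ^ 2 := by
  have h1 : 1 - m ≠ 0 := sub_ne_zero.mpr hm.symm
  induction r with
  | zero => simp
  | succ r ih =>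
    rw [Finset.sum_range_succ, ih, geom_sum_eq hm, ← neg_sub 1 m, ← neg_sub 1 (m ^ (r + 1)),
      neg_div_neg_eq]
    push_cast
    field_simp
    ring

theorem two_lt_exp_neg {μ : ℝ} (hμ : μ < -Real.log 2) : 2 < Real.exp (-μ) := by
  rw [← Real.log_lt_iff_lt_exp two_pos]
  linarith

end PlanarTree

end

theorem mainTheorem10 :
    (∀ μ : ℝ, μ < -Real.log 2 →
      (∃ τ : Measure PlanarTree, PlanarTree.IsLocalLimit μ τ) ∧
      (0 < PlanarTree.offspringMean μ ∧ PlanarTree.offspringMean μ < 1 ∧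
        PlanarTree.offspringMean μ =
          PlanarTree.generatingFunction (PlanarTree.criticalPoint μ) /
            (1 - PlanarTree.generatingFunction (PlanarTree.criticalPoint μ))) ∧
      ∀ τ : Measure PlanarTree, PlanarTree.IsLocalLimit μ τ →
        (∀ r : ℕ, Integrable (fun T : PlanarTree => (T.levelCard r : ℝ)) τ ∧
          Integrable (fun T : PlanarTree => (T.ballSize r : ℝ)) τ) ∧
        (∃ C : ℝ, ∀ r : ℕ, 1 ≤ r →
          |(∫ T, (T.levelCard r : ℝ) ∂τ) - 1 / (1 - PlanarTree.offspringMean μ)| ≤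
            C * PlanarTree.offspringMean μ ^ (r - 1)) ∧
        (∃ C : ℝ, ∀ r : ℕ, 1 ≤ r →
          |(∫ T, (T.ballSize r : ℝ) ∂τ) - (r : ℝ) / (1 - PlanarTree.offspringMean μ)| ≤ C)) ∧
    ((∃ τ : Measure PlanarTree, PlanarTree.IsLocalLimit (-Real.log 2) τ) ∧
      ∀ τ : Measure PlanarTree, PlanarTree.IsLocalLimit (-Real.log 2) τ →
        (∀ r : ℕ, Integrable (fun T : PlanarTree => (T.levelCard r : ℝ)) τ ∧
          Integrable (fun T : PlanarTree => (T.ballSize r : ℝ)) τ) ∧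
        (∀ r : ℕ, 1 ≤ r → (∫ T, (T.levelCard r : ℝ) ∂τ) = (r : ℝ)) ∧
        (∃ C : ℝ, ∀ r : ℕ, 1 ≤ r →
          |(∫ T, (T.ballSize r : ℝ) ∂τ) - (r : ℝ) ^ 2 / 2| ≤ C * (r : ℝ))) := by
  constructor
  · intro μ hμ
    have hy := PlanarTree.two_lt_exp_neg hμ
    have hx0 : 0 < (Real.exp (-μ))⁻¹ := by positivity
    have hx : (Real.exp (-μ))⁻¹ < 1 / 2 := by
      rw [one_div]
      exact inv_strictAnti₀ two_pos hy
    have hm0 : 0 < PlanarTree.offspringMean μ := by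
      rw [PlanarTree.offspringMean_eq hy.le]
      exact div_pos hx0 (by linarith)
    have hm1 : PlanarTree.offspringMean μ < 1 := by
      rw [PlanarTree.offspringMean_eq hy.le, div_lt_one (by linarith)]
      linarith
    refine ⟨⟨_, PlanarTree.isLocalLimit_spineLaw hy.le⟩, ⟨hm0, hm1, ?_⟩, fun τ hτ => ?_⟩
    · rw [PlanarTree.offspringMean_eq hy.le, PlanarTree.criticalPoint_eq hy.le,
        PlanarTree.generatingFunction_eq hy.le]
    · obtain ⟨h1, h2, h3⟩ := hτ.expectations hy.le
      generalize PlanarTree.offspringMean μ = m at hm0 hm1 h2 h3 ⊢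
      have hm2 : 0 < 1 - m := sub_pos.mpr hm1
      -- The errors are exactly -m^r/(1 - m) and -m(1 - m^r)/(1 - m)².
      refine ⟨h1, ⟨m / (1 - m), fun r hr => ?_⟩, m / (1 - m) ^ 2, fun r _ => ?_⟩
      · rw [h2 r hr, geom_sum_eq hm1.ne, div_mul_eq_mul_div, ← pow_succ', Nat.sub_add_cancel hr]
        have e : (m ^ r - 1) / (m - 1) - 1 / (1 - m) = -(m ^ r / (1 - m)) := by
          rw [← neg_sub 1 m, ← neg_sub 1 (m ^ r), neg_div_neg_eq]
          ring
        rw [e, abs_neg, abs_of_nonneg (by positivity)]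
      · rw [h3 r, PlanarTree.sum_geom_sum m hm1.ne]
        have hmr : m ^ r ≤ 1 := pow_le_one₀ hm0.le hm1.le
        have hmr0 : 0 ≤ m ^ r := by positivity
        rw [sub_sub_cancel_left, abs_neg, abs_of_nonneg
          (div_nonneg (mul_nonneg hm0.le (by linarith)) (by positivity))]
        gcongr
        nlinarith
  · have hy : Real.exp (- -Real.log 2) = 2 := by rw [neg_neg, Real.exp_log two_pos]
    have hm : PlanarTree.offspringMean (-Real.log 2) = 1 := by
      rw [PlanarTree.offspringMean_eq hy.ge, hy]
      norm_num
    refine ⟨⟨_, PlanarTree.isLocalLimit_spineLaw hy.ge⟩, fun τ hτ => ?_⟩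
    obtain ⟨h1, h2, h3⟩ := hτ.expectations hy.ge
    rw [hm] at h2 h3
    -- For m = 1 the mean ball size is r(r + 1)/2, so the error is exactly r/2.
    refine ⟨h1, fun r hr => by simpa using h2 r hr, 1 / 2, fun r hr => ?_⟩
    clear hr
    have e : ∑ j ∈ Finset.range r, ∑ i ∈ Finset.range (j + 1), (1 : ℝ) ^ i =
        (r : ℝ) ^ 2 / 2 + 1 / 2 * r := by
      induction r with
      | zero => simp
      | succ r ih =>
        rw [Finset.sum_range_succ, ih]
        simp only [one_pow, Finset.sum_const, Finset.card_range, nsmul_eq_mul, mul_one]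
        push_cast
        ring
    rw [h3 r, e, add_sub_cancel_left, abs_of_nonneg (by positivity)]
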